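/- \textbf{Setting.} Let $n\ge 1$, let $\Theta\subset\mathbb R^n$ be compact and connected with $0$ in its interior, and let $H$ be a separable complex Hilbert space with non-negative sesquilinear forms $a_\theta,b_\theta$ ($\theta\in\Theta$; linear in the first, antilinear in the second argument; $s[u]:=s(u,u)$). The forms $(u,\tilde u)_\theta:=a_\theta(u,\tilde u)+b_\theta(u,\tilde u)$ are inner products equivalent to that of $H$; with $\|u\|_\theta:=(u,u)_\theta^{1/2}$ there are $K,L_a>0$ such that, for all $\theta_1,\theta_2\in\Theta$ and $u,\tilde u\in H$, $\|u\|_{\theta_1}\le K\|u\|_{\theta_2}$ and $|a_{\theta_1}(u,\tilde u)-a_{\theta_2}(u,\tilde u)|\le L_a|\theta_1-\theta_2|\,\|u\|_{\theta_1}\|\tilde u\|_{\theta_1}$. Let $\mathcal H$ be a separable complex Hilbert space with inner products $d_\theta$ ($\theta\in\Theta$), equivalent to that of $\mathcal H$, with $d_{\theta_1}[u]\le K_d\,d_{\theta_2}[u]$ for some $K_d>0$ and all $\theta_1,\theta_2\in\Theta$, $u\in\mathcal H$; let $H$ be a compactly embedded dense subspace of $\mathcal H$ with $d_\theta[u]\le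 b_\theta[u]$ for $u\in H$, $\theta\in\Theta$. Put $V_\theta:=\{v\in H: a_\theta[v]=0\}$ and $W_\theta:=\{w\in H:(w,v)_\theta=0\ \forall v\in V_\theta\}$. \textbf{Assumptions.} (H1) For every $\theta\in\Theta$ there is $\nu_\theta>0$ with $a_\theta[w]\ge\nu_\theta\|w\|_\theta^2$ for all $w\in W_\theta$. (H2) $V_\star$ is a closed subspace of $H$ such that, with $V^\star_\theta:=V_\theta$ for $\theta\ne0$ and $V^\star_0:=V_\star$, for some $L_\star\ge0$: $\inf_{v_2\in V^\star_{\theta_2}}\|v_1-v_2\|_{\theta_2}\le L_\star|\theta_1-\theta_2|\,\|v_1\|_{\theta_1}$ for all $\theta_1,\theta_2\in\Theta$, $v_1\in V^\star_{\theta_1}$. Moreover $Z$ is a closed subspace of $V_0$ with $V_0=V_\star\dot+Z$ (direct sum) and, for some $0\le K_Z<1$, $|(v,z)_0|\le K_Z\|v\|_0\|z\|_0$ for all $v\in V_\star$, $z\in Z$. (H3) There is $\gamma>0$ with $a_\theta[w]\ge\gamma|\theta|^2\|w\|_\theta^2$ for all $\theta\in\Theta$, $w\in W_\theta$. (H4)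 There are sesquilinear maps $a_0':V_0\times H\to\mathbb C^n$, $a_0'':V_0\times V_0\to\mathbb C^{n\times n}$ and constants $K_{a'},K_{a''}\ge 0$ with $|a_\theta(v,u)-a_0'(v,u)\cdot\theta|\le K_{a'}|\theta|^2\|v\|_0\|u\|_0$ and $|a_\theta(v,\tilde v)-a_0''(v,\tilde v)\theta\cdot\theta|\le K_{a''}|\theta|^3\|v\|_0\|\tilde v\|_0$ for all $v,\tilde v\in V_0$, $u\in H$, $\theta\in\Theta$. (H5) There is $L_b\ge0$ with $|b_\theta(v,\tilde v)-b_0(v,\tilde v)|\le L_b|\theta|\,\|v\|_0\|\tilde v\|_\theta$ for all $v,\tilde v\in V_0$, $\theta\in\Theta$. (H6) For $\theta\in\Theta$ there are linear bijections $\mathcal E_\theta:V_\star\to V_\theta^\star$ with $b_\theta(\mathcal E_\theta v,\mathcal E_\theta\tilde v)=b_0(v,\tilde v)$ and, for some $K_b\ge0$ independent of $\theta$, $|b_\theta(\mathcal E_\theta v,z)-b_0(v,z)|\le K_b|\theta|\,\|v\|_0\|z\|_0$ for all $v,\tilde v\in V_\star$, $z\in Z$, which extend to linear bijections $\mathcal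 E_\theta$ of $\mathcal H$ such that $d_\theta(\mathcal E_\theta u,\mathcal E_\theta\tilde u)=d_0(u,\tilde u)$ for all $u,\tilde u\in\mathcal H$, $\mathcal E_0=I$, and, for some $K_e\ge 0$, $d_{\theta_1}^{1/2}[(\mathcal E_{\theta_1}-\mathcal E_{\theta_2})u]\le K_e|\theta_1-\theta_2|\,d_0^{1/2}[u]$ for all $\theta_1,\theta_2\in\Theta$, $u\in\mathcal H$. \textbf{Operators.} For $0<\varepsilon<1$ and $\theta\in\Theta$ let $\mathcal L_{\varepsilon,\theta}$ be the self-adjoint operator in $(\mathcal H,d_\theta)$ generated by the closed form $\varepsilon^{-2}a_\theta+b_\theta$ with form domain $H$. For $\theta\in\mathbb R^n$ and $v\in V_0$ let $N_\theta v\in W_0$ be the solution of $a_0(N_\theta v,\tilde w)=-a_0'(v,\tilde w)\cdot\theta$ for all $\tilde w\in W_0$, and put $a^{\rm h}_\theta(v,\tilde v):=a_0''(v,\tilde v)\theta\cdot\theta-a_0(N_\theta v,N_\theta\tilde v)$. For $\xi\in\mathbb R^n$ let $\mathbb L_\xi$ be the self-adjoint operator in $\mathcal H_0:=(\overline{V_\star\dot+Z},d_0)$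 (closure in $\mathcal H$) generated by the form $a^{\rm h}_\xi(z,\tilde z)+b_0(v+z,\tilde v+\tilde z)$, $v,\tilde v\in V_\star$, $z,\tilde z\in Z$, with form domain $V_\star\dot+Z$. \textbf{Theorem.} Under these assumptions: (i) There is $C>0$, independent of $\varepsilon$, such that for all $0<\varepsilon<1$ $$\mathrm{dist}_H\Big(\bigcup_{\theta\in\Theta}\mathrm{Sp}\,\mathcal L_{\varepsilon,\theta}^{-1}\cup\{0\},\ \bigcup_{\xi\in\mathbb R^n}\mathrm{Sp}\,\mathbb L_\xi^{-1}\cup\{0\}\Big)\le C\varepsilon,$$ where $\mathrm{dist}_H$ is the symmetric Hausdorff distance. (ii) There is a constant $C$ and, for every $b\in\mathbb R$, a constant $0\le C_b\le C(1+b^2)$ such that for all $a\le b$ and all $0<\varepsilon<1$ $$\mathrm{dist}_{[a,b]}\Big(\overline{\bigcup_{\theta\in\Theta}\mathrm{Sp}\,\mathcal L_{\varepsilon,\theta}},\ \overline{\bigcup_{\xi\in\mathbb R^n}\mathrm{Sp}\,\mathbb L_\xi}\Big)\le C_b\,\varepsilon,$$ where $\mathrm{dist}_{[a,b]}(X,Y):=\max\{\mathrm{dist}([a,b]\cap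 X,Y),\mathrm{dist}([a,b]\cap Y,X)\}$, $\mathrm{dist}(X,Y):=\sup_{x\in X}\inf_{y\in Y}|x-y|$ and $\mathrm{dist}(\emptyset,A)=\mathrm{dist}(A,\emptyset):=0$. -/

import Mathlib

open scoped ENNReal ComplexConjugate

noncomputable section

namespace DegenerateForms

/-- Sesquilinear forms, linear in the first argument and antilinear in the second. -/
abbrev SForm (X : Type*) [AddCommGroup X] [Module ℂ X] : Type _ :=
  X →ₗ[ℂ] X →ₗ⋆[ℂ] ℂ

/-- Non-negative sesquilinear forms: `form u u` is a non-negative real number for all `u`. -/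
structure NonnegForm (X : Type*) [AddCommGroup X] [Module ℂ X] where
  form : SForm X
  nonneg : ∀ u, 0 ≤ (form u u).re ∧ (form u u).im = 0

namespace NonnegForm

variable {X : Type*} [AddCommGroup X] [Module ℂ X]

/-- The quadratic form of a non-negative sesquilinear form, as a real number. -/
def quad (s : NonnegForm X) (u : X) : ℝ := (s.form u u).re

theorem conj_symm (s : NonnegForm X) (u v : X) : s.form v u = conj (s.form u v) := by
  have h1 := (s.nonneg (u + v)).2
  have h2 := (s.nonneg (u + Complex.I • v)).2
  have hu := (s.nonneg u).2
  have hv := (s.nonneg v).2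
  simp only [map_add, LinearMap.add_apply, LinearMap.map_smulₛₗ, LinearMap.smul_apply,
    smul_eq_mul, Complex.add_im, Complex.mul_im, Complex.I_re, Complex.I_im, RingHom.id_apply,
    Complex.conj_I, Complex.neg_re, Complex.neg_im, Complex.add_re, Complex.mul_re] at h1 h2
  apply Complex.ext
  · simp only [Complex.conj_re]; linarith
  · simp only [Complex.conj_im]; linarith

theorem form_eq_zero (s : NonnegForm X) {v : X} (hv : s.form v v = 0) (u : X) :
    s.form v u = 0 := by
  have hsymm := s.conj_symm v u
  set x : ℂ := s.form v u with hx
  have key : ∀ t : ℝ, 0 ≤ (s.form u u).re + 2 * t * Complex.normSq x := by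
    intro t
    have h := (s.nonneg (u + ((t : ℂ) * conj x) • v)).1
    simp only [map_add, LinearMap.add_apply, LinearMap.map_smulₛₗ, LinearMap.smul_apply,
      smul_eq_mul, RingHom.id_apply, hv, hsymm, ← hx, map_mul, Complex.conj_conj,
      Complex.conj_ofReal, mul_zero, add_zero] at h
    simp only [Complex.add_re, Complex.mul_re, Complex.mul_im, Complex.ofReal_re,
      Complex.ofReal_im, Complex.conj_re, Complex.conj_im] at h
    rw [Complex.normSq_apply]
    nlinarith [h]
  have h0 : Complex.normSq x = 0 := by
    by_contra hne
    have h := key (-((s.form u u).re + 1) / (2 * Complex.normSq x))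
    have h' : 2 * (-((s.form u u).re + 1) / (2 * Complex.normSq x)) * Complex.normSq x
        = -((s.form u u).re + 1) := by field_simp
    linarith
  exact Complex.normSq_eq_zero.mp h0

/-- The degeneracy subspace `{v | s[v] = 0}` of a non-negative form. -/
def degeneracy (s : NonnegForm X) : Submodule ℂ X where
  carrier := {v | s.form v v = 0}
  zero_mem' := by simp
  add_mem' := by
    intro v w hv hw
    change s.form v v = 0 at hv
    change s.form w w = 0 at hw
    change s.form (v + w) (v + w) = 0
    simp [s.form_eq_zero hv, s.form_eq_zero hw]
  smul_mem' := by
    intro c v hv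
    change s.form v v = 0 at hv
    change s.form (c • v) (c • v) = 0
    simp [hv]

end NonnegForm

/-! ### Operators generated by forms, and their spectra -/

section Operators

variable {Q X : Type*} [AddCommGroup Q] [Module ℂ Q]
  [NormedAddCommGroup X] [NormedSpace ℂ X]

/-- The operator in `X` (with inner product `d`) generated by the form `s` whose form domain `Q` is
embedded into `X` by the injective map `j` with dense range: `u` belongs to the operator domain and
is mapped to `g` iff `u = j q` with `s(q, q') = d(g, j q')` for all `q'` in the form domain. -/
def formOperator (j : Q →ₗ[ℂ] X) (s : SForm Q) (d : SForm X) : X →ₗ.[ℂ] X :=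
  Submodule.toLinearPMap
    { carrier := {p : X × X | ∃ q : Q, j q = p.1 ∧ ∀ q' : Q, s q q' = d p.2 (j q')}
      zero_mem' := ⟨0, by simp⟩
      add_mem' := by
        rintro p p' ⟨q, h1, h2⟩ ⟨q', h1', h2'⟩
        exact ⟨q + q', by simp [h1, h1'], fun r => by simp [h2, h2']⟩
      smul_mem' := by
        rintro c p ⟨q, h1, h2⟩
        exact ⟨c • q, by simp [h1], fun r => by simp [h2]⟩ }

/-- The spectrum of a (possibly unbounded) operator: the complement of the set of those `z` for
which `T - z` is a bijection from the domain of `T` onto `X` with a bounded inverse `R`. -/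
def spectrumOf (T : X →ₗ.[ℂ] X) : Set ℂ :=
  {z : ℂ | ∃ R : X →L[ℂ] X,
    (∀ g : X, ∃ h : R g ∈ T.domain, T ⟨R g, h⟩ - z • R g = g) ∧
    (∀ u : T.domain, R (T u - z • (u : X)) = u)}ᶜ

end Operators

/-! ### Distances between sets -/

/-- The non-symmetric distance `sup_{x ∈ X} dist(x, Y)`, with the convention that it is `0` as soon
as one of the two sets is empty. -/
def directedDist (X Y : Set ℂ) : ℝ≥0∞ :=
  ⨆ x ∈ X, ⨆ _ : Y.Nonempty, Metric.infEDist x Y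

/-- The distance between `X` and `Y` on the real interval `[a, b]`. -/
def distOn (a b : ℝ) (X Y : Set ℂ) : ℝ≥0∞ :=
  max (directedDist (((↑) : ℝ → ℂ) '' Set.Icc a b ∩ X) Y)
    (directedDist (((↑) : ℝ → ℂ) '' Set.Icc a b ∩ Y) X)

/-! ### The abstract setting -/

/-- The parameter space `ℝⁿ` with its Euclidean norm. -/
abbrev Param (n : ℕ) : Type := EuclideanSpace ℝ (Fin n)

/-- The data of the problem: the parameter set `Θ`, the forms `a_θ`, `b_θ` on `H`, the embedding of
`H` into `𝓗`, and the inner products `d_θ` on `𝓗`. Only the parameters in `Θ` matter. -/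
structure Model (n : ℕ) (H 𝓗 : Type*) [NormedAddCommGroup H] [InnerProductSpace ℂ H]
    [NormedAddCommGroup 𝓗] [InnerProductSpace ℂ 𝓗] where
  Θ : Set (Param n)
  a : Param n → NonnegForm H
  b : Param n → NonnegForm H
  ι : H →L[ℂ] 𝓗
  d : Param n → NonnegForm 𝓗

namespace Model

variable {n : ℕ} {H 𝓗 : Type*} [NormedAddCommGroup H] [InnerProductSpace ℂ H]
  [NormedAddCommGroup 𝓗] [InnerProductSpace ℂ 𝓗] (M : Model n H 𝓗)

/-- `(u, v)_θ = a_θ(u, v) + b_θ(u, v)`. -/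
def ip (θ : Param n) : SForm H := (M.a θ).form + (M.b θ).form

/-- `‖u‖_θ`, the norm of `(·, ·)_θ`. -/
def nrm (θ : Param n) (u : H) : ℝ := Real.sqrt ((M.a θ).quad u + (M.b θ).quad u)

/-- `V_θ = {v | a_θ[v] = 0}`. -/
def V (θ : Param n) : Submodule ℂ H := (M.a θ).degeneracy

/-- `W_θ`, the orthogonal complement of `V_θ` with respect to `(·, ·)_θ`. -/
def W (θ : Param n) : Submodule ℂ H where
  carrier := {w | ∀ v ∈ M.V θ, M.ip θ w v = 0}
  zero_mem' := by simp
  add_mem' := by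
    intro w w' h h' v hv
    simp [h v hv, h' v hv]
  smul_mem' := by
    intro c w h v hv
    simp [h v hv]

/-- Standing assumptions on `Θ`, `a_θ`, `b_θ`: `Θ` is compact, `(·, ·)_θ` are uniformly equivalent
inner products of the Hilbert space `H`, and `a_θ` is Lipschitz continuous in `θ`. -/
structure FormAssumptions : Prop where
  isCompact : IsCompact M.Θ
  equiv : ∀ θ ∈ M.Θ, ∃ c C : ℝ, 0 < c ∧ 0 < C ∧
    ∀ u : H, c * ‖u‖ ≤ M.nrm θ u ∧ M.nrm θ u ≤ C * ‖u‖
  unif_equiv : ∃ K : ℝ, 0 < K ∧ ∀ u : H, ∀ θ₁ ∈ M.Θ, ∀ θ₂ ∈ M.Θ, M.nrm θ₁ u ≤ K * M.nrm θ₂ u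
  lipschitz : ∃ L : ℝ, 0 < L ∧ ∀ u v : H, ∀ θ₁ ∈ M.Θ, ∀ θ₂ ∈ M.Θ,
    ‖(M.a θ₁).form u v - (M.a θ₂).form u v‖ ≤ L * ‖θ₁ - θ₂‖ * M.nrm θ₁ u * M.nrm θ₁ v

/-- Standing assumptions on `𝓗`: `d_θ` are uniformly equivalent inner products of the Hilbert space
`𝓗`, in which `H` is a compactly embedded dense subset, and `d_θ ≤ b_θ` on `H`. -/
structure AmbientAssumptions : Prop where
  equiv : ∀ θ ∈ M.Θ, ∃ c C : ℝ, 0 < c ∧ 0 < C ∧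
    ∀ u : 𝓗, c * ‖u‖ ^ 2 ≤ (M.d θ).quad u ∧ (M.d θ).quad u ≤ C * ‖u‖ ^ 2
  unif_equiv : ∃ K : ℝ, 0 < K ∧ ∀ u : 𝓗, ∀ θ₁ ∈ M.Θ, ∀ θ₂ ∈ M.Θ,
    (M.d θ₁).quad u ≤ K * (M.d θ₂).quad u
  injective : Function.Injective M.ι
  denseRange : DenseRange M.ι
  compact : IsCompactOperator M.ι
  le_b : ∀ u : H, ∀ θ ∈ M.Θ, (M.d θ).quad (M.ι u) ≤ (M.b θ).quad u

/-- (H1) The gap condition. -/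
def GapCondition : Prop :=
  ∀ θ ∈ M.Θ, ∃ ν : ℝ, 0 < ν ∧ ∀ w ∈ M.W θ, ν * M.nrm θ w ^ 2 ≤ (M.a θ).quad w

open Classical in
/-- `V_θ^⋆`, which is `V_θ` for `θ ≠ 0` and `V_⋆` for `θ = 0`. -/
def Vs (Vstar : Submodule ℂ H) (θ : Param n) : Submodule ℂ H :=
  if θ = 0 then Vstar else M.V θ

/-- (H2) `V_θ` has a removable singularity at `θ = 0`, with the closed subspace `V_⋆`. -/
structure RemovableSingularity (Vstar : Submodule ℂ H) : Prop where
  isClosed : IsClosed (Vstar : Set H)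
  lipschitz : ∃ L : ℝ, 0 ≤ L ∧ ∀ θ₁ ∈ M.Θ, ∀ θ₂ ∈ M.Θ, ∀ v₁ ∈ M.Vs Vstar θ₁,
    ⨅ v₂ : M.Vs Vstar θ₂, M.nrm θ₂ (v₁ - (v₂ : H)) ≤ L * ‖θ₁ - θ₂‖ * M.nrm θ₁ v₁

/-- `Z` is a defect subspace: a closed subspace of `V_0` with `V_0 = V_⋆ ∔ Z`, the direct sum being
transversal. -/
structure IsDefectSubspace (Vstar : Submodule ℂ H) (Z : Submodule ℂ (M.V 0)) : Prop where
  isClosed : IsClosed (Z : Set (M.V 0))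
  sup_eq : Vstar ⊔ Z.map (M.V 0).subtype = M.V 0
  inf_eq : Vstar ⊓ Z.map (M.V 0).subtype = ⊥
  transversal : ∃ K : ℝ, 0 ≤ K ∧ K < 1 ∧ ∀ v ∈ Vstar, ∀ z ∈ Z,
    ‖M.ip 0 v (z : H)‖ ≤ K * M.nrm 0 v * M.nrm 0 (z : H)

/-- (H3) The gap degenerates at most quadratically. -/
def QuadraticGap : Prop :=
  ∃ γ : ℝ, 0 < γ ∧ ∀ θ ∈ M.Θ, ∀ w ∈ M.W θ, γ * ‖θ‖ ^ 2 * M.nrm θ w ^ 2 ≤ (M.a θ).quad w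

/-- Vector-valued sesquilinear maps `a'_0 : V_0 × H → ℂⁿ`. -/
abbrev FirstOrder : Type _ := M.V 0 →ₗ[ℂ] H →ₗ⋆[ℂ] (Fin n → ℂ)

/-- Matrix-valued sesquilinear maps `a''_0 : V_0 × V_0 → ℂⁿˣⁿ`. -/
abbrev SecondOrder : Type _ := M.V 0 →ₗ[ℂ] M.V 0 →ₗ⋆[ℂ] Matrix (Fin n) (Fin n) ℂ

/-- `x · θ` for `x ∈ ℂⁿ` and `θ ∈ ℝⁿ`. -/
def dotp (x : Fin n → ℂ) (θ : Param n) : ℂ := ∑ i, x i * (θ i : ℂ)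

/-- `A θ · θ` for `A ∈ ℂⁿˣⁿ` and `θ ∈ ℝⁿ`. -/
def quadp (A : Matrix (Fin n) (Fin n) ℂ) (θ : Param n) : ℂ :=
  ∑ i, ∑ j, A i j * (θ j : ℂ) * (θ i : ℂ)

/-- (H4) The differentiability of `a_θ` at `θ = 0`, with the derivatives `a'_0` and `a''_0`. -/
structure Differentiability (a' : M.FirstOrder) (a'' : M.SecondOrder) : Prop where
  first : ∃ K : ℝ, 0 ≤ K ∧ ∀ (v : M.V 0) (u : H), ∀ θ ∈ M.Θ,
    ‖(M.a θ).form v u - dotp (a' v u) θ‖ ≤ K * ‖θ‖ ^ 2 * M.nrm 0 v * M.nrm 0 u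
  second : ∃ K : ℝ, 0 ≤ K ∧ ∀ v v' : M.V 0, ∀ θ ∈ M.Θ,
    ‖(M.a θ).form v v' - quadp (a'' v v') θ‖ ≤ K * ‖θ‖ ^ 3 * M.nrm 0 v * M.nrm 0 v'

/-- (H5) `b_θ` is Lipschitz continuous at `θ = 0`. -/
def LipschitzAtZero : Prop :=
  ∃ L : ℝ, 0 ≤ L ∧ ∀ v v' : M.V 0, ∀ θ ∈ M.Θ,
    ‖(M.b θ).form v v' - (M.b 0).form v v'‖ ≤ L * ‖θ‖ * M.nrm 0 v * M.nrm θ v'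

/-- (H6) There are bijections `T θ : V_⋆ → V_θ^⋆` with the two defining properties of transfer
operators (`b`-isometry and closeness to the identity when tested on `Z`), which extend to
bijections `E θ` of `𝓗` that are isometric from `d_0` to `d_θ` and Lipschitz in `θ`, with
`E 0 = I`. -/
def TransferExtends (Vstar : Submodule ℂ H) (Z : Submodule ℂ (M.V 0)) : Prop :=
  ∃ (T : Param n → Vstar →ₗ[ℂ] H) (E : Param n → 𝓗 ≃ₗ[ℂ] 𝓗),
    (∀ θ ∈ M.Θ, Function.Injective (T θ) ∧ LinearMap.range (T θ) = M.Vs Vstar θ) ∧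
    (∀ θ ∈ M.Θ, ∀ v v' : Vstar, (M.b θ).form (T θ v) (T θ v') = (M.b 0).form v v') ∧
    (∃ K : ℝ, 0 ≤ K ∧ ∀ θ ∈ M.Θ, ∀ v : Vstar, ∀ z ∈ Z,
      ‖(M.b θ).form (T θ v) (z : H) - (M.b 0).form v (z : H)‖
        ≤ K * ‖θ‖ * M.nrm 0 v * M.nrm 0 (z : H)) ∧
    (∀ θ ∈ M.Θ, ∀ v : Vstar, E θ (M.ι v) = M.ι (T θ v)) ∧
    (∀ θ ∈ M.Θ, ∀ u u' : 𝓗, (M.d θ).form (E θ u) (E θ u') = (M.d 0).form u u') ∧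
    (∀ u : 𝓗, E 0 u = u) ∧
    (∃ K : ℝ, 0 ≤ K ∧ ∀ θ₁ ∈ M.Θ, ∀ θ₂ ∈ M.Θ, ∀ u : 𝓗,
      Real.sqrt ((M.d θ₁).quad (E θ₁ u - E θ₂ u))
        ≤ K * ‖θ₁ - θ₂‖ * Real.sqrt ((M.d 0).quad u))

/-! ### The operators -/

/-- The form `A_{ε,θ} = ε⁻² a_θ + b_θ`. -/
def formA (ε : ℝ) (θ : Param n) : SForm H :=
  ((ε : ℂ) ^ 2)⁻¹ • (M.a θ).form + (M.b θ).form

/-- The self-adjoint operator `L_{ε,θ}` in `(𝓗, d_θ)` generated by `A_{ε,θ}`. -/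
def opL (ε : ℝ) (θ : Param n) : 𝓗 →ₗ.[ℂ] 𝓗 :=
  formOperator (M.ι : H →ₗ[ℂ] 𝓗) (M.formA ε θ) (M.d θ).form

/-- `N` solves the linearised abstract cell problem at `θ`: for `v ∈ V_0`, the element `N v ∈ W_0`
satisfies `a_0(N v, w) = - a'_0(v, w) · θ` for all `w ∈ W_0`. -/
def IsCorrector (a' : M.FirstOrder) (θ : Param n) (N : M.V 0 →ₗ[ℂ] H) : Prop :=
  ∀ v : M.V 0, N v ∈ M.W 0 ∧ ∀ w ∈ M.W 0, (M.a 0).form (N v) w = -dotp (a' v w) θ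

open Classical in
/-- The operator `N_θ : V_0 → W_0`, the solution of the linearised abstract cell problem (which is
uniquely solvable under the gap condition and the differentiability of `a_θ`). -/
def corrector (a' : M.FirstOrder) (θ : Param n) : M.V 0 →ₗ[ℂ] H :=
  if h : ∃ N, M.IsCorrector a' θ N then h.choose else 0

/-- The homogenised form `a^h_θ(v, v') = a''_0(v, v')θ·θ - a_0(N_θ v, N_θ v')` on `V_0`. -/
def homForm (a' : M.FirstOrder) (a'' : M.SecondOrder) (θ : Param n) : SForm (M.V 0) :=
  LinearMap.mk₂'ₛₗ (RingHom.id ℂ) (starRingEnd ℂ)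
    (fun v v' => quadp (a'' v v') θ
      - (M.a 0).form (M.corrector a' θ v) (M.corrector a' θ v'))
    (by intro u v w; simp [quadp, add_mul, Finset.sum_add_distrib]; ring)
    (by intro c v w; simp [quadp, mul_sub, Finset.mul_sum, mul_assoc])
    (by intro u v w; simp [quadp, add_mul, Finset.sum_add_distrib]; ring)
    (by intro c v w; simp [quadp, mul_sub, Finset.mul_sum, mul_assoc])

/-- The map `(v, z) ↦ v + z` from `V_⋆ × Z` to `H`, whose range is `V_⋆ ∔ Z`. -/
def sumMap (Vstar : Submodule ℂ H) (Z : Submodule ℂ (M.V 0)) : (Vstar × Z) →ₗ[ℂ] H :=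
  Vstar.subtype.coprod ((M.V 0).subtype ∘ₗ Z.subtype)

/-- The form `S_ξ(v + z, v' + z') = a^h_ξ(z, z') + b_0(v + z, v' + z')` on `V_⋆ ∔ Z`. -/
def formS (Vstar : Submodule ℂ H) (Z : Submodule ℂ (M.V 0)) (a' : M.FirstOrder)
    (a'' : M.SecondOrder) (ξ : Param n) : SForm (Vstar × Z) :=
  LinearMap.mk₂'ₛₗ (RingHom.id ℂ) (starRingEnd ℂ)
    (fun p p' => M.homForm a' a'' ξ p.2 p'.2
      + (M.b 0).form (M.sumMap Vstar Z p) (M.sumMap Vstar Z p'))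
    (by intro u v w; simp; ring)
    (by intro c v w; simp [mul_add])
    (by intro u v w; simp; ring)
    (by intro c v w; simp [mul_add])

/-- The space `𝓗_0`, the closure of `V_⋆ ∔ Z` in `𝓗`. -/
def limitSpace (Vstar : Submodule ℂ H) (Z : Submodule ℂ (M.V 0)) : Submodule ℂ 𝓗 :=
  (LinearMap.range ((M.ι : H →ₗ[ℂ] 𝓗) ∘ₗ M.sumMap Vstar Z)).topologicalClosure

/-- The embedding of `V_⋆ ∔ Z` into `𝓗_0`. -/
def limitEmbedding (Vstar : Submodule ℂ H) (Z : Submodule ℂ (M.V 0)) :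
    (Vstar × Z) →ₗ[ℂ] M.limitSpace Vstar Z :=
  LinearMap.codRestrict _ ((M.ι : H →ₗ[ℂ] 𝓗) ∘ₗ M.sumMap Vstar Z)
    fun p => Submodule.le_topologicalClosure _ (LinearMap.mem_range_self _ p)

/-- The restriction of the inner product `d_0` to `𝓗_0`. -/
def limitInner (Vstar : Submodule ℂ H) (Z : Submodule ℂ (M.V 0)) :
    SForm (M.limitSpace Vstar Z) :=
  LinearMap.mk₂'ₛₗ (RingHom.id ℂ) (starRingEnd ℂ)
    (fun u u' => (M.d 0).form (u : 𝓗) (u' : 𝓗))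
    (by intro u v w; simp) (by intro c v w; simp)
    (by intro u v w; simp) (by intro c v w; simp)

/-- The self-adjoint operator `𝕃_ξ` in `(𝓗_0, d_0)` generated by `S_ξ`. -/
def opLimit (Vstar : Submodule ℂ H) (Z : Submodule ℂ (M.V 0)) (a' : M.FirstOrder)
    (a'' : M.SecondOrder) (ξ : Param n) :
    M.limitSpace Vstar Z →ₗ.[ℂ] M.limitSpace Vstar Z :=
  formOperator (M.limitEmbedding Vstar Z) (M.formS Vstar Z a' a'' ξ) (M.limitInner Vstar Z)

end Model

end DegenerateForms

end

/-! Both families are compared through their resolvents. Given `f`, let u solve the ε-problem at θ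
with right-hand side `E θ f`, and let v + z (v in `Vstar`, z in `Z`) solve the limit problem at ξ =
θ/ε with right-hand side `f`. The ansatz U = `T θ v` + z + N_θ z almost solves the ε-problem: tested
against the energy norm of ε⁻²a_θ + b_θ, its residual is O(ε)‖f‖. Hence u − U is O(ε) in energy and,
since d_θ ≤ b_θ, u differs from `E θ (v + z)` by O(ε) in 𝓗.

The residual is small because, for small θ, the sum V_θ^⋆ + Z + W_0 is dense in H and the components
v', z', w of a test function of energy norm D satisfy ‖v'‖ ≲ D, |θ|‖z'‖ ≲ εD and ‖w‖ ≲ εD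
(`test_bounds`, resting on `coercive_near`). On V_θ^⋆ the form a_θ vanishes and the transfer
isometries cancel the main terms; on Z the limit equation does so; on W_0 the cell problem removes
the first-order part of a_θ. The remainders (`residual_V`, `residual_Z`, `residual_W`) are
controlled by a priori bounds on |ξ|‖z‖ and |ξ|²‖z‖ (`limit_bounds`). These come from the
ellipticity of the homogenised form on Z, which is inherited from the coercivity of a_θ at θ = tξ as
t → 0.

Away from θ = 0 the gap makes W_θ-components O(ε), and the ε-problem reduces to the b_0-problem on
`Vstar` alone (`far_estimate`). For large ξ the limit problem reduces to the same problem, since ‖z‖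
= O(1/|ξ|) (`limit_far`). So when |θ| and ε|ξ| are both bounded below, the two resolvents are close
whether or not ξ = θ/ε; this takes care of those ξ for which εξ leaves Θ.

Conjugation with `E θ` makes both resolvents symmetric for d_0 on one space, so that their spectra
are as close as the operators (`exists_mem_spectrum_near`); this is (i). For (ii) the spectra lie in
[1, ∞) and inversion costs a factor of order b². When ε is not small compared with 1/b a crude bound
suffices, given a spectral point of bounded modulus in the other set. -/

open Filter

noncomputable section

namespace DegenerateForms

/-! ### Non-negative forms, the Lax–Milgram lemma and spectral perturbation. -/

section

namespace NonnegForm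

variable {X : Type*} [AddCommGroup X] [Module ℂ X]

theorem quad_nonneg (s : NonnegForm X) (u : X) : 0 ≤ s.quad u := (s.nonneg u).1

theorem form_self (s : NonnegForm X) (u : X) : s.form u u = (s.quad u : ℂ) := by
  apply Complex.ext
  · simp [quad]
  · simp [(s.nonneg u).2]

/-- The inner product space core of a non-negative form. -/
@[reducible]
def core (s : NonnegForm X) : PreInnerProductSpace.Core ℂ X where
  inner u v := s.form v u
  conj_inner_symm u v := (s.conj_symm u v).symm
  re_inner_nonneg u := (s.nonneg u).1
  add_left u v w := by simp
  smul_left u v c := by simp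

theorem norm_form_le (s : NonnegForm X) (u v : X) :
    ‖s.form u v‖ ≤ √(s.quad u) * √(s.quad v) := by
  let _ := s.core
  have h := InnerProductSpace.Core.norm_inner_le_norm (𝕜 := ℂ) (F := X) v u
  rw [mul_comm]
  exact h

theorem norm_form_sq_le (s : NonnegForm X) (u v : X) :
    ‖s.form u v‖ ^ 2 ≤ s.quad u * s.quad v := by
  have h := s.norm_form_le u v
  calc ‖s.form u v‖ ^ 2 ≤ (√(s.quad u) * √(s.quad v)) ^ 2 := by gcongr
    _ = _ := by rw [mul_pow, Real.sq_sqrt (s.quad_nonneg u), Real.sq_sqrt (s.quad_nonneg v)]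

theorem norm_form_le_of_quad_le (s : NonnegForm X) {u v : X} {p q : ℝ} (hp : 0 ≤ p) (hq : 0 ≤ q)
    (hu : s.quad u ≤ p ^ 2) (hv : s.quad v ≤ q ^ 2) : ‖s.form u v‖ ≤ p * q :=
  (s.norm_form_le u v).trans (mul_le_mul (Real.sqrt_le_iff.mpr ⟨hp, hu⟩)
    (Real.sqrt_le_iff.mpr ⟨hq, hv⟩) (Real.sqrt_nonneg _) hp)

theorem quad_add (s : NonnegForm X) (u v : X) :
    s.quad (u + v) = s.quad u + s.quad v + 2 * (s.form u v).re := by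
  have := s.conj_symm u v
  simp only [quad, map_add, LinearMap.add_apply, Complex.add_re, this, Complex.conj_re]
  ring

theorem quad_neg (s : NonnegForm X) (u : X) : s.quad (-u) = s.quad u := by simp [quad]

theorem quad_add_le (s : NonnegForm X) (u v : X) : s.quad (u + v) ≤ 2 * s.quad u + 2 * s.quad v := by
  have h1 := s.quad_add u v
  have h2 := s.quad_add u (-v)
  have h3 := s.quad_nonneg (u + -v)
  simp only [map_neg, Complex.neg_re, quad_neg] at h2
  linarith

theorem sqrt_quad_add_le (s : NonnegForm X) (u v : X) :
    √(s.quad (u + v)) ≤ √(s.quad u) + √(s.quad v) := by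
  rw [Real.sqrt_le_iff]
  refine ⟨by positivity, ?_⟩
  rw [add_sq, Real.sq_sqrt (s.quad_nonneg u), Real.sq_sqrt (s.quad_nonneg v), s.quad_add]
  have := (Complex.re_le_norm _).trans (s.norm_form_le u v)
  linarith

end NonnegForm

/-! ### Coercive variational problems -/

section LaxMilgram

variable {Y K : Type*} [NormedAddCommGroup Y] [NormedSpace ℂ Y]
  [NormedAddCommGroup K] [InnerProductSpace ℂ K] [CompleteSpace K]

theorem exists_riesz_operator (t : Y →ₗ[ℂ] K →ₗ⋆[ℂ] ℂ) {C : ℝ} (hC : 0 ≤ C)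
    (ht : ∀ y k, ‖t y k‖ ≤ C * ‖y‖ * ‖k‖) :
    ∃ T : Y →L[ℂ] K, ∀ y k, t y k = inner ℂ k (T y) := by
  have key : ∀ y, ∃ w : K, ∀ k, t y k = inner ℂ k w := by
    intro y
    -- Conjugation makes the functional linear in `k`, as the Riesz theorem requires.
    let φ : K →ₗ[ℂ] ℂ :=
      { toFun := fun k => conj (t y k)
        map_add' := by intro a b; simp
        map_smul' := by intro c a; simp }
    let ψ : K →L[ℂ] ℂ := φ.mkContinuous (C * ‖y‖) (by
      intro k
      simpa [φ] using ht y k)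
    refine ⟨(InnerProductSpace.toDual ℂ K).symm ψ, fun k => ?_⟩
    rw [← inner_conj_symm, InnerProductSpace.toDual_symm_apply]
    simp [ψ, φ]
  choose T hT using key
  let T' : Y →ₗ[ℂ] K :=
    { toFun := T
      map_add' := by
        intro a b
        refine ext_inner_left ℂ fun k => ?_
        rw [inner_add_right, ← hT, ← hT, ← hT]; simp
      map_smul' := by
        intro c a
        refine ext_inner_left ℂ fun k => ?_
        rw [RingHom.id_apply, inner_smul_right, ← hT, ← hT]; simp }
  refine ⟨T'.mkContinuous C fun y => ?_, fun y k => hT y k⟩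
  change ‖T y‖ ≤ _
  have h := ht y (T y)
  rw [hT y (T y), inner_self_eq_norm_sq_to_K] at h
  rcases eq_or_lt_of_le (norm_nonneg (T y)) with h0 | h0
  · rw [← h0]
    positivity
  · have h2 : ‖T y‖ * ‖T y‖ ≤ C * ‖y‖ * ‖T y‖ := by
      simpa [sq] using h
    exact le_of_mul_le_mul_right h2 h0

/-- The Lax-Milgram lemma, with a parametrised right-hand side. -/
theorem lax_milgram (s : SForm K) {c C : ℝ} (hc : 0 < c) (hC : 0 ≤ C)
    (hcoer : ∀ u, c * ‖u‖ ^ 2 ≤ (s u u).re) (hs : ∀ u v, ‖s u v‖ ≤ C * ‖u‖ * ‖v‖)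
    (t : Y →ₗ[ℂ] K →ₗ⋆[ℂ] ℂ) {D : ℝ} (hD : 0 ≤ D) (ht : ∀ y k, ‖t y k‖ ≤ D * ‖y‖ * ‖k‖) :
    ∃ S : Y →L[ℂ] K, ∀ y k, s (S y) k = t y k := by
  obtain ⟨G, hG⟩ := exists_riesz_operator s hC hs
  obtain ⟨T, hT⟩ := exists_riesz_operator t hD ht
  -- Coercivity bounds the numerical range of `G` from below by `c`, which makes `G` invertible.
  have hu : IsUnit G := by
    refine ContinuousLinearMap.isUnit_of_forall_le_norm_inner_map G (c := c.toNNReal)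
      (by simpa using hc) fun x => ?_
    have h1 := hcoer x
    rw [hG, ← inner_conj_symm] at h1
    have h2 := (Complex.re_le_norm _).trans_eq (Complex.norm_conj (inner ℂ (G x) x))
    rw [Real.coe_toNNReal c hc.le]
    linarith
  obtain ⟨g, rfl⟩ := hu
  refine ⟨(↑g⁻¹ : K →L[ℂ] K) ∘L T, fun y k => ?_⟩
  rw [hG, hT]
  congr 1
  change ((g : K →L[ℂ] K) * (↑g⁻¹ : K →L[ℂ] K)) (T y) = T y
  rw [g.mul_inv]; rfl

end LaxMilgram

/-! ### Operators that are symmetric with respect to a form -/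

section Symmetric

theorem unit_apply_inv_apply {X : Type*} [NormedAddCommGroup X] [NormedSpace ℂ X]
    (g : (X →L[ℂ] X)ˣ) (x : X) : (g : X →L[ℂ] X) ((↑g⁻¹ : X →L[ℂ] X) x) = x := by
  change ((g : X →L[ℂ] X) * (↑g⁻¹ : X →L[ℂ] X)) x = x
  rw [g.mul_inv]; rfl

theorem unit_inv_apply_apply {X : Type*} [NormedAddCommGroup X] [NormedSpace ℂ X]
    (g : (X →L[ℂ] X)ˣ) (x : X) : (↑g⁻¹ : X →L[ℂ] X) ((g : X →L[ℂ] X) x) = x := by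
  change ((↑g⁻¹ : X →L[ℂ] X) * (g : X →L[ℂ] X)) x = x
  rw [g.inv_mul]; rfl

variable {X : Type*} [NormedAddCommGroup X] [InnerProductSpace ℂ X] [CompleteSpace X]

/-- The Gram operator of `d` is positive and bounded below, so its square root is an invertible `g`,
and `d` is the pullback of the Hilbert inner product by `g`. Conjugation with `g` turns
`d`-symmetric operators into self-adjoint ones without changing the spectrum. -/
theorem exists_unit_representing (d : NonnegForm X) {c C : ℝ} (hc : 0 < c) (hC : 0 ≤ C)
    (hl : ∀ u, c * ‖u‖ ^ 2 ≤ d.quad u) (hr : ∀ u, d.quad u ≤ C * ‖u‖ ^ 2) :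
    ∃ g : (X →L[ℂ] X)ˣ, ∀ u v, d.form u v = inner ℂ ((g : X →L[ℂ] X) v) ((g : X →L[ℂ] X) u) := by
  have hb : ∀ u v, ‖d.form u v‖ ≤ C * ‖u‖ * ‖v‖ := by
    intro u v
    have := d.norm_form_le_of_quad_le (u := u) (v := v) (p := √C * ‖u‖) (q := √C * ‖v‖)
      (by positivity) (by positivity) (by rw [mul_pow, Real.sq_sqrt hC]; exact hr u)
      (by rw [mul_pow, Real.sq_sqrt hC]; exact hr v)
    calc _ ≤ _ := this
      _ = (√C * √C) * ‖u‖ * ‖v‖ := by ring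
      _ = _ := by rw [Real.mul_self_sqrt hC]
  obtain ⟨G, hG⟩ := exists_riesz_operator d.form hC hb
  have hpos : G.IsPositive := by
    rw [ContinuousLinearMap.isPositive_iff_complex]
    intro x
    have h : inner ℂ (G x) x = (d.quad x : ℂ) := by
      rw [← inner_conj_symm, ← hG, d.form_self, Complex.conj_ofReal]
    rw [h]
    exact ⟨by simp, by simpa using d.quad_nonneg x⟩
  have hnn : 0 ≤ G := by rwa [ContinuousLinearMap.nonneg_iff_isPositive]
  have hu : IsUnit G := by
    refine ContinuousLinearMap.isUnit_of_forall_le_norm_inner_map G (c := c.toNNReal)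
      (by simpa using hc) fun x => ?_
    have h1 := hl x
    rw [NonnegForm.quad, hG, ← inner_conj_symm] at h1
    have h2 := (Complex.re_le_norm _).trans_eq (Complex.norm_conj (inner ℂ (G x) x))
    rw [Real.coe_toNNReal c hc.le]
    linarith
  obtain ⟨g, hg⟩ := (CFC.isUnit_sqrt_iff G hnn).mpr hu
  refine ⟨g, fun u v => ?_⟩
  have hsa : IsSelfAdjoint (CFC.sqrt G) := (CFC.sqrt_nonneg G).isSelfAdjoint
  rw [hG, hg, ← ContinuousLinearMap.adjoint_inner_right, ← ContinuousLinearMap.star_eq_adjoint,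
    hsa.star_eq]
  conv_lhs => rw [← CFC.sqrt_mul_sqrt_self G hnn]
  rfl

/-- Symmetry of a bounded operator with respect to a form. -/
def IsSymm (d : NonnegForm X) (T : X →L[ℂ] X) : Prop :=
  ∀ u v, d.form (T u) v = d.form u (T v)

/-- The resolvent of a self-adjoint `B` is normal, so its norm at `z` is the reciprocal of the
distance from `z` to the spectrum. If that distance exceeds `δ`, a Neumann series inverts `z - A`
too. Nothing but boundedness is needed of `A`. -/
theorem exists_mem_spectrum_near_of_selfAdjoint {A B : X →L[ℂ] X}
    (hB : IsSelfAdjoint B) {δ : ℝ} (hAB : ‖A - B‖ ≤ δ) {z : ℂ} (hz : z ∈ spectrum ℂ A) :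
    ∃ μ ∈ spectrum ℂ B, ‖z - μ‖ ≤ δ := by
  have hδ : 0 ≤ δ := (norm_nonneg _).trans hAB
  by_contra! hcon
  have hzB : z ∉ spectrum ℂ B := fun h => by
    have := hcon z h
    simp at this
    linarith
  -- The spectral radius is attained only in a nontrivial algebra; on the zero space `A` has empty
  -- spectrum.
  rcases subsingleton_or_nontrivial X with hX | hX
  · exact (spectrum.mem_iff.mp hz) (isUnit_of_subsingleton _)
  rw [spectrum.notMem_iff] at hzB
  obtain ⟨u, hu⟩ := hzB
  set r : X →L[ℂ] X := ↑u⁻¹ with hr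
  have hcomm : Commute (star (u : X →L[ℂ] X)) u := by
    rw [hu, star_sub, hB.star_eq, ← algebraMap_star_comm]
    exact ((Algebra.commute_algebraMap_left _ _).sub_left
      (((Algebra.commute_algebraMap_right _ _)).sub_right (Commute.refl B)))
  have hnr : IsStarNormal r := by
    have h1 : Commute ((star u : (X →L[ℂ] X)ˣ) : X →L[ℂ] X) u := by simpa using hcomm
    have h2 := h1.units_inv_left.units_inv_right
    refine ⟨?_⟩
    rw [hr]
    simpa [Units.coe_star_inv] using h2
  -- A spectral value `ν` of the resolvent with |ν| = ‖r‖ yields the point `z - ν⁻¹` of the spectrum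
  -- of `B` at distance exactly ‖r‖⁻¹ from `z`.
  obtain ⟨ν, hν, hνr⟩ := spectrum.exists_nnnorm_eq_spectralRadius r
  rw [IsStarNormal.spectralRadius_eq_nnnorm] at hνr
  have hν0 : ν ≠ 0 := by
    rintro rfl
    exact spectrum.zero_notMem ℂ u⁻¹.isUnit hν
  have hmem : z - ν⁻¹ ∈ spectrum ℂ B := by
    have h := spectrum.inv_mem_iff (r := (Units.mk0 ν hν0)⁻¹) (a := u)
    rw [inv_inv, Units.val_mk0] at h
    have h3 := h.mpr hν
    rw [Units.val_inv_eq_inv_val, Units.val_mk0, hu, ← spectrum.singleton_sub_eq] at h3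
    obtain ⟨_, rfl, μ, hμ, hμ'⟩ := Set.mem_sub.mp h3
    rw [← hμ']
    simpa using hμ
  have h1 := hcon _ hmem
  rw [sub_sub_cancel, norm_inv] at h1
  have hνr' : ‖ν‖ = ‖r‖ := by
    have : ‖ν‖₊ = ‖r‖₊ := by exact_mod_cast hνr
    exact congrArg NNReal.toReal this
  have h2 : ‖(algebraMap ℂ (X →L[ℂ] X) z - A) - u‖ < ‖(↑u⁻¹ : X →L[ℂ] X)‖⁻¹ := by
    rw [hu, sub_sub_sub_cancel_left, norm_sub_rev, ← hr, ← hνr']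
    exact hAB.trans_lt h1
  exact spectrum.mem_iff.mp hz (u.ofNearby _ h2).isUnit

/-- The conjugate of a symmetric operator by the square root of the Gram operator. -/
theorem IsSymm.isSelfAdjoint_conj {d : NonnegForm X} {T : X →L[ℂ] X} (hT : IsSymm d T)
    {g : (X →L[ℂ] X)ˣ}
    (hg : ∀ u v, d.form u v = inner ℂ ((g : X →L[ℂ] X) v) ((g : X →L[ℂ] X) u)) :
    IsSelfAdjoint ((g : X →L[ℂ] X) * T * (↑g⁻¹ : X →L[ℂ] X)) := by
  have hgg : ∀ x, (g : X →L[ℂ] X) ((↑g⁻¹ : X →L[ℂ] X) x) = x := unit_apply_inv_apply g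
  rw [ContinuousLinearMap.isSelfAdjoint_iff_isSymmetric]
  intro x y
  have h := hT ((↑g⁻¹ : X →L[ℂ] X) y) ((↑g⁻¹ : X →L[ℂ] X) x)
  rw [hg, hg, hgg, hgg] at h
  exact h.symm

omit [CompleteSpace X] in
theorem quad_eq_norm_sq {d : NonnegForm X} {g : (X →L[ℂ] X)ˣ}
    (hg : ∀ u v, d.form u v = inner ℂ ((g : X →L[ℂ] X) v) ((g : X →L[ℂ] X) u)) (u : X) :
    d.quad u = ‖(g : X →L[ℂ] X) u‖ ^ 2 := by
  rw [NonnegForm.quad, hg, inner_self_eq_norm_sq_to_K]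
  norm_cast

omit [CompleteSpace X] in
-- Since the `d`-norm of `u` is ‖g u‖, a bound in the `d`-norm becomes an operator norm bound for
-- the conjugate.
theorem norm_conj_unit_le {d : NonnegForm X} {T : X →L[ℂ] X} {g : (X →L[ℂ] X)ˣ}
    (hg : ∀ u v, d.form u v = inner ℂ ((g : X →L[ℂ] X) v) ((g : X →L[ℂ] X) u)) {δ : ℝ}
    (hδ : 0 ≤ δ) (h : ∀ u, d.quad (T u) ≤ δ ^ 2 * d.quad u) :
    ‖(g : X →L[ℂ] X) * T * (↑g⁻¹ : X →L[ℂ] X)‖ ≤ δ := by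
  refine ContinuousLinearMap.opNorm_le_bound _ hδ fun x => ?_
  have hgg : (g : X →L[ℂ] X) ((↑g⁻¹ : X →L[ℂ] X) x) = x := unit_apply_inv_apply g _
  have h1 := h ((↑g⁻¹ : X →L[ℂ] X) x)
  rw [quad_eq_norm_sq hg, quad_eq_norm_sq hg, hgg, ← mul_pow] at h1
  exact le_of_sq_le_sq h1 (by positivity)

variable {d : NonnegForm X} {c C : ℝ}

theorem exists_mem_spectrum_near (hc : 0 < c) (hC : 0 ≤ C)
    (hl : ∀ u, c * ‖u‖ ^ 2 ≤ d.quad u) (hr : ∀ u, d.quad u ≤ C * ‖u‖ ^ 2)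
    {A B : X →L[ℂ] X} (hB : IsSymm d B) {δ : ℝ} (hδ : 0 ≤ δ)
    (hAB : ∀ u, d.quad (A u - B u) ≤ δ ^ 2 * d.quad u) {z : ℂ} (hz : z ∈ spectrum ℂ A) :
    ∃ μ ∈ spectrum ℂ B, ‖z - μ‖ ≤ δ := by
  obtain ⟨g, hg⟩ := exists_unit_representing d hc hC hl hr
  have h1 := norm_conj_unit_le (T := A - B) hg hδ hAB
  rw [mul_sub, sub_mul] at h1
  rw [← spectrum.units_conjugate (u := g)] at hz
  obtain ⟨μ, hμ, h⟩ := exists_mem_spectrum_near_of_selfAdjoint (hB.isSelfAdjoint_conj hg) h1 hz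
  exact ⟨μ, by rwa [spectrum.units_conjugate] at hμ, h⟩

theorem spectrum_subset_Icc (hc : 0 < c) (hC : 0 ≤ C)
    (hl : ∀ u, c * ‖u‖ ^ 2 ≤ d.quad u) (hr : ∀ u, d.quad u ≤ C * ‖u‖ ^ 2)
    {T : X →L[ℂ] X} (hT : IsSymm d T) (hpos : ∀ u, 0 ≤ (d.form (T u) u).re)
    (hle : ∀ u, d.quad (T u) ≤ d.quad u) {z : ℂ} (hz : z ∈ spectrum ℂ T) :
    ∃ x : ℝ, 0 ≤ x ∧ x ≤ 1 ∧ z = x := by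
  obtain ⟨g, hg⟩ := exists_unit_representing d hc hC hl hr
  rw [← spectrum.units_conjugate (u := g)] at hz
  rcases subsingleton_or_nontrivial X with hX | hX
  · exact absurd (isUnit_of_subsingleton _) (spectrum.mem_iff.mp hz)
  have hsa := hT.isSelfAdjoint_conj hg
  have hn := norm_conj_unit_le (T := T) hg zero_le_one (by simpa using hle)
  have hnn : 0 ≤ (g : X →L[ℂ] X) * T * (↑g⁻¹ : X →L[ℂ] X) := by
    rw [ContinuousLinearMap.nonneg_iff_isPositive, ContinuousLinearMap.isPositive_def']
    refine ⟨hsa, fun x => ?_⟩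
    have h := hpos ((↑g⁻¹ : X →L[ℂ] X) x)
    have hgg : (g : X →L[ℂ] X) ((↑g⁻¹ : X →L[ℂ] X) x) = x := unit_apply_inv_apply g _
    rw [hg, hgg] at h
    rw [ContinuousLinearMap.reApplyInnerSelf_apply, ← inner_conj_symm, RCLike.conj_re]
    exact h
  have hzz := hsa.mem_spectrum_eq_re hz
  have h0 : 0 ≤ z.re := by
    rw [hzz] at hz
    exact spectrum_nonneg_of_nonneg (𝕜 := ℝ) hnn ((spectrum.algebraMap_mem_iff ℂ).mp hz)
  refine ⟨z.re, h0, ?_, hzz⟩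
  exact (Complex.re_le_norm z).trans ((spectrum.norm_le_norm_of_mem hz).trans hn)

/-- A self-adjoint operator has a spectral value whose modulus is its norm, and the norm dominates
every Rayleigh quotient. -/
theorem exists_mem_spectrum_ge (hc : 0 < c) (hC : 0 ≤ C)
    (hl : ∀ u, c * ‖u‖ ^ 2 ≤ d.quad u) (hr : ∀ u, d.quad u ≤ C * ‖u‖ ^ 2)
    {T : X →L[ℂ] X} (hT : IsSymm d T) {ρ : ℝ} {u : X} (hu : 0 < d.quad u)
    (hρ : ρ * d.quad u ≤ (d.form (T u) u).re) :
    ∃ z ∈ spectrum ℂ T, ρ ≤ ‖z‖ := by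
  obtain ⟨g, hg⟩ := exists_unit_representing d hc hC hl hr
  have hsa := hT.isSelfAdjoint_conj hg
  have hX : Nontrivial X := by
    refine ⟨u, 0, ?_⟩
    rintro rfl
    simp [NonnegForm.quad] at hu
  obtain ⟨ν, hν, hνr⟩ := spectrum.exists_nnnorm_eq_spectralRadius
    ((g : X →L[ℂ] X) * T * (↑g⁻¹ : X →L[ℂ] X))
  rw [hsa.spectralRadius_eq_nnnorm] at hνr
  have hνr' : ‖ν‖ = ‖(g : X →L[ℂ] X) * T * (↑g⁻¹ : X →L[ℂ] X)‖ := by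
    have : ‖ν‖₊ = ‖(g : X →L[ℂ] X) * T * (↑g⁻¹ : X →L[ℂ] X)‖₊ := by exact_mod_cast hνr
    exact congrArg NNReal.toReal this
  refine ⟨ν, by rwa [spectrum.units_conjugate] at hν, ?_⟩
  have hgg : (↑g⁻¹ : X →L[ℂ] X) ((g : X →L[ℂ] X) u) = u := unit_inv_apply_apply g _
  have h1 := ContinuousLinearMap.le_opNorm ((g : X →L[ℂ] X) * T * (↑g⁻¹ : X →L[ℂ] X))
    ((g : X →L[ℂ] X) u)
  change ‖(g : X →L[ℂ] X) (T ((↑g⁻¹ : X →L[ℂ] X) ((g : X →L[ℂ] X) u)))‖ ≤ _ at h1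
  rw [hgg, ← hνr'] at h1
  have h2 : (d.form (T u) u).re ≤ ‖(g : X →L[ℂ] X) u‖ * ‖(g : X →L[ℂ] X) (T u)‖ := by
    rw [hg]
    exact (Complex.re_le_norm _).trans (norm_inner_le_norm _ _)
  rw [quad_eq_norm_sq hg] at hu hρ
  have h3 : ρ * ‖(g : X →L[ℂ] X) u‖ ^ 2 ≤ ‖ν‖ * ‖(g : X →L[ℂ] X) u‖ ^ 2 := by
    refine hρ.trans (h2.trans ?_)
    calc _ ≤ ‖(g : X →L[ℂ] X) u‖ * (‖ν‖ * ‖(g : X →L[ℂ] X) u‖) := by gcongr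
      _ = _ := by ring
  exact le_of_mul_le_mul_right h3 hu

end Symmetric

end

/-! ### Operators with bounded inverse and their spectra. -/

section

/-- By the open mapping theorem membership in the spectrum is a purely algebraic matter, which is
convenient for restrictions and for unbounded operators. -/
theorem notMem_spectrum_iff_bijective {X : Type*} [NormedAddCommGroup X] [NormedSpace ℂ X]
    [CompleteSpace X] (T : X →L[ℂ] X) (z : ℂ) :
    z ∉ spectrum ℂ T ↔ Function.Bijective (z • (LinearMap.id : X →ₗ[ℂ] X) - (T : X →ₗ[ℂ] X)) := by
  rw [spectrum.notMem_iff, ContinuousLinearMap.isUnit_iff_bijective]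
  have : (⇑(algebraMap ℂ (X →L[ℂ] X) z - T)) = ⇑(z • (LinearMap.id : X →ₗ[ℂ] X) - (T : X →ₗ[ℂ] X)) := by
    ext x; simp [Algebra.algebraMap_eq_smul_one]
  rw [this]

section Resolvent

variable {Q X : Type*} [AddCommGroup Q] [Module ℂ Q] [NormedAddCommGroup X] [NormedSpace ℂ X]

/-- A bounded operator is the inverse of a partially defined one. -/
def IsInverse (T : X →ₗ.[ℂ] X) (R : X →L[ℂ] X) : Prop :=
  ∀ u g : X, (u, g) ∈ T.graph ↔ u = R g

theorem formOperator_isInverse {j : Q →ₗ[ℂ] X} {s : SForm Q} {d : SForm X} {R : X →L[ℂ] X}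
    (hj : Function.Injective j) (hd : ∀ g, (∀ q, d g (j q) = 0) → g = 0)
    (hs : ∀ q, (∀ q', s q q' = 0) → q = 0)
    (hR : ∀ f, ∃ q, j q = R f ∧ ∀ q', s q q' = d f (j q')) :
    IsInverse (formOperator j s d) R := by
  intro u g
  rw [formOperator, Submodule.toLinearPMap_graph_eq]
  · change (∃ q : Q, j q = u ∧ ∀ q' : Q, s q q' = d g (j q')) ↔ u = R g
    obtain ⟨q₀, h₀, h₀'⟩ := hR g
    constructor
    · rintro ⟨q, rfl, hq⟩
      have : q - q₀ = 0 := hs _ fun q' => by simp [hq, h₀']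
      rw [sub_eq_zero.mp this, h₀]
    · rintro rfl
      exact ⟨q₀, h₀, h₀'⟩
  -- The defining relation is single-valued, so it really is the graph of the operator: injectivity
  -- of `j` gives `q = 0`, and then `y` is `d`-orthogonal to the range of `j`.
  · rintro ⟨x, y⟩ ⟨q, hq, hq'⟩ hx
    change x = 0 at hx
    change j q = x at hq
    have hq0 : q = 0 := hj (by simp [hq, hx])
    refine hd y fun q' => ?_
    rw [← hq' q', hq0]; simp

namespace IsInverse

variable {T : X →ₗ.[ℂ] X} {R : X →L[ℂ] X}

theorem apply_mem (h : IsInverse T R) (g : X) : ∃ hg : R g ∈ T.domain, T ⟨R g, hg⟩ = g := by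
  have := (h (R g) g).mpr rfl
  rw [LinearPMap.mem_graph_iff] at this
  obtain ⟨⟨y, hy⟩, h1, h2⟩ := this
  simp only at h1
  subst h1
  exact ⟨hy, h2⟩

theorem apply_apply (h : IsInverse T R) (u : T.domain) : R (T u) = u :=
  ((h u (T u)).mp (T.mem_graph u)).symm

theorem injective (h : IsInverse T R) : Function.Injective R := by
  intro f g hfg
  obtain ⟨h1, h1'⟩ := h.apply_mem f
  obtain ⟨h2, h2'⟩ := h.apply_mem g
  rw [← h1', ← h2']
  congr 1
  exact Subtype.ext hfg

theorem mem_inverse_graph (h : IsInverse T R) (g u : X) :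
    (g, u) ∈ T.inverse.graph ↔ u = R g := by
  rw [LinearPMap.inverse_graph]
  · rw [← h u g]
    constructor
    · rintro ⟨⟨a, b⟩, hab, h1⟩
      have h2 : b = g ∧ a = u := by simpa [Prod.ext_iff] using h1
      rw [← h2.1, ← h2.2]; exact hab
    · intro hab
      exact ⟨(u, g), hab, rfl⟩
  · rw [LinearMap.ker_eq_bot']
    intro u hu
    have h1 := h.apply_apply u
    have h2 : T u = 0 := hu
    rw [h2, map_zero] at h1
    exact Subtype.ext h1.symm

theorem mem_inverse_domain (h : IsInverse T R) (g : X) :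
    ∃ hg : g ∈ T.inverse.domain, T.inverse ⟨g, hg⟩ = R g := by
  have := (h.mem_inverse_graph g (R g)).mpr rfl
  rw [LinearPMap.mem_graph_iff] at this
  obtain ⟨⟨y, hy⟩, h1, h2⟩ := this
  simp only at h1
  subst h1
  exact ⟨hy, h2⟩

theorem spectrumOf_inverse (h : IsInverse T R) : spectrumOf T.inverse = spectrum ℂ R := by
  ext z
  rw [spectrumOf, Set.mem_compl_iff, spectrum.mem_iff, not_iff_not, Set.mem_ofPred_eq]
  have hT : ∀ u : T.inverse.domain, T.inverse u = R u := by
    rintro ⟨u, hu⟩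
    obtain ⟨_, h2⟩ := h.mem_inverse_domain u
    exact h2
  constructor
  · rintro ⟨S, hS1, hS2⟩
    -- `spectrumOf` inverts `T - z` whereas `spectrum` inverts `z - T`; hence the sign.
    have h1 : (algebraMap ℂ (X →L[ℂ] X) z - R) * (-S) = 1 := by
      ext g
      obtain ⟨hg, hg'⟩ := hS1 g
      rw [hT] at hg'
      change (algebraMap ℂ (X →L[ℂ] X) z - R) (-(S g)) = g
      rw [map_neg, ← sub_eq_zero, ← hg']
      simp [Algebra.algebraMap_eq_smul_one, hg']
    have h2 : (-S) * (algebraMap ℂ (X →L[ℂ] X) z - R) = 1 := by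
      ext g
      obtain ⟨hg, hg'⟩ := h.mem_inverse_domain g
      have h3 := hS2 ⟨g, hg⟩
      rw [hg'] at h3
      have h4 : R g - z • g = - ((algebraMap ℂ (X →L[ℂ] X) z - R) g) := by
        simp [Algebra.algebraMap_eq_smul_one]
      change S (R g - z • g) = g at h3
      rw [h4, map_neg] at h3
      exact h3
    exact ⟨⟨_, _, h1, h2⟩, rfl⟩
  · rintro ⟨w, hw⟩
    have hw' : ∀ g, R g - z • g = - (w : X →L[ℂ] X) g := by
      intro g
      rw [hw]
      simp [Algebra.algebraMap_eq_smul_one]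
    refine ⟨-(↑w⁻¹ : X →L[ℂ] X), fun g => ?_, fun u => ?_⟩
    · refine ⟨(h.mem_inverse_domain _).1, ?_⟩
      rw [hT, hw']
      simp [unit_apply_inv_apply]
    · rw [hT, hw']
      simp [unit_inv_apply_apply]

/-- With u = R x one has (T − z)u = x − zRx = z(z⁻¹x − Rx), so for z ≠ 0 the two operators are
invertible together. At z = 0 the operator `R` itself is the bounded inverse. -/
theorem mem_spectrumOf_iff [CompleteSpace X] (h : IsInverse T R) (z : ℂ) :
    z ∈ spectrumOf T ↔ z ≠ 0 ∧ z⁻¹ ∈ spectrum ℂ R := by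
  rw [← not_iff_not, not_and_or, not_not, spectrumOf, Set.mem_compl_iff, not_not,
    Set.mem_ofPred_eq]
  constructor
  · rintro ⟨S, hS1, hS2⟩
    rcases eq_or_ne z 0 with hz | hz
    · exact Or.inl hz
    right
    rw [notMem_spectrum_iff_bijective]
    constructor
    · rw [injective_iff_map_eq_zero]
      intro x hx
      obtain ⟨h1, h2⟩ := h.apply_mem x
      have h3 := hS2 ⟨R x, h1⟩
      rw [h2] at h3
      have h4 : x - z • R x = 0 := by
        have : x - z • R x = z • (z⁻¹ • x - R x) := by rw [smul_sub, smul_inv_smul₀ hz]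
        rw [this]
        change z • ((z⁻¹ • x) - R x) = 0
        change z⁻¹ • x - R x = 0 at hx
        rw [hx, smul_zero]
      change S (x - z • R x) = R x at h3
      rw [h4, map_zero] at h3
      exact h.injective (by rw [← h3, map_zero])
    · intro g
      obtain ⟨h1, h2⟩ := hS1 (z • g)
      refine ⟨T ⟨S (z • g), h1⟩, ?_⟩
      change z⁻¹ • T ⟨S (z • g), h1⟩ - R (T ⟨S (z • g), h1⟩) = g
      rw [h.apply_apply]
      apply smul_right_injective X hz
      change z • (z⁻¹ • T ⟨S (z • g), h1⟩ - S (z • g)) = z • g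
      rw [smul_sub, smul_inv_smul₀ hz]
      exact h2
  · rintro (rfl | hz')
    · exact ⟨R, fun g => by simpa using h.apply_mem g, fun u => by simpa using h.apply_apply u⟩
    rcases eq_or_ne z 0 with rfl | hz
    · exact ⟨R, fun g => by simpa using h.apply_mem g, fun u => by simpa using h.apply_apply u⟩
    rw [spectrum.notMem_iff] at hz'
    obtain ⟨w, hw⟩ := hz'
    have hw' : ∀ x, x - z • R x = z • (w : X →L[ℂ] X) x := by
      intro x
      rw [hw]
      simp [Algebra.algebraMap_eq_smul_one, smul_sub, smul_inv_smul₀ hz]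
    refine ⟨R ∘L (z⁻¹ • (↑w⁻¹ : X →L[ℂ] X)), fun g => ?_, fun u => ?_⟩
    · obtain ⟨h1, h2⟩ := h.apply_mem ((z⁻¹ • (↑w⁻¹ : X →L[ℂ] X)) g)
      refine ⟨h1, ?_⟩
      change T ⟨R ((z⁻¹ • (↑w⁻¹ : X →L[ℂ] X)) g), h1⟩ - z • R ((z⁻¹ • (↑w⁻¹ : X →L[ℂ] X)) g) = g
      rw [h2, hw']
      simp [unit_apply_inv_apply, smul_inv_smul₀ hz]
    · have h1 := hw' (T u)
      rw [h.apply_apply] at h1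
      rw [h1]
      simp [unit_inv_apply_apply, smul_inv_smul₀ hz, h.apply_apply]

end IsInverse

end Resolvent

section Restriction

variable {X : Type*} [NormedAddCommGroup X] [NormedSpace ℂ X] [CompleteSpace X]

/-- The nonzero spectrum of an operator does not change on restriction to a closed subspace that
contains its range. -/
theorem mem_spectrum_restrict_iff {Y : Submodule ℂ X} [CompleteSpace Y] {B : X →L[ℂ] X}
    {R : Y →L[ℂ] Y} (hB : ∀ x, B x ∈ Y) (hR : ∀ y : Y, (R y : X) = B y) {z : ℂ} (hz : z ≠ 0) :
    z ∈ spectrum ℂ R ↔ z ∈ spectrum ℂ B := by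
  rw [← not_iff_not, notMem_spectrum_iff_bijective, notMem_spectrum_iff_bijective]
  -- As `B` maps into `Y`, this formula puts every solution with right-hand side in `Y` into `Y`.
  have key : ∀ x y : X, z • x - B x = y → x = z⁻¹ • (B x + y) := by
    rintro x y rfl
    rw [add_sub_cancel, inv_smul_smul₀ hz]
  constructor
  · rintro ⟨hi, hs⟩
    constructor
    · rw [injective_iff_map_eq_zero] at hi ⊢
      intro x hx
      have hxY : x ∈ Y := by
        rw [key x 0 hx, add_zero]
        exact Y.smul_mem _ (hB x)
      have := hi ⟨x, hxY⟩ (Subtype.ext (by simpa [hR] using hx))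
      simpa using congrArg Subtype.val this
    · intro y
      -- A general right-hand side `y` is reduced to `B y`, which lies in `Y`; the solution is then
      -- z⁻¹(t + y).
      obtain ⟨t, ht⟩ := hs ⟨B y, hB y⟩
      have ht' : z • (t : X) - B t = B y := by
        rw [← hR]
        exact congrArg Subtype.val ht
      refine ⟨z⁻¹ • (t + y), ?_⟩
      change z • z⁻¹ • ((t : X) + y) - B (z⁻¹ • ((t : X) + y)) = y
      rw [smul_inv_smul₀ hz, map_smul, map_add, ← ht', sub_eq_iff_eq_add]
      rw [add_sub_cancel, inv_smul_smul₀ hz, add_comm]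
  · rintro ⟨hi, hs⟩
    constructor
    · rw [injective_iff_map_eq_zero] at hi ⊢
      intro y hy
      refine Subtype.ext (hi y ?_)
      change z • (y : X) - B y = 0
      rw [← hR]
      exact congrArg Subtype.val hy
    · intro y
      obtain ⟨x, hx⟩ := hs y
      have hxY : x ∈ Y := by
        rw [key x y hx]
        exact Y.smul_mem _ (Y.add_mem (hB x) y.2)
      refine ⟨⟨x, hxY⟩, Subtype.ext ?_⟩
      change z • x - (R ⟨x, hxY⟩ : X) = y
      rw [hR]
      exact hx

end Restriction

end

/-! ### From closeness of inverses to closeness of spectra. -/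

section

section Distances

theorem hausdorffEDist_le_of_norm_sub_le {A B : Set ℂ} {r : ℝ}
    (hA : ∀ x ∈ A, ∃ y ∈ B, ‖x - y‖ ≤ r) (hB : ∀ y ∈ B, ∃ x ∈ A, ‖y - x‖ ≤ r) :
    Metric.hausdorffEDist A B ≤ ENNReal.ofReal r := by
  refine Metric.hausdorffEDist_le_of_mem_edist (fun x hx => ?_) fun y hy => ?_
  · obtain ⟨y, hy, h⟩ := hA x hx
    exact ⟨y, hy, by rw [edist_dist, dist_eq_norm]; exact ENNReal.ofReal_le_ofReal h⟩
  · obtain ⟨x, hx, h⟩ := hB y hy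
    exact ⟨x, hx, by rw [edist_dist, dist_eq_norm]; exact ENNReal.ofReal_le_ofReal h⟩

/-- If 2Cβε ≤ 1, then |μ| ≥ 1/(2β) and |t − μ⁻¹| = |t||μ⁻¹||t⁻¹ − μ| ≤ 2β²Cε. Otherwise ε is so
large that a point of `Y` of modulus at most `m`, at distance at most β + m ≤ (1 + m)β, is already
close enough. -/
theorem exists_near_of_inv_near {X Y : Set ℂ} (hX : ∀ x ∈ X, ∃ t : ℝ, 1 ≤ t ∧ x = t)
    {C ε m β : ℝ} (hC : 0 < C) (hε : 0 < ε)
    (hm : 0 ≤ m) (h : ∀ x ∈ X, ∃ μ : ℂ, ‖x⁻¹ - μ‖ ≤ C * ε ∧ (μ = 0 ∨ μ⁻¹ ∈ Y))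
    (hmY : ∃ y ∈ Y, ‖y‖ ≤ m) {x : ℂ} (hx : x ∈ X) (hxβ : ‖x‖ ≤ β) :
    ∃ y ∈ Y, ‖x - y‖ ≤ 2 * C * (1 + m) * β ^ 2 * ε := by
  obtain ⟨t, ht, rfl⟩ := hX x hx
  have htβ : t ≤ β := by
    rw [Complex.norm_real] at hxβ
    exact (le_abs_self t).trans hxβ
  have hβ : 1 ≤ β := ht.trans htβ
  rcases le_or_gt (2 * C * β * ε) 1 with hs | hs
  · obtain ⟨μ, hμ, hμY⟩ := h _ hx
    have hinv : β⁻¹ ≤ ‖(t : ℂ)⁻¹‖ := by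
      rw [norm_inv, Complex.norm_real, Real.norm_of_nonneg (by linarith)]
      gcongr
    have hsm : C * ε ≤ β⁻¹ / 2 := by
      rw [le_div_iff₀ two_pos, le_inv_comm₀ (by positivity) (by positivity)]
      rw [le_inv_comm₀ (by positivity) (by positivity), ← one_div, le_div_iff₀ (by positivity)]
      linarith
    have hβ' : 0 < β⁻¹ := by positivity
    have hμlow : β⁻¹ / 2 ≤ ‖μ‖ := by
      have := norm_sub_norm_le (t : ℂ)⁻¹ μ
      linarith
    have hμ0 : μ ≠ 0 := by
      rintro rfl
      simp at hμlow
      linarith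
    have hμY' : μ⁻¹ ∈ Y := hμY.resolve_left hμ0
    refine ⟨μ⁻¹, hμY', ?_⟩
    have ht0 : (t : ℂ) ≠ 0 := by exact_mod_cast (by linarith : t ≠ 0)
    have hid : (t : ℂ) - μ⁻¹ = -(t * μ⁻¹ * ((t : ℂ)⁻¹ - μ)) := by
      field_simp
      ring
    have hμinv : ‖μ⁻¹‖ ≤ 2 * β := by
      rw [norm_inv, inv_le_comm₀ (norm_pos_iff.mpr hμ0) (by positivity), mul_inv]
      linarith
    rw [hid, norm_neg, norm_mul, norm_mul]
    calc ‖(t : ℂ)‖ * ‖μ⁻¹‖ * ‖(t : ℂ)⁻¹ - μ‖ ≤ β * (2 * β) * (C * ε) := by gcongr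
      _ = 2 * C * 1 * β ^ 2 * ε := by ring
      _ ≤ _ := by gcongr; linarith
  · obtain ⟨y, hy, hym⟩ := hmY
    refine ⟨y, hy, ?_⟩
    calc ‖(t : ℂ) - y‖ ≤ ‖(t : ℂ)‖ + ‖y‖ := norm_sub_le _ _
      _ ≤ β + m := by gcongr
      _ ≤ 1 * ((1 + m) * β) := by nlinarith
      _ ≤ (2 * C * β * ε) * ((1 + m) * β) := by gcongr
      _ = _ := by ring

theorem directedDist_closure_le {X Y : Set ℂ} (hX : ∀ x ∈ X, ∃ t : ℝ, 1 ≤ t ∧ x = t)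
    {C ε m a b : ℝ} (hC : 0 < C) (hε : 0 < ε)
    (hm : 0 ≤ m) (h : ∀ x ∈ X, ∃ μ : ℂ, ‖x⁻¹ - μ‖ ≤ C * ε ∧ (μ = 0 ∨ μ⁻¹ ∈ Y))
    (hmY : X.Nonempty → Y.Nonempty → ∃ y ∈ Y, ‖y‖ ≤ m) :
    directedDist (((↑) : ℝ → ℂ) '' Set.Icc a b ∩ closure X) (closure Y)
      ≤ ENNReal.ofReal (4 * C * (1 + m) * (1 + b ^ 2) * ε) := by
  rw [directedDist]
  refine iSup₂_le fun x hx => iSup_le fun hYne => ?_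
  obtain ⟨⟨t, ⟨-, htb⟩, rfl⟩, hxX⟩ := hx
  rw [closure_nonempty_iff] at hYne
  have hXne : X.Nonempty := closure_nonempty_iff.mp ⟨_, hxX⟩
  have ht1 : 1 ≤ t := by
    have hcl : IsClosed {z : ℂ | 1 ≤ z.re} := isClosed_le continuous_const Complex.continuous_re
    have hsub : X ⊆ {z : ℂ | 1 ≤ z.re} := by
      intro z hz
      obtain ⟨s, hs, rfl⟩ := hX z hz
      simpa using hs
    simpa using closure_minimal hsub hcl hxX
  rw [Metric.infEDist_closure]
  refine ENNReal.le_of_forall_pos_le_add fun η hη _ => ?_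
  -- Accuracy 1 keeps |x'| ≤ b + 1, and (b + 1)² ≤ 2(1 + b²) explains the constant; accuracy η
  -- disappears in the limit.
  obtain ⟨x', hx', hd⟩ := Metric.mem_closure_iff.mp hxX (min η 1) (by positivity)
  rw [dist_eq_norm] at hd
  have hx'n : ‖x'‖ ≤ b + 1 := by
    have h1 := norm_sub_norm_le x' (t : ℂ)
    rw [norm_sub_rev] at h1
    have h2 : ‖(t : ℂ)‖ = t := by rw [Complex.norm_real, Real.norm_of_nonneg (by linarith)]
    have h3 := min_le_right (η : ℝ) 1
    linarith
  obtain ⟨y, hy, hxy⟩ := exists_near_of_inv_near hX hC hε hm h (hmY hXne hYne) hx' hx'n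
  refine (Metric.infEDist_le_edist_of_mem hy).trans ?_
  rw [edist_dist, dist_eq_norm, ← ENNReal.ofReal_coe_nnreal,
    ← ENNReal.ofReal_add (by positivity) (by positivity)]
  refine ENNReal.ofReal_le_ofReal ?_
  have h1 := norm_sub_le_norm_sub_add_norm_sub (t : ℂ) x' y
  have h3 := min_le_left (η : ℝ) 1
  have h4 : 2 * C * (1 + m) * (b + 1) ^ 2 * ε ≤ 4 * C * (1 + m) * (1 + b ^ 2) * ε := by
    have : (b + 1) ^ 2 ≤ 2 * (1 + b ^ 2) := by nlinarith [sq_nonneg (b - 1)]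
    calc _ ≤ 2 * C * (1 + m) * (2 * (1 + b ^ 2)) * ε := by gcongr
      _ = _ := by ring
  linarith

end Distances

end

/-! ### Uniform constants extracted from the assumptions. -/

section

theorem SForm.continuous_right {X : Type*} [NormedAddCommGroup X] [InnerProductSpace ℂ X]
    [CompleteSpace X] {s : SForm X} {C : ℝ} (hC : 0 ≤ C) (hs : ∀ u v, ‖s u v‖ ≤ C * ‖u‖ * ‖v‖)
    (u : X) : Continuous fun v => s u v := by
  obtain ⟨G, hG⟩ := exists_riesz_operator s hC hs
  simp only [hG]
  fun_prop

theorem SForm.continuous_left {X : Type*} [NormedAddCommGroup X] [InnerProductSpace ℂ X]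
    [CompleteSpace X] {s : SForm X} {C : ℝ} (hC : 0 ≤ C) (hs : ∀ u v, ‖s u v‖ ≤ C * ‖u‖ * ‖v‖)
    (v : X) : Continuous fun u => s u v := by
  obtain ⟨G, hG⟩ := exists_riesz_operator s hC hs
  simp only [hG]
  fun_prop

theorem SForm.continuous_diag {X : Type*} [NormedAddCommGroup X] [InnerProductSpace ℂ X]
    [CompleteSpace X] {s : SForm X} {C : ℝ} (hC : 0 ≤ C) (hs : ∀ u v, ‖s u v‖ ≤ C * ‖u‖ * ‖v‖) :
    Continuous fun u => s u u := by
  obtain ⟨G, hG⟩ := exists_riesz_operator s hC hs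
  simp only [hG]
  fun_prop

namespace Model

variable {n : ℕ} {H 𝓗 : Type*} [NormedAddCommGroup H] [InnerProductSpace ℂ H]
  [NormedAddCommGroup 𝓗] [InnerProductSpace ℂ 𝓗] (M : Model n H 𝓗)

/-- `(·, ·)_θ` as a non-negative form. -/
def ipForm (θ : Param n) : NonnegForm H where
  form := M.ip θ
  nonneg u := by
    have h1 := (M.a θ).nonneg u
    have h2 := (M.b θ).nonneg u
    simp only [ip, LinearMap.add_apply, Complex.add_re, Complex.add_im]
    exact ⟨by linarith, by linarith⟩

theorem ipForm_quad (θ : Param n) (u : H) :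
    (M.ipForm θ).quad u = (M.a θ).quad u + (M.b θ).quad u := by
  simp [NonnegForm.quad, ipForm, ip]

theorem nrm_eq (θ : Param n) (u : H) : M.nrm θ u = √((M.ipForm θ).quad u) := by
  rw [ipForm_quad, nrm]

theorem nrm_nonneg (θ : Param n) (u : H) : 0 ≤ M.nrm θ u := Real.sqrt_nonneg _

theorem nrm_sq (θ : Param n) (u : H) : M.nrm θ u ^ 2 = (M.ipForm θ).quad u := by
  rw [nrm_eq, Real.sq_sqrt (NonnegForm.quad_nonneg _ _)]

theorem a_quad_le (θ : Param n) (u : H) : (M.a θ).quad u ≤ M.nrm θ u ^ 2 := by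
  rw [nrm_sq, ipForm_quad]
  linarith [(M.b θ).quad_nonneg u]

theorem b_quad_le (θ : Param n) (u : H) : (M.b θ).quad u ≤ M.nrm θ u ^ 2 := by
  rw [nrm_sq, ipForm_quad]
  linarith [(M.a θ).quad_nonneg u]

theorem norm_a_le (θ : Param n) (u v : H) : ‖(M.a θ).form u v‖ ≤ M.nrm θ u * M.nrm θ v :=
  (M.a θ).norm_form_le_of_quad_le (M.nrm_nonneg θ u) (M.nrm_nonneg θ v)
    (M.a_quad_le θ u) (M.a_quad_le θ v)

theorem norm_b_le (θ : Param n) (u v : H) : ‖(M.b θ).form u v‖ ≤ M.nrm θ u * M.nrm θ v :=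
  (M.b θ).norm_form_le_of_quad_le (M.nrm_nonneg θ u) (M.nrm_nonneg θ v)
    (M.b_quad_le θ u) (M.b_quad_le θ v)

theorem a_left_eq_zero {θ : Param n} {v : H} (hv : v ∈ M.V θ) (u : H) : (M.a θ).form v u = 0 :=
  (M.a θ).form_eq_zero hv u

theorem a_right_eq_zero {θ : Param n} {v : H} (hv : v ∈ M.V θ) (u : H) :
    (M.a θ).form u v = 0 := by
  rw [(M.a θ).conj_symm v u, M.a_left_eq_zero hv, map_zero]

variable {M}

/-- The norms `‖·‖_θ` are uniformly comparable with the norm of `H`. -/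
theorem FormAssumptions.exists_nrm_bound (hform : M.FormAssumptions) (h0 : 0 ∈ M.Θ) :
    ∃ P : ℝ, 1 ≤ P ∧ ∀ θ ∈ M.Θ, ∀ u, M.nrm θ u ≤ P * ‖u‖ ∧ ‖u‖ ≤ P * M.nrm θ u := by
  obtain ⟨c, C, hc, hC, hcC⟩ := hform.equiv 0 h0
  obtain ⟨K, hK, hKu⟩ := hform.unif_equiv
  refine ⟨max 1 (max (K * C) (c⁻¹ * K)), le_max_left _ _, fun θ hθ u => ⟨?_, ?_⟩⟩
  · calc M.nrm θ u ≤ K * M.nrm 0 u := hKu u θ hθ 0 h0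
      _ ≤ K * (C * ‖u‖) := by gcongr; exact (hcC u).2
      _ = (K * C) * ‖u‖ := by ring
      _ ≤ _ := by gcongr; exact (le_max_left _ _).trans (le_max_right _ _)
  · have h1 := (hcC u).1
    have h2 := hKu u 0 h0 θ hθ
    calc ‖u‖ = c⁻¹ * (c * ‖u‖) := by field_simp
      _ ≤ c⁻¹ * (K * M.nrm θ u) := mul_le_mul_of_nonneg_left (h1.trans h2) (by positivity)
      _ = (c⁻¹ * K) * M.nrm θ u := by ring
      _ ≤ _ := by
        gcongr
        · exact M.nrm_nonneg θ u
        · exact (le_max_right _ _).trans (le_max_right _ _)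

/-- The quantitative content of the assumptions, in terms of the norm of `H` and with a single
constant. -/
structure Bounds (M : Model n H 𝓗) (Vstar : Submodule ℂ H) (Z : Submodule ℂ (M.V 0))
    (a' : M.FirstOrder) (a'' : M.SecondOrder) (T : Param n → Vstar →ₗ[ℂ] H)
    (E : Param n → 𝓗 ≃ₗ[ℂ] 𝓗) (κ : ℝ) : Prop where
  one_le : 1 ≤ κ
  norm_sq_le : ∀ θ ∈ M.Θ, ∀ u, ‖u‖ ^ 2 ≤ κ * ((M.a θ).quad u + (M.b θ).quad u)
  a_le : ∀ θ ∈ M.Θ, ∀ u v, ‖(M.a θ).form u v‖ ≤ κ * ‖u‖ * ‖v‖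
  b_le : ∀ θ ∈ M.Θ, ∀ u v, ‖(M.b θ).form u v‖ ≤ κ * ‖u‖ * ‖v‖
  a_lip : ∀ θ ∈ M.Θ, ∀ u v, ‖(M.a θ).form u v - (M.a 0).form u v‖ ≤ κ * ‖θ‖ * ‖u‖ * ‖v‖
  gap_zero : ∀ w ∈ M.W 0, ‖w‖ ^ 2 ≤ κ * (M.a 0).quad w
  gap : ∀ θ ∈ M.Θ, ∀ w ∈ M.W θ, ‖θ‖ ^ 2 * ‖w‖ ^ 2 ≤ κ * (M.a θ).quad w
  near_Vstar : ∀ θ ∈ M.Θ, ∀ v ∈ M.Vs Vstar θ, ∃ v' ∈ Vstar, ‖v - v'‖ ≤ κ * ‖θ‖ * ‖v‖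
  near_Vs : ∀ θ ∈ M.Θ, ∀ v ∈ Vstar, ∃ v' ∈ M.Vs Vstar θ, ‖v - v'‖ ≤ κ * ‖θ‖ * ‖v‖
  transversal : ∀ v ∈ Vstar, ∀ z ∈ Z, ‖v‖ ^ 2 + ‖z‖ ^ 2 ≤ κ * ‖v + (z : H)‖ ^ 2
  first : ∀ (v : M.V 0) (u : H), ∀ θ ∈ M.Θ,
    ‖(M.a θ).form v u - dotp (a' v u) θ‖ ≤ κ * ‖θ‖ ^ 2 * ‖v‖ * ‖u‖
  second : ∀ v v' : M.V 0, ∀ θ ∈ M.Θ,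
    ‖(M.a θ).form v v' - quadp (a'' v v') θ‖ ≤ κ * ‖θ‖ ^ 3 * ‖v‖ * ‖v'‖
  b_lip : ∀ v v' : M.V 0, ∀ θ ∈ M.Θ,
    ‖(M.b θ).form v v' - (M.b 0).form v v'‖ ≤ κ * ‖θ‖ * ‖v‖ * ‖v'‖
  transfer : ∀ θ ∈ M.Θ, ∀ v : Vstar, ∀ z ∈ Z,
    ‖(M.b θ).form (T θ v) (z : H) - (M.b 0).form v (z : H)‖ ≤ κ * ‖θ‖ * ‖v‖ * ‖z‖
  E_lip : ∀ θ ∈ M.Θ, ∀ u : 𝓗, (M.d θ).quad (E θ u - u) ≤ (κ * ‖θ‖) ^ 2 * (M.d 0).quad u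

variable {Vstar : Submodule ℂ H} {Z : Submodule ℂ (M.V 0)} {a' : M.FirstOrder}
  {a'' : M.SecondOrder}

theorem IsDefectSubspace.Vstar_le (hZ : M.IsDefectSubspace Vstar Z) : Vstar ≤ M.V 0 := by
  rw [← hZ.sup_eq]; exact le_sup_left

/-- The infimum in (H2) need not be attained, so `L` is enlarged to `L + 1`. The strict inequality
this requires fails only for θ₁ = θ₂ or v = 0, where v or 0 itself serves. -/
theorem RemovableSingularity.eventually_near (hform : M.FormAssumptions) (h0 : 0 ∈ M.Θ)
    (H2 : M.RemovableSingularity Vstar) :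
    ∀ᶠ κ in atTop, ∀ θ₁ ∈ M.Θ, ∀ θ₂ ∈ M.Θ, ∀ v ∈ M.Vs Vstar θ₁,
      ∃ v' ∈ M.Vs Vstar θ₂, ‖v - v'‖ ≤ κ * ‖θ₁ - θ₂‖ * ‖v‖ := by
  obtain ⟨P, hP, hPu⟩ := hform.exists_nrm_bound h0
  obtain ⟨L, hL, hLv⟩ := H2.lipschitz
  filter_upwards [eventually_ge_atTop (P ^ 2 * (L + 1))] with κ hκ θ₁ h₁ θ₂ h₂ v hv
  rcases eq_or_ne θ₁ θ₂ with rfl | hne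
  · exact ⟨v, hv, by simp⟩
  rcases eq_or_ne v 0 with rfl | hv0
  · exact ⟨0, Submodule.zero_mem _, by simp⟩
  have hθ : 0 < ‖θ₁ - θ₂‖ := norm_pos_iff.mpr (sub_ne_zero.mpr hne)
  have hn : 0 < M.nrm θ₁ v := by
    have h1 := (hPu θ₁ h₁ v).2
    have h2 := norm_pos_iff.mpr hv0
    by_contra hneg
    have := mul_nonneg (zero_le_one.trans hP) (neg_nonneg.mpr (not_lt.mp hneg))
    linarith
  have hlt : ⨅ v₂ : M.Vs Vstar θ₂, M.nrm θ₂ (v - (v₂ : H)) <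
      (L + 1) * ‖θ₁ - θ₂‖ * M.nrm θ₁ v := by
    refine (hLv θ₁ h₁ θ₂ h₂ v hv).trans_lt ?_
    gcongr
    linarith
  obtain ⟨v', hv'⟩ := exists_lt_of_ciInf_lt hlt
  refine ⟨v', v'.2, ?_⟩
  calc ‖v - (v' : H)‖ ≤ P * M.nrm θ₂ (v - v') := (hPu θ₂ h₂ _).2
    _ ≤ P * ((L + 1) * ‖θ₁ - θ₂‖ * (P * ‖v‖)) := by
      gcongr
      refine hv'.le.trans ?_
      gcongr
      exact (hPu θ₁ h₁ v).1
    _ = (P ^ 2 * (L + 1)) * ‖θ₁ - θ₂‖ * ‖v‖ := by ring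
    _ ≤ _ := by gcongr

/-- Every inequality survives an increase of its constant, so one `κ` beyond finitely many
thresholds serves all of them. -/
theorem exists_bounds (hform : M.FormAssumptions) (h0 : 0 ∈ M.Θ) (H1 : M.GapCondition)
    (H2 : M.RemovableSingularity Vstar) (hZ : M.IsDefectSubspace Vstar Z) (H3 : M.QuadraticGap)
    (H4 : M.Differentiability a' a'') (H5 : M.LipschitzAtZero)
    {T : Param n → Vstar →ₗ[ℂ] H} {E : Param n → 𝓗 ≃ₗ[ℂ] 𝓗}
    (hT : ∃ K : ℝ, 0 ≤ K ∧ ∀ θ ∈ M.Θ, ∀ v : Vstar, ∀ z ∈ Z,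
      ‖(M.b θ).form (T θ v) (z : H) - (M.b 0).form v (z : H)‖
        ≤ K * ‖θ‖ * M.nrm 0 v * M.nrm 0 (z : H))
    (hE0 : ∀ u : 𝓗, E 0 u = u)
    (hE : ∃ K : ℝ, 0 ≤ K ∧ ∀ θ₁ ∈ M.Θ, ∀ θ₂ ∈ M.Θ, ∀ u : 𝓗,
      Real.sqrt ((M.d θ₁).quad (E θ₁ u - E θ₂ u))
        ≤ K * ‖θ₁ - θ₂‖ * Real.sqrt ((M.d 0).quad u)) :
    ∃ κ, M.Bounds Vstar Z a' a'' T E κ := by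
  obtain ⟨P, hP, hPu⟩ := hform.exists_nrm_bound h0
  have hP0 : 0 ≤ P := zero_le_one.trans hP
  have hup : ∀ θ ∈ M.Θ, ∀ u, M.nrm θ u ≤ P * ‖u‖ := fun θ hθ u => (hPu θ hθ u).1
  have hlo : ∀ θ ∈ M.Θ, ∀ u, ‖u‖ ^ 2 ≤ P ^ 2 * M.nrm θ u ^ 2 := fun θ hθ u => by
    rw [← mul_pow]
    exact pow_le_pow_left₀ (norm_nonneg _) (hPu θ hθ u).2 2
  have hprod : ∀ {x K : ℝ}, ∀ θ₁ ∈ M.Θ, ∀ θ₂ ∈ M.Θ, ∀ u v, 0 ≤ K →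
      x ≤ K * M.nrm θ₁ u * M.nrm θ₂ v → x ≤ (P ^ 2 * K) * ‖u‖ * ‖v‖ := by
    intro x K θ₁ h₁ θ₂ h₂ u v hK hx
    calc x ≤ K * M.nrm θ₁ u * M.nrm θ₂ v := hx
      _ ≤ K * (P * ‖u‖) * (P * ‖v‖) := by
        gcongr
        · exact M.nrm_nonneg _ _
        · exact hup _ h₁ _
        · exact hup _ h₂ _
      _ = _ := by ring
  obtain ⟨L, hL, hLip⟩ := hform.lipschitz
  obtain ⟨ν, hν, hνw⟩ := H1 0 h0
  obtain ⟨γ, hγ, hγw⟩ := H3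
  obtain ⟨Kt, hKt0, hKt1, hKtr⟩ := hZ.transversal
  obtain ⟨K1, hK1, hfirst⟩ := H4.first
  obtain ⟨K2, hK2, hsecond⟩ := H4.second
  obtain ⟨Lb, hLb, hLip_b⟩ := H5
  obtain ⟨Kb, hKb, htr⟩ := hT
  obtain ⟨Ke, hKe, hEl⟩ := hE
  have hVs0 : M.Vs Vstar 0 = Vstar := by simp [Vs]
  have hex := (H2.eventually_near hform h0).and <| (eventually_ge_atTop (1 : ℝ)).and <|
    (eventually_ge_atTop (P ^ 2)).and <| (eventually_ge_atTop (P ^ 2 * L)).and <|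
    (eventually_ge_atTop (P ^ 2 * ν⁻¹)).and <| (eventually_ge_atTop (P ^ 2 * γ⁻¹)).and <|
    (eventually_ge_atTop (P ^ 4 * (1 - Kt)⁻¹)).and <| (eventually_ge_atTop (P ^ 2 * K1)).and <|
    (eventually_ge_atTop (P ^ 2 * K2)).and <| (eventually_ge_atTop (P ^ 2 * Lb)).and <|
    (eventually_ge_atTop (P ^ 2 * Kb)).and (eventually_ge_atTop Ke)
  obtain ⟨κ, hnear, h1, hP2, hκL, hκν, hκγ, hκt, hκ1, hκ2, hκb, hκB, hκe⟩ := hex.exists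
  refine ⟨κ, ?_⟩
  constructor
  · exact h1
  · intro θ hθ u
    rw [← ipForm_quad, ← nrm_sq]
    exact (hlo θ hθ u).trans (by gcongr)
  · intro θ hθ u v
    have := hprod (x := ‖(M.a θ).form u v‖) θ hθ θ hθ u v zero_le_one
      (by rw [one_mul]; exact M.norm_a_le θ u v)
    exact this.trans (by rw [mul_one]; gcongr)
  · intro θ hθ u v
    have := hprod (x := ‖(M.b θ).form u v‖) θ hθ θ hθ u v zero_le_one
      (by rw [one_mul]; exact M.norm_b_le θ u v)
    exact this.trans (by rw [mul_one]; gcongr)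
  · intro θ hθ u v
    have h := hLip u v θ hθ 0 h0
    rw [sub_zero] at h
    have := hprod θ hθ θ hθ u v (by positivity) h
    refine this.trans ?_
    rw [← mul_assoc]
    gcongr
  · intro w hw
    have h := hνw w hw
    calc ‖w‖ ^ 2 ≤ P ^ 2 * M.nrm 0 w ^ 2 := hlo 0 h0 w
      _ = P ^ 2 * ν⁻¹ * (ν * M.nrm 0 w ^ 2) := by field_simp
      _ ≤ P ^ 2 * ν⁻¹ * (M.a 0).quad w := by gcongr
      _ ≤ _ := by gcongr; exact (M.a 0).quad_nonneg w
  · intro θ hθ w hw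
    have h := hγw θ hθ w hw
    calc ‖θ‖ ^ 2 * ‖w‖ ^ 2 ≤ ‖θ‖ ^ 2 * (P ^ 2 * M.nrm θ w ^ 2) := by gcongr; exact hlo θ hθ w
      _ = P ^ 2 * γ⁻¹ * (γ * ‖θ‖ ^ 2 * M.nrm θ w ^ 2) := by field_simp
      _ ≤ P ^ 2 * γ⁻¹ * (M.a θ).quad w := by gcongr
      _ ≤ _ := by gcongr; exact (M.a θ).quad_nonneg w
  · intro θ hθ v hv
    obtain ⟨v', hv', h⟩ := hnear θ hθ 0 h0 v hv
    rw [hVs0] at hv'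
    exact ⟨v', hv', by rwa [sub_zero] at h⟩
  · intro θ hθ v hv
    obtain ⟨v', hv', h⟩ := hnear 0 h0 θ hθ v (by rwa [hVs0])
    exact ⟨v', hv', by rwa [zero_sub, norm_neg] at h⟩
  · intro v hv z hz
    have h := hKtr v hv z hz
    have h2 := (M.ipForm 0).quad_add v z
    have h3 : -(Kt * M.nrm 0 v * M.nrm 0 (z : H)) ≤ ((M.ipForm 0).form v z).re :=
      (neg_le_neg h).trans (neg_le_of_abs_le (Complex.abs_re_le_norm _))
    rw [← nrm_sq, ← nrm_sq, ← nrm_sq] at h2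
    -- The cross term is at least −2K‖v‖‖z‖ ≥ −K(‖v‖² + ‖z‖²).
    have h4 : (1 - Kt) * (M.nrm 0 v ^ 2 + M.nrm 0 (z : H) ^ 2) ≤ M.nrm 0 (v + z) ^ 2 := by
      nlinarith [mul_nonneg hKt0 (sq_nonneg (M.nrm 0 v - M.nrm 0 (z : H)))]
    have hpos : 0 < 1 - Kt := by linarith
    have h5 := hup 0 h0 (v + z)
    calc ‖v‖ ^ 2 + ‖(z : H)‖ ^ 2 ≤ P ^ 2 * M.nrm 0 v ^ 2 + P ^ 2 * M.nrm 0 (z : H) ^ 2 :=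
          add_le_add (hlo 0 h0 v) (hlo 0 h0 z)
      _ = P ^ 2 * (1 - Kt)⁻¹ * ((1 - Kt) * (M.nrm 0 v ^ 2 + M.nrm 0 (z : H) ^ 2)) := by
          field_simp
      _ ≤ P ^ 2 * (1 - Kt)⁻¹ * (P * ‖v + (z : H)‖) ^ 2 := by
          gcongr
          exact h4.trans (pow_le_pow_left₀ (M.nrm_nonneg _ _) h5 2)
      _ = P ^ 4 * (1 - Kt)⁻¹ * ‖v + (z : H)‖ ^ 2 := by ring
      _ ≤ _ := by gcongr
  · intro v u θ hθ
    refine (hprod 0 h0 0 h0 _ _ (by positivity) (hfirst v u θ hθ)).trans ?_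
    rw [← mul_assoc, Submodule.coe_norm]
    gcongr
  · intro v v' θ hθ
    refine (hprod 0 h0 0 h0 _ _ (by positivity) (hsecond v v' θ hθ)).trans ?_
    rw [← mul_assoc, Submodule.coe_norm, Submodule.coe_norm]
    gcongr
  · intro v v' θ hθ
    refine (hprod 0 h0 θ hθ _ _ (by positivity) (hLip_b v v' θ hθ)).trans ?_
    rw [← mul_assoc, Submodule.coe_norm, Submodule.coe_norm]
    gcongr
  · intro θ hθ v z hz
    refine (hprod 0 h0 0 h0 _ _ (by positivity) (htr θ hθ v z hz)).trans ?_
    rw [← mul_assoc, Submodule.coe_norm, Submodule.coe_norm]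
    gcongr
  · intro θ hθ u
    have h := hEl θ hθ 0 h0 u
    rw [sub_zero, hE0, Real.sqrt_le_iff] at h
    refine h.2.trans ?_
    rw [mul_pow, Real.sq_sqrt ((M.d 0).quad_nonneg u)]
    gcongr
    exact (M.d 0).quad_nonneg u

end Model

end

/-! ### Decompositions of H and coercivity near θ = 0. -/

section

namespace Model

theorem dotp_smul {n : ℕ} (x : Fin n → ℂ) (t : ℝ) (θ : Param n) :
    dotp x (t • θ) = t * dotp x θ := by
  simp only [dotp, Finset.mul_sum, PiLp.smul_apply, smul_eq_mul, Complex.ofReal_mul]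
  exact Finset.sum_congr rfl fun i _ => by ring

theorem quadp_smul {n : ℕ} (A : Matrix (Fin n) (Fin n) ℂ) (t : ℝ) (θ : Param n) :
    quadp A (t • θ) = (t : ℂ) ^ 2 * quadp A θ := by
  simp only [quadp, Finset.mul_sum, PiLp.smul_apply, smul_eq_mul, Complex.ofReal_mul]
  exact Finset.sum_congr rfl fun i _ => Finset.sum_congr rfl fun j _ => by ring

theorem exists_smul_norm_eq {n : ℕ} {ξ : Param n} (hξ : ξ ≠ 0) {r : ℝ} (hr : 0 ≤ r) :
    ‖(r / ‖ξ‖) • ξ‖ = r := by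
  rw [norm_smul, Real.norm_of_nonneg (by positivity), div_mul_cancel₀ _ (norm_ne_zero_iff.mpr hξ)]

variable {n : ℕ} {H 𝓗 : Type*} [NormedAddCommGroup H] [InnerProductSpace ℂ H]
  [NormedAddCommGroup 𝓗] [InnerProductSpace ℂ 𝓗] {M : Model n H 𝓗}

variable {Vstar : Submodule ℂ H} {Z : Submodule ℂ (M.V 0)} {a' : M.FirstOrder}
  {a'' : M.SecondOrder} {T : Param n → Vstar →ₗ[ℂ] H} {E : Param n → 𝓗 ≃ₗ[ℂ] 𝓗} {κ : ℝ}

theorem ip_apply (θ : Param n) (u v : H) :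
    M.ip θ u v = (M.a θ).form u v + (M.b θ).form u v := rfl

theorem exists_closedBall_subset (hint : (0 : Param n) ∈ interior M.Θ) :
    ∃ r : ℝ, 0 < r ∧ ∀ θ : Param n, ‖θ‖ ≤ r → θ ∈ M.Θ := by
  obtain ⟨r, hr, h⟩ := Metric.nhds_basis_closedBall.mem_iff.mp (mem_interior_iff_mem_nhds.mp hint)
  exact ⟨r, hr, fun θ hθ => h (by simpa using hθ)⟩

theorem mem_W_iff {θ : Param n} {w : H} : w ∈ M.W θ ↔ ∀ v ∈ M.V θ, M.ip θ w v = 0 := Iff.rfl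

namespace Bounds

variable (hB : M.Bounds Vstar Z a' a'' T E κ)
include hB

theorem pos : 0 < κ := zero_lt_one.trans_le hB.one_le

theorem ip_le {θ : Param n} (hθ : θ ∈ M.Θ) (u v : H) : ‖M.ip θ u v‖ ≤ 2 * κ * ‖u‖ * ‖v‖ := by
  rw [ip_apply]
  refine (norm_add_le _ _).trans ?_
  linarith [hB.a_le θ hθ u v, hB.b_le θ hθ u v]

theorem a_quad_le {θ : Param n} (hθ : θ ∈ M.Θ) (u : H) : (M.a θ).quad u ≤ κ * ‖u‖ ^ 2 := by
  have := (Complex.re_le_norm _).trans (hB.a_le θ hθ u u)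
  rw [NonnegForm.quad, sq, ← mul_assoc]
  exact this

theorem b_quad_le {θ : Param n} (hθ : θ ∈ M.Θ) (u : H) : (M.b θ).quad u ≤ κ * ‖u‖ ^ 2 := by
  have := (Complex.re_le_norm _).trans (hB.b_le θ hθ u u)
  rw [NonnegForm.quad, sq, ← mul_assoc]
  exact this

section Complete

variable [CompleteSpace H]

theorem isClosed_V {θ : Param n} (hθ : θ ∈ M.Θ) : IsClosed (M.V θ : Set H) :=
  isClosed_eq (SForm.continuous_diag hB.pos.le (hB.a_le θ hθ)) continuous_const

theorem isClosed_W {θ : Param n} (hθ : θ ∈ M.Θ) : IsClosed (M.W θ : Set H) := by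
  have : (M.W θ : Set H) = ⋂ v ∈ M.V θ, {w | M.ip θ w v = 0} := by
    ext w; simp [mem_W_iff]
  rw [this]
  exact isClosed_biInter fun v _ => isClosed_eq
    (SForm.continuous_left (by linarith [hB.pos]) (hB.ip_le hθ) v) continuous_const

/-- Lax–Milgram for (·,·)_θ on the closed subspace V_θ produces the orthogonal projection onto it.
-/
theorem exists_decomp {θ : Param n} (hθ : θ ∈ M.Θ) (h : H) :
    ∃ v ∈ M.V θ, ∃ w ∈ M.W θ, v + w = h := by
  have : CompleteSpace (M.V θ) := (hB.isClosed_V hθ).completeSpace_coe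
  have hκ := hB.pos
  obtain ⟨S, hS⟩ := lax_milgram (Y := H) ((M.ip θ).domRestrict₁₂ (M.V θ) (M.V θ)) (c := κ⁻¹)
    (C := 2 * κ) (by positivity) (by positivity)
    (fun u => by
      have h1 := hB.norm_sq_le θ hθ u
      rw [inv_mul_le_iff₀ hκ]
      exact h1)
    (fun u v => hB.ip_le hθ u v) ((M.ip θ).domRestrict₂ (M.V θ)) (D := 2 * κ) (by positivity)
    (fun u v => hB.ip_le hθ u v)
  refine ⟨S h, (S h).2, h - S h, fun v hv => ?_, by simp⟩
  have := hS h ⟨v, hv⟩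
  change M.ip θ (S h) v = M.ip θ h v at this
  rw [map_sub, LinearMap.sub_apply, this, sub_self]

end Complete

theorem orthogonal_bound (h0 : 0 ∈ M.Θ) {v w : H} (hv : v ∈ M.V 0) (hw : w ∈ M.W 0) :
    ‖v‖ ^ 2 + ‖w‖ ^ 2 ≤ 2 * κ ^ 2 * ‖v + w‖ ^ 2 := by
  have h1 := (M.ipForm 0).quad_add w v
  have h2 : (M.ipForm 0).form w v = 0 := hw v hv
  rw [h2, Complex.zero_re, mul_zero, add_zero, add_comm w v] at h1
  have h3 := hB.norm_sq_le 0 h0 v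
  have h4 := hB.norm_sq_le 0 h0 w
  rw [← ipForm_quad] at h3 h4
  have h5 : (M.ipForm 0).quad (v + w) ≤ 2 * κ * ‖v + w‖ ^ 2 := by
    rw [ipForm_quad]
    linarith [hB.a_quad_le h0 (v + w), hB.b_quad_le h0 (v + w)]
  calc _ ≤ κ * (M.ipForm 0).quad v + κ * (M.ipForm 0).quad w := add_le_add h3 h4
    _ = κ * (M.ipForm 0).quad (v + w) := by rw [h1]; ring
    _ ≤ κ * (2 * κ * ‖v + w‖ ^ 2) := mul_le_mul_of_nonneg_left h5 hB.pos.le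
    _ = _ := by ring

/-- Pythagoras separates V_0 from W_0, and transversality separates `Vstar` from `Z` inside V_0. -/
theorem triple_bound (h0 : 0 ∈ M.Θ) (hle : Vstar ≤ M.V 0) :
    ∃ C : ℝ, 1 ≤ C ∧ ∀ v ∈ Vstar, ∀ z ∈ Z, ∀ w ∈ M.W 0,
      ‖v‖ + ‖(z : H)‖ + ‖w‖ ≤ C * ‖v + z + w‖ := by
  have hκ := hB.pos
  refine ⟨3 * √(2 * κ ^ 3), ?_, fun v hv z hz w hw => ?_⟩
  · have : 1 ≤ √(2 * κ ^ 3) := by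
      rw [Real.one_le_sqrt]
      have := one_le_pow₀ (n := 3) hB.one_le
      linarith
    linarith
  have h1 := hB.orthogonal_bound h0 (Submodule.add_mem _ (hle hv) z.2) hw
  have h2 := hB.transversal v hv z hz
  have hκ1 := hB.one_le
  have h3 : ‖v‖ ^ 2 + ‖(z : H)‖ ^ 2 + ‖w‖ ^ 2 ≤ 2 * κ ^ 3 * ‖v + z + w‖ ^ 2 := by
    calc ‖v‖ ^ 2 + ‖(z : H)‖ ^ 2 + ‖w‖ ^ 2 ≤ κ * ‖v + (z : H)‖ ^ 2 + ‖w‖ ^ 2 := by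
          gcongr; exact h2
      _ ≤ κ * ‖v + (z : H)‖ ^ 2 + κ * ‖w‖ ^ 2 := by nlinarith [sq_nonneg ‖w‖]
      _ = κ * (‖v + (z : H)‖ ^ 2 + ‖w‖ ^ 2) := by ring
      _ ≤ κ * (2 * κ ^ 2 * ‖v + z + w‖ ^ 2) := by gcongr
      _ = _ := by ring
  have key : ∀ x : ℝ, x ^ 2 ≤ 2 * κ ^ 3 * ‖v + z + w‖ ^ 2 →
      x ≤ √(2 * κ ^ 3) * ‖v + z + w‖ := by
    intro x hx
    refine le_of_sq_le_sq ?_ (by positivity)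
    rw [mul_pow, Real.sq_sqrt (by positivity)]
    exact hx
  have k1 := key ‖v‖ (by linarith [sq_nonneg ‖(z : H)‖, sq_nonneg ‖w‖])
  have k2 := key ‖(z : H)‖ (by linarith [sq_nonneg ‖v‖, sq_nonneg ‖w‖])
  have k3 := key ‖w‖ (by linarith [sq_nonneg ‖(z : H)‖, sq_nonneg ‖v‖])
  linarith

theorem triple_bound_near (h0 : 0 ∈ M.Θ) (hle : Vstar ≤ M.V 0) :
    ∃ r C : ℝ, 0 < r ∧ 0 < C ∧ ∀ θ ∈ M.Θ, ‖θ‖ ≤ r → ∀ v ∈ M.Vs Vstar θ, ∀ z ∈ Z, ∀ w ∈ M.W 0,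
      ‖v‖ + ‖(z : H)‖ + ‖w‖ ≤ C * ‖v + z + w‖ := by
  obtain ⟨C, hC, h⟩ := hB.triple_bound h0 hle
  have hκ := hB.pos
  -- On this ball (C + 1)κ‖θ‖ ≤ 1/2, so replacing v by a nearby element of `Vstar` costs at most
  -- ‖v‖/2, which is absorbed on the left.
  refine ⟨(2 * (C + 1) * κ)⁻¹, 2 * C, by positivity, by positivity,
    fun θ hθ hθr v hv z hz w hw => ?_⟩
  obtain ⟨v', hv', hd⟩ := hB.near_Vstar θ hθ v hv
  have h1 := h v' hv' z hz w hw
  have h2 : ‖v' + z + w‖ ≤ ‖v + z + w‖ + ‖v - v'‖ := by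
    have : v' + z + w = (v + z + w) - (v - v') := by abel
    rw [this]; exact norm_sub_le _ _
  have h3 : ‖v‖ ≤ ‖v'‖ + ‖v - v'‖ := by
    have := norm_add_le v' (v - v')
    rwa [add_sub_cancel] at this
  have h4 : (C + 1) * ‖v - v'‖ ≤ ‖v‖ / 2 := by
    calc (C + 1) * ‖v - v'‖ ≤ (C + 1) * (κ * (2 * (C + 1) * κ)⁻¹ * ‖v‖) := by
          gcongr
          refine hd.trans ?_
          gcongr
      _ = ‖v‖ / 2 := by field_simp
  have h5 : C * ‖v' + z + w‖ ≤ C * (‖v + z + w‖ + ‖v - v'‖) := by gcongr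
  nlinarith [norm_nonneg w, norm_nonneg (z : H)]

/-- At θ = 0 the triple sum is all of H; moving only the `Vstar` component into V_θ^⋆ costs O(θ). -/
theorem exists_near_triple [CompleteSpace H] (h0 : 0 ∈ M.Θ) (hle : Vstar ≤ M.V 0)
    (hZ : M.IsDefectSubspace Vstar Z) :
    ∃ C : ℝ, 0 < C ∧ ∀ θ ∈ M.Θ, ∀ h : H,
      ∃ x ∈ M.Vs Vstar θ ⊔ Z.map (M.V 0).subtype ⊔ M.W 0, ‖h - x‖ ≤ C * ‖θ‖ * ‖h‖ := by
  obtain ⟨C, hC, hb⟩ := hB.triple_bound h0 hle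
  have hκ := hB.pos
  refine ⟨κ * C, by positivity, fun θ hθ h => ?_⟩
  obtain ⟨y, hy, w, hw, rfl⟩ := hB.exists_decomp h0 h
  rw [← hZ.sup_eq] at hy
  obtain ⟨v, hv, z, hz, rfl⟩ := Submodule.mem_sup.mp hy
  obtain ⟨z, hzZ, rfl⟩ := hz
  obtain ⟨v', hv', hd⟩ := hB.near_Vs θ hθ v hv
  refine ⟨v' + z + w, Submodule.add_mem_sup (Submodule.add_mem_sup hv'
    ⟨z, hzZ, rfl⟩) hw, ?_⟩
  have h1 := hb v hv z hzZ w hw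
  have h2 : v + (M.V 0).subtype z + w - (v' + z + w) = v - v' := by
    rw [Submodule.subtype_apply]; abel
  rw [h2]
  refine hd.trans ?_
  calc κ * ‖θ‖ * ‖v‖ ≤ κ * ‖θ‖ * (C * ‖v + z + w‖) := by
        gcongr
        linarith [norm_nonneg w, norm_nonneg (z : H)]
    _ = κ * C * ‖θ‖ * ‖v + z + w‖ := by ring

/-- For small `θ` the sum of `V_θ^⋆`, `Z` and `W_0` is dense. -/
theorem exists_dense_triple [CompleteSpace H] (h0 : 0 ∈ M.Θ) (hle : Vstar ≤ M.V 0)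
    (hZ : M.IsDefectSubspace Vstar Z) :
    ∃ r : ℝ, 0 < r ∧ ∀ θ ∈ M.Θ, ‖θ‖ ≤ r →
      Dense ((M.Vs Vstar θ ⊔ Z.map (M.V 0).subtype ⊔ M.W 0 : Submodule ℂ H) : Set H) := by
  obtain ⟨C, hC, hb⟩ := hB.exists_near_triple h0 hle hZ
  refine ⟨(2 * C)⁻¹, by positivity, fun θ hθ hθr => ?_⟩
  rw [Submodule.dense_iff_topologicalClosure_eq_top, Submodule.topologicalClosure_eq_top_iff,
    Submodule.eq_bot_iff]
  -- A vector h orthogonal to the sum satisfies ‖h‖² = ⟨h − x, h⟩ ≤ ‖h‖²/2 for a suitable x in the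
  -- sum, hence vanishes.
  intro h hh
  obtain ⟨x, hx, hd⟩ := hb θ hθ h
  have h1 : inner ℂ h h = inner ℂ (h - x) h := by
    rw [inner_sub_left, (Submodule.mem_orthogonal _ _).mp hh x hx, sub_zero]
  have h2 : ‖h‖ ^ 2 ≤ ‖h - x‖ * ‖h‖ := by
    have h3 := norm_inner_le_norm (𝕜 := ℂ) (h - x) h
    rw [← h1, inner_self_eq_norm_sq_to_K] at h3
    simpa using h3
  have h4 : ‖h - x‖ ≤ ‖h‖ / 2 := by
    refine hd.trans ?_
    calc C * ‖θ‖ * ‖h‖ ≤ C * (2 * C)⁻¹ * ‖h‖ := by gcongr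
      _ = ‖h‖ / 2 := by field_simp
  by_contra hne
  have hpos : 0 < ‖h‖ := norm_pos_iff.mpr hne
  nlinarith

/-- By homogeneity ξ can be rescaled to a fixed norm inside Θ, where both a_θ and the remainder in
(H4) are bounded. -/
theorem first_bound (hint : (0 : Param n) ∈ interior M.Θ) :
    ∃ C : ℝ, 0 < C ∧ ∀ (v : M.V 0) (u : H) (ξ : Param n),
      ‖dotp (a' v u) ξ‖ ≤ C * ‖ξ‖ * ‖v‖ * ‖u‖ := by
  obtain ⟨r, hr, hrΘ⟩ := exists_closedBall_subset hint
  have hκ := hB.pos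
  refine ⟨(κ + κ * r ^ 2) / r, by positivity, fun v u ξ => ?_⟩
  rcases eq_or_ne ξ 0 with rfl | hξ
  · simp [dotp]
  have hn := exists_smul_norm_eq hξ hr.le
  have hξn : 0 < ‖ξ‖ := norm_pos_iff.mpr hξ
  have hθ := hrΘ _ hn.le
  have h1 := hB.first v u _ hθ
  have h2 := hB.a_le _ hθ v u
  rw [hn, norm_sub_rev] at h1
  have h3 := norm_sub_norm_le (dotp (a' v u) ((r / ‖ξ‖) • ξ))
    ((M.a ((r / ‖ξ‖) • ξ)).form v u)
  rw [dotp_smul, norm_mul, Complex.norm_real, Real.norm_of_nonneg (by positivity)] at h3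
  rw [dotp_smul] at h1
  have h4 : (r / ‖ξ‖) * ‖dotp (a' v u) ξ‖ ≤ (κ + κ * r ^ 2) * ‖v‖ * ‖u‖ := by
    rw [Submodule.coe_norm] at h1 ⊢
    linarith
  calc ‖dotp (a' v u) ξ‖ = (‖ξ‖ / r) * ((r / ‖ξ‖) * ‖dotp (a' v u) ξ‖) := by field_simp
    _ ≤ (‖ξ‖ / r) * ((κ + κ * r ^ 2) * ‖v‖ * ‖u‖) := by gcongr
    _ = _ := by ring

theorem second_bound (hint : (0 : Param n) ∈ interior M.Θ) :
    ∃ C : ℝ, 0 < C ∧ ∀ (v v' : M.V 0) (ξ : Param n),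
      ‖quadp (a'' v v') ξ‖ ≤ C * ‖ξ‖ ^ 2 * ‖v‖ * ‖v'‖ := by
  obtain ⟨r, hr, hrΘ⟩ := exists_closedBall_subset hint
  have hκ := hB.pos
  refine ⟨(κ + κ * r ^ 3) / r ^ 2, by positivity, fun v v' ξ => ?_⟩
  rcases eq_or_ne ξ 0 with rfl | hξ
  · simp [quadp]
  have hn := exists_smul_norm_eq hξ hr.le
  have hξn : 0 < ‖ξ‖ := norm_pos_iff.mpr hξ
  have hθ := hrΘ _ hn.le
  have h1 := hB.second v v' _ hθ
  have h2 := hB.a_le _ hθ v v'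
  rw [hn, norm_sub_rev] at h1
  have h3 := norm_sub_norm_le (quadp (a'' v v') ((r / ‖ξ‖) • ξ))
    ((M.a ((r / ‖ξ‖) • ξ)).form v v')
  rw [quadp_smul, norm_mul, norm_pow, Complex.norm_real,
    Real.norm_of_nonneg (by positivity)] at h3
  rw [quadp_smul] at h1
  have h4 : (r / ‖ξ‖) ^ 2 * ‖quadp (a'' v v') ξ‖ ≤ (κ + κ * r ^ 3) * ‖v‖ * ‖v'‖ := by
    rw [Submodule.coe_norm, Submodule.coe_norm] at h1 ⊢
    linarith
  calc ‖quadp (a'' v v') ξ‖ = (‖ξ‖ / r) ^ 2 * ((r / ‖ξ‖) ^ 2 * ‖quadp (a'' v v') ξ‖) := by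
        field_simp
    _ ≤ (‖ξ‖ / r) ^ 2 * ((κ + κ * r ^ 3) * ‖v‖ * ‖v'‖) := by gcongr
    _ = _ := by ring

/-- The coercivity of `a_θ` on `Z ∔ W_0` for small `θ`. -/
theorem coercive_near [CompleteSpace H] (hint : (0 : Param n) ∈ interior M.Θ)
    (hle : Vstar ≤ M.V 0) :
    ∃ r C : ℝ, 0 < r ∧ 0 < C ∧ ∀ θ ∈ M.Θ, ‖θ‖ ≤ r → ∀ z ∈ Z, ∀ w ∈ M.W 0,
      ‖θ‖ ^ 2 * ‖z‖ ^ 2 + ‖w‖ ^ 2 ≤ C * (M.a θ).quad (z + w) := by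
  have h0 : 0 ∈ M.Θ := interior_subset hint
  have hκ := hB.pos
  obtain ⟨r₁, C₁, hr₁, hC₁, h₁⟩ := hB.triple_bound_near h0 hle
  obtain ⟨C₂, hC₂, h₂⟩ := hB.second_bound hint
  refine ⟨min (min r₁ 1) (2 * κ ^ 2)⁻¹,
    κ * C₁ ^ 2 + 2 * (2 * κ + 2 * κ * (C₂ + κ) * (κ * C₁ ^ 2)), by positivity, by positivity,
    fun θ hθ hθr z hz w hw => ?_⟩
  have hθ₁ : ‖θ‖ ≤ r₁ := hθr.trans ((min_le_left _ _).trans (min_le_left _ _))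
  have hθ₂ : ‖θ‖ ≤ 1 := hθr.trans ((min_le_left _ _).trans (min_le_right _ _))
  have hθ₃ : ‖θ‖ ≤ (2 * κ ^ 2)⁻¹ := hθr.trans (min_le_right _ _)
  have hA := (M.a θ).quad_nonneg (z + w)
  -- Write z + w = v + w' with v in V_θ and w' in W_θ. Then a_θ only sees w' = −v + z + w, whose
  -- norm dominates ‖z‖ by the triple bound, and (H3) applies to w'. At θ = 0 the left side
  -- vanishes.
  have hz1 : ‖θ‖ ^ 2 * ‖z‖ ^ 2 ≤ κ * C₁ ^ 2 * (M.a θ).quad (z + w) := by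
    rcases eq_or_ne θ 0 with rfl | hne
    · simp only [norm_zero]
      have := mul_nonneg (show 0 ≤ κ * C₁ ^ 2 by positivity) hA
      simpa using this
    obtain ⟨v, hv, w', hw', hvw⟩ := hB.exists_decomp hθ (z + w : H)
    have h3 : (M.a θ).quad (z + w) = (M.a θ).quad w' := by
      rw [← hvw, NonnegForm.quad_add, M.a_left_eq_zero hv]
      simp [NonnegForm.quad, M.a_left_eq_zero hv]
    have h4 := h₁ θ hθ hθ₁ (-v) (by rw [Vs, if_neg hne]; exact Submodule.neg_mem _ hv) z hz w hw
    have h5 : -v + z + w = w' := by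
      rw [add_assoc, ← hvw]; abel
    rw [h5] at h4
    have h6 : ‖z‖ ≤ C₁ * ‖w'‖ := by
      rw [Submodule.coe_norm]
      linarith [norm_nonneg (-v), norm_nonneg w]
    rw [h3]
    calc ‖θ‖ ^ 2 * ‖z‖ ^ 2 ≤ ‖θ‖ ^ 2 * (C₁ * ‖w'‖) ^ 2 := by gcongr
      _ = C₁ ^ 2 * (‖θ‖ ^ 2 * ‖w'‖ ^ 2) := by ring
      _ ≤ C₁ ^ 2 * (κ * (M.a θ).quad w') :=
        mul_le_mul_of_nonneg_left (hB.gap θ hθ w' hw') (by positivity)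
      _ = _ := by ring
  -- Since z lies in V_0, the value a_θ[z] is of second order in θ.
  have hz2 : (M.a θ).quad z ≤ (C₂ + κ) * (‖θ‖ ^ 2 * ‖z‖ ^ 2) := by
    have h3 := hB.second z z θ hθ
    have h4 := h₂ z z θ
    have h5 : ‖(M.a θ).form z z‖ ≤ ‖quadp (a'' z z) θ‖ + κ * ‖θ‖ ^ 3 * ‖z‖ * ‖z‖ := by
      have := norm_sub_norm_le ((M.a θ).form (z : H) z) (quadp (a'' z z) θ)
      linarith
    have h6 : ‖θ‖ ^ 3 ≤ ‖θ‖ ^ 2 := pow_le_pow_of_le_one (norm_nonneg _) hθ₂ (by norm_num)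
    have h7 : κ * ‖θ‖ ^ 3 * ‖z‖ * ‖z‖ ≤ κ * ‖θ‖ ^ 2 * ‖z‖ * ‖z‖ := by gcongr
    have h8 : (M.a θ).quad z ≤ ‖(M.a θ).form z z‖ := Complex.re_le_norm _
    nlinarith
  -- The gap at θ = 0 controls w through a_0; passing to a_θ costs κ²‖θ‖‖w‖² ≤ ‖w‖²/2, absorbed on
  -- the left.
  have hw1 : ‖w‖ ^ 2 ≤ 2 * (2 * κ * (M.a θ).quad (z + w) + 2 * κ * (M.a θ).quad z) := by
    have h3 := hB.gap_zero w hw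
    have h4 := (Complex.abs_re_le_norm _).trans (hB.a_lip θ hθ w w)
    rw [Complex.sub_re] at h4
    have h5 : (M.a 0).quad w ≤ (M.a θ).quad w + κ * ‖θ‖ * ‖w‖ * ‖w‖ := by
      have := (abs_le.mp h4).1
      simp only [NonnegForm.quad]
      linarith
    have h6 : (M.a θ).quad w ≤ 2 * (M.a θ).quad (z + w) + 2 * (M.a θ).quad z := by
      have := (M.a θ).quad_add_le (z + w : H) (-z)
      rw [NonnegForm.quad_neg] at this
      simpa using this
    have h7 : κ * (κ * ‖θ‖ * ‖w‖ * ‖w‖) ≤ ‖w‖ ^ 2 / 2 := by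
      calc κ * (κ * ‖θ‖ * ‖w‖ * ‖w‖) ≤ κ * (κ * (2 * κ ^ 2)⁻¹ * ‖w‖ * ‖w‖) := by gcongr
        _ = ‖w‖ ^ 2 / 2 := by field_simp
    have h8 : κ * (M.a 0).quad w ≤ κ * ((M.a θ).quad w + κ * ‖θ‖ * ‖w‖ * ‖w‖) := by gcongr
    have h9 : κ * (M.a θ).quad w ≤ κ * (2 * (M.a θ).quad (z + w) + 2 * (M.a θ).quad z) := by
      gcongr
    linarith
  have hz3 : 2 * κ * (M.a θ).quad z ≤
      2 * κ * ((C₂ + κ) * (κ * C₁ ^ 2 * (M.a θ).quad (z + w))) := by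
    gcongr
    exact hz2.trans (by gcongr)
  linarith

end Bounds

end Model

end

/-! ### The corrector and the homogenised form. -/

section

namespace Model

variable {n : ℕ} {H 𝓗 : Type*} [NormedAddCommGroup H] [InnerProductSpace ℂ H]
  [NormedAddCommGroup 𝓗] [InnerProductSpace ℂ 𝓗] {M : Model n H 𝓗}

variable {Vstar : Submodule ℂ H} {Z : Submodule ℂ (M.V 0)} {a' : M.FirstOrder}
  {a'' : M.SecondOrder} {T : Param n → Vstar →ₗ[ℂ] H} {E : Param n → 𝓗 ≃ₗ[ℂ] 𝓗} {κ : ℝ}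

theorem homForm_apply (ξ : Param n) (v v' : M.V 0) : M.homForm a' a'' ξ v v' =
    quadp (a'' v v') ξ - (M.a 0).form (M.corrector a' ξ v) (M.corrector a' ξ v') := rfl

namespace Bounds

variable (hB : M.Bounds Vstar Z a' a'' T E κ) [CompleteSpace H]
include hB

/-- Lax–Milgram for a_0 on W_0, coercive by the gap at θ = 0, solves the cell problem, so the
default value 0 in `corrector` never occurs. -/
theorem isCorrector_corrector (hint : (0 : Param n) ∈ interior M.Θ) (ξ : Param n) :
    M.IsCorrector a' ξ (M.corrector a' ξ) := by
  have h0 : 0 ∈ M.Θ := interior_subset hint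
  have hκ := hB.pos
  suffices h : ∃ N, M.IsCorrector a' ξ N by
    rw [corrector, dif_pos h]
    exact h.choose_spec
  obtain ⟨C, hC, hb⟩ := hB.first_bound hint
  have : CompleteSpace (M.W 0) := (hB.isClosed_W h0).completeSpace_coe
  let t : M.V 0 →ₗ[ℂ] M.W 0 →ₗ⋆[ℂ] ℂ :=
    LinearMap.mk₂'ₛₗ (RingHom.id ℂ) (starRingEnd ℂ) (fun v w => -dotp (a' v (w : H)) ξ)
      (by intro u v w; simp [dotp, add_mul, Finset.sum_add_distrib]; ring)
      (by intro c v w; simp [dotp, Finset.mul_sum, mul_assoc])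
      (by intro u v w; simp [dotp, add_mul, Finset.sum_add_distrib]; ring)
      (by intro c v w; simp [dotp, Finset.mul_sum, mul_assoc])
  obtain ⟨S, hS⟩ := lax_milgram ((M.a 0).form.domRestrict₁₂ (M.W 0) (M.W 0)) (c := κ⁻¹)
    (C := κ) (by positivity) (by positivity)
    (fun u => by
      rw [inv_mul_le_iff₀ hκ]
      exact hB.gap_zero u u.2)
    (fun u v => hB.a_le 0 h0 u v) t (D := C * ‖ξ‖) (by positivity)
    (fun u v => by
      change ‖-dotp (a' u (v : H)) ξ‖ ≤ _
      rw [norm_neg]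
      exact hb u v ξ)
  exact ⟨(M.W 0).subtype ∘ₗ (S : M.V 0 →ₗ[ℂ] M.W 0), fun v => ⟨(S v).2,
    fun w hw => hS v ⟨w, hw⟩⟩⟩

omit [CompleteSpace H] in
theorem eq_of_forall_a_zero {x y : H} (hx : x ∈ M.W 0) (hy : y ∈ M.W 0)
    (h : ∀ w ∈ M.W 0, (M.a 0).form x w = (M.a 0).form y w) : x = y := by
  have h1 := hB.gap_zero (x - y) (Submodule.sub_mem _ hx hy)
  have h2 : (M.a 0).quad (x - y) = 0 := by
    rw [NonnegForm.quad, LinearMap.map_sub₂, h _ (Submodule.sub_mem _ hx hy), sub_self,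
      Complex.zero_re]
  rw [h2, mul_zero] at h1
  have h3 : ‖x - y‖ = 0 := by nlinarith [norm_nonneg (x - y)]
  exact sub_eq_zero.mp (norm_eq_zero.mp h3)

theorem corrector_smul (hint : (0 : Param n) ∈ interior M.Θ) (t : ℝ) (ξ : Param n) (v : M.V 0) :
    M.corrector a' (t • ξ) v = (t : ℂ) • M.corrector a' ξ v := by
  obtain ⟨h1, h1'⟩ := hB.isCorrector_corrector hint (t • ξ) v
  obtain ⟨h2, h2'⟩ := hB.isCorrector_corrector hint ξ v
  refine hB.eq_of_forall_a_zero h1 (Submodule.smul_mem _ _ h2) fun w hw => ?_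
  rw [h1' w hw, map_smul, LinearMap.smul_apply, h2' w hw, dotp_smul]
  simp

/-- Used with `t = ε⁻¹`: the limit form at θ/ε is ε⁻² times the homogenised form at θ, matching the
scaling of ε⁻²a_θ. -/
theorem homForm_smul (hint : (0 : Param n) ∈ interior M.Θ) (t : ℝ) (ξ : Param n) (v v' : M.V 0) :
    M.homForm a' a'' (t • ξ) v v' = (t : ℂ) ^ 2 * M.homForm a' a'' ξ v v' := by
  rw [homForm_apply, homForm_apply, quadp_smul, hB.corrector_smul hint, hB.corrector_smul hint]
  simp only [map_smul, LinearMap.smul_apply, LinearMap.map_smulₛₗ, Complex.conj_ofReal, smul_eq_mul]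
  ring

theorem corrector_bound (hint : (0 : Param n) ∈ interior M.Θ) :
    ∃ C : ℝ, 0 < C ∧ ∀ (ξ : Param n) (v : M.V 0), ‖M.corrector a' ξ v‖ ≤ C * ‖ξ‖ * ‖v‖ := by
  obtain ⟨C, hC, hb⟩ := hB.first_bound hint
  have hκ := hB.pos
  refine ⟨κ * C, by positivity, fun ξ v => ?_⟩
  obtain ⟨h1, h2⟩ := hB.isCorrector_corrector hint ξ v
  have h3 := hB.gap_zero _ h1
  have h4 : (M.a 0).quad (M.corrector a' ξ v) ≤ C * ‖ξ‖ * ‖v‖ * ‖M.corrector a' ξ v‖ := by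
    rw [NonnegForm.quad, h2 _ h1]
    refine (Complex.re_le_norm _).trans ?_
    rw [norm_neg]
    exact hb _ _ _
  rcases eq_or_lt_of_le (norm_nonneg (M.corrector a' ξ v)) with h5 | h5
  · rw [← h5]; positivity
  · refine le_of_mul_le_mul_right ?_ h5
    calc _ = ‖M.corrector a' ξ v‖ ^ 2 := by ring
      _ ≤ κ * (M.a 0).quad (M.corrector a' ξ v) := h3
      _ ≤ κ * (C * ‖ξ‖ * ‖v‖ * ‖M.corrector a' ξ v‖) := by gcongr
      _ = _ := by ring

/-- The corrected function `v + N_θ v` is almost `a_θ`-orthogonal to `W_0`. -/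
theorem a_corrected_W (hint : (0 : Param n) ∈ interior M.Θ) :
    ∃ C : ℝ, 0 < C ∧ ∀ θ ∈ M.Θ, ∀ v : M.V 0, ∀ w ∈ M.W 0,
      ‖(M.a θ).form (v + M.corrector a' θ v) w‖ ≤ C * ‖θ‖ ^ 2 * ‖v‖ * ‖w‖ := by
  obtain ⟨C, hC, hb⟩ := hB.corrector_bound hint
  have hκ := hB.pos
  refine ⟨κ + κ * C, by positivity, fun θ hθ v w hw => ?_⟩
  obtain ⟨h1, h2⟩ := hB.isCorrector_corrector hint θ v
  have h3 := hB.first v w θ hθ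
  have h4 := hB.a_lip θ hθ (M.corrector a' θ v) w
  have h5 : (M.a θ).form (v + M.corrector a' θ v) w =
      ((M.a θ).form v w - dotp (a' v w) θ) +
      ((M.a θ).form (M.corrector a' θ v) w - (M.a 0).form (M.corrector a' θ v) w) := by
    rw [h2 w hw, map_add, LinearMap.add_apply]; ring
  rw [h5]
  refine (norm_add_le _ _).trans ?_
  have h6 : κ * ‖θ‖ * ‖M.corrector a' θ v‖ * ‖w‖ ≤ κ * ‖θ‖ * (C * ‖θ‖ * ‖v‖) * ‖w‖ := by
    gcongr; exact hb θ v
  linarith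

/-- Tested on `V_0`, the form `a_θ` of `v + N_θ v` is the homogenised form up to third order. -/
theorem a_corrected_V (hint : (0 : Param n) ∈ interior M.Θ) :
    ∃ C : ℝ, 0 < C ∧ ∀ θ ∈ M.Θ, ∀ v v' : M.V 0,
      ‖(M.a θ).form (v + M.corrector a' θ v) v' - M.homForm a' a'' θ v v'‖
        ≤ C * ‖θ‖ ^ 3 * ‖v‖ * ‖v'‖ := by
  obtain ⟨C, hC, hb⟩ := hB.corrector_bound hint
  have hκ := hB.pos
  refine ⟨κ + κ * C, by positivity, fun θ hθ v v' => ?_⟩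
  obtain ⟨h1, -⟩ := hB.isCorrector_corrector hint θ v
  obtain ⟨-, h2⟩ := hB.isCorrector_corrector hint θ v'
  have h3 := hB.second v v' θ hθ
  have h4 := hB.first v' (M.corrector a' θ v) θ hθ
  have h5 : (M.a θ).form (v + M.corrector a' θ v) v' - M.homForm a' a'' θ v v' =
      ((M.a θ).form v v' - quadp (a'' v v') θ) +
      conj ((M.a θ).form v' (M.corrector a' θ v) - dotp (a' v' (M.corrector a' θ v)) θ) := by
    -- The cell equation of v', tested with N_θ v, turns the correction in a^h into a first-order
    -- derivative term, which cancels that of a_θ(N_θ v, v').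
    have h6 : (M.a 0).form (M.corrector a' θ v) (M.corrector a' θ v') =
        -conj (dotp (a' v' (M.corrector a' θ v)) θ) := by
      rw [(M.a 0).conj_symm (M.corrector a' θ v') (M.corrector a' θ v), h2 _ h1, map_neg]
    rw [homForm_apply, h6, map_add, LinearMap.add_apply, map_sub,
      (M.a θ).conj_symm v' (M.corrector a' θ v)]
    ring
  rw [h5]
  refine (norm_add_le _ _).trans ?_
  rw [Complex.norm_conj]
  have h6 : κ * ‖θ‖ ^ 2 * ‖v'‖ * ‖M.corrector a' θ v‖ ≤
      κ * ‖θ‖ ^ 2 * ‖v'‖ * (C * ‖θ‖ * ‖v‖) := by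
    gcongr; exact hb θ v
  linarith

/-- Testing v + N_θ v with itself, the V_0 part gives a^h up to O(θ³), and the W_0 part is O(θ²)
times the O(θ) corrector. -/
theorem homForm_near (hint : (0 : Param n) ∈ interior M.Θ) :
    ∃ C : ℝ, 0 < C ∧ ∀ θ ∈ M.Θ, ∀ v : M.V 0,
      ‖(((M.a θ).quad (v + M.corrector a' θ v) : ℝ) : ℂ) - M.homForm a' a'' θ v v‖
        ≤ C * ‖θ‖ ^ 3 * ‖v‖ ^ 2 := by
  obtain ⟨C₁, hC₁, h₁⟩ := hB.a_corrected_W hint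
  obtain ⟨C₂, hC₂, h₂⟩ := hB.a_corrected_V hint
  obtain ⟨C₃, hC₃, h₃⟩ := hB.corrector_bound hint
  refine ⟨C₂ + C₁ * C₃, by positivity, fun θ hθ v => ?_⟩
  have h4 := h₁ θ hθ v _ (hB.isCorrector_corrector hint θ v).1
  have h5 := h₂ θ hθ v v
  rw [← NonnegForm.form_self]
  have h6 : (M.a θ).form (v + M.corrector a' θ v) (v + M.corrector a' θ v) -
      M.homForm a' a'' θ v v = ((M.a θ).form (v + M.corrector a' θ v) v -
      M.homForm a' a'' θ v v) + (M.a θ).form (v + M.corrector a' θ v) (M.corrector a' θ v) := by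
    rw [map_add ((M.a θ).form ((v : H) + M.corrector a' θ v)) (v : H)]; ring
  rw [h6]
  refine (norm_add_le _ _).trans ?_
  have h7 : C₁ * ‖θ‖ ^ 2 * ‖v‖ * ‖M.corrector a' θ v‖ ≤
      C₁ * ‖θ‖ ^ 2 * ‖v‖ * (C₃ * ‖θ‖ * ‖v‖) := by
    gcongr; exact h₃ θ v
  linarith

/-- The homogenised form is real on the diagonal and elliptic on `Z`. -/
theorem homForm_elliptic (hint : (0 : Param n) ∈ interior M.Θ) (hle : Vstar ≤ M.V 0) :
    ∃ c : ℝ, 0 < c ∧ ∀ (ξ : Param n), ∀ z ∈ Z,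
      c * ‖ξ‖ ^ 2 * ‖z‖ ^ 2 ≤ (M.homForm a' a'' ξ z z).re ∧ (M.homForm a' a'' ξ z z).im = 0 := by
  obtain ⟨r, C, hr, hC, hco⟩ := hB.coercive_near hint hle
  obtain ⟨C₁, hC₁, h₁⟩ := hB.homForm_near hint
  obtain ⟨ρ, hρ, hρΘ⟩ := exists_closedBall_subset hint
  refine ⟨C⁻¹, by positivity, fun ξ z hz => ?_⟩
  set x := M.homForm a' a'' ξ z z with hx
  -- Put θ = tξ. The real number a_θ[z + N_θ z] is coercive by `coercive_near` and equals t²a^h_ξ[z]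
  -- + O(t³); dividing by t² leaves errors of order t in both the real and the imaginary part.
  have key : ∀ᶠ t : ℝ in nhdsWithin 0 (Set.Ioi 0),
      C⁻¹ * ‖ξ‖ ^ 2 * ‖z‖ ^ 2 - x.re ≤ C₁ * ‖ξ‖ ^ 3 * ‖z‖ ^ 2 * t ∧
      |x.im| ≤ C₁ * ‖ξ‖ ^ 3 * ‖z‖ ^ 2 * t := by
    have hcont : Tendsto (fun t : ℝ => ‖t • ξ‖) (nhdsWithin 0 (Set.Ioi 0)) (nhds 0) := by
      have : Continuous fun t : ℝ => ‖t • ξ‖ := by fun_prop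
      have := this.tendsto 0
      rw [zero_smul, norm_zero] at this
      exact this.mono_left nhdsWithin_le_nhds
    filter_upwards [self_mem_nhdsWithin, hcont.eventually (ge_mem_nhds (lt_min hr hρ))]
      with t ht hsmall
    have ht : 0 < t := ht
    have hθ := hρΘ _ (hsmall.trans (min_le_right _ _))
    have h2 := hco _ hθ (hsmall.trans (min_le_left _ _)) z hz _
      (hB.isCorrector_corrector hint (t • ξ) z).1
    have h3 := h₁ _ hθ z
    rw [hB.homForm_smul hint, ← hx] at h3
    have hre := (Complex.abs_re_le_norm _).trans h3
    have him := (Complex.abs_im_le_norm _).trans h3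
    have hsq : (t : ℂ) ^ 2 = ((t ^ 2 : ℝ) : ℂ) := by push_cast; rfl
    rw [hsq, Complex.sub_re, Complex.ofReal_re, Complex.re_ofReal_mul, norm_smul,
      Real.norm_of_nonneg ht.le] at hre
    rw [hsq, Complex.sub_im, Complex.ofReal_im, Complex.im_ofReal_mul, zero_sub, abs_neg,
      abs_mul, abs_of_pos (by positivity : 0 < t ^ 2), norm_smul,
      Real.norm_of_nonneg ht.le] at him
    rw [norm_smul, Real.norm_of_nonneg ht.le] at h2
    have ht2 : 0 < t ^ 2 := by positivity
    constructor
    · refine le_of_mul_le_mul_left ?_ ht2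
      have h4 : C⁻¹ * ((t * ‖ξ‖) ^ 2 * ‖z‖ ^ 2) ≤
          (M.a (t • ξ)).quad (z + M.corrector a' (t • ξ) z) := by
        rw [inv_mul_le_iff₀ hC]
        linarith [sq_nonneg ‖M.corrector a' (t • ξ) z‖]
      have h5 := (abs_le.mp hre).2
      calc _ = C⁻¹ * ((t * ‖ξ‖) ^ 2 * ‖z‖ ^ 2) - t ^ 2 * x.re := by ring
        _ ≤ C₁ * (t * ‖ξ‖) ^ 3 * ‖z‖ ^ 2 := by linarith
        _ = _ := by ring
    · refine le_of_mul_le_mul_left ?_ ht2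
      calc _ ≤ C₁ * (t * ‖ξ‖) ^ 3 * ‖z‖ ^ 2 := him
        _ = _ := by ring
  have hlim : Tendsto (fun t : ℝ => C₁ * ‖ξ‖ ^ 3 * ‖z‖ ^ 2 * t) (nhdsWithin 0 (Set.Ioi 0))
      (nhds 0) := by
    have : Continuous fun t : ℝ => C₁ * ‖ξ‖ ^ 3 * ‖z‖ ^ 2 * t := by fun_prop
    have := this.tendsto 0
    rw [mul_zero] at this
    exact this.mono_left nhdsWithin_le_nhds
  constructor
  · have := ge_of_tendsto hlim (key.mono fun t h => h.1)
    linarith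
  · have := ge_of_tendsto hlim (key.mono fun t h => h.2)
    exact abs_eq_zero.mp (le_antisymm this (abs_nonneg _))

theorem homForm_bound (hint : (0 : Param n) ∈ interior M.Θ) :
    ∃ C : ℝ, 0 < C ∧ ∀ (ξ : Param n) (v v' : M.V 0),
      ‖M.homForm a' a'' ξ v v'‖ ≤ C * ‖ξ‖ ^ 2 * ‖v‖ * ‖v'‖ := by
  obtain ⟨C₁, hC₁, h₁⟩ := hB.second_bound hint
  obtain ⟨C₂, hC₂, h₂⟩ := hB.corrector_bound hint
  have hκ := hB.pos
  refine ⟨C₁ + κ * C₂ ^ 2, by positivity, fun ξ v v' => ?_⟩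
  rw [homForm_apply]
  refine (norm_sub_le _ _).trans ?_
  have h3 := h₁ v v' ξ
  have h4 : ‖(M.a 0).form (M.corrector a' ξ v) (M.corrector a' ξ v')‖ ≤
      κ * (C₂ * ‖ξ‖ * ‖v‖) * (C₂ * ‖ξ‖ * ‖v'‖) := by
    refine (hB.a_le 0 (interior_subset hint) _ _).trans ?_
    gcongr
    · exact h₂ ξ v
    · exact h₂ ξ v'
  linarith

end Bounds

end Model

end

/-! ### Energy forms and a priori bounds. -/

section

namespace NonnegForm

variable {X : Type*} [AddCommGroup X] [Module ℂ X]

/-- A function with a small residual is close to the solution in the energy norm. -/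
theorem quad_sub_le_of_residual (s : NonnegForm X) {u U : X} {ℓ : X → ℂ} {δ : ℝ} (hδ : 0 ≤ δ)
    (hu : ∀ w, s.form u w = ℓ w) (hU : ∀ w, ‖s.form U w - ℓ w‖ ≤ δ * √(s.quad w)) :
    s.quad (u - U) ≤ δ ^ 2 := by
  have h1 := hU (u - U)
  rw [← hu, ← LinearMap.map_sub₂, ← neg_sub u U, LinearMap.map_neg₂, norm_neg, form_self,
    Complex.norm_real, Real.norm_of_nonneg (s.quad_nonneg _)] at h1
  have h2 := Real.sq_sqrt (s.quad_nonneg (u - U))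
  have h3 := Real.sqrt_nonneg (s.quad (u - U))
  have h4 : √(s.quad (u - U)) ≤ δ := by
    rcases eq_or_lt_of_le h3 with h | h
    · rw [← h]; exact hδ
    · refine le_of_mul_le_mul_right ?_ h
      nlinarith
  rw [← h2]
  exact pow_le_pow_left₀ h3 h4 2

end NonnegForm

namespace Model

variable {n : ℕ} {H 𝓗 : Type*} [NormedAddCommGroup H] [InnerProductSpace ℂ H]
  [NormedAddCommGroup 𝓗] [InnerProductSpace ℂ 𝓗] {M : Model n H 𝓗}

variable {Vstar : Submodule ℂ H} {Z : Submodule ℂ (M.V 0)} {a' : M.FirstOrder}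
  {a'' : M.SecondOrder} {T : Param n → Vstar →ₗ[ℂ] H} {E : Param n → 𝓗 ≃ₗ[ℂ] 𝓗} {κ : ℝ}

/-- The exact relations satisfied by the transfer operators. -/
structure Transfer (M : Model n H 𝓗) (Vstar : Submodule ℂ H) (T : Param n → Vstar →ₗ[ℂ] H)
    (E : Param n → 𝓗 ≃ₗ[ℂ] 𝓗) : Prop where
  range_eq : ∀ θ ∈ M.Θ, LinearMap.range (T θ) = M.Vs Vstar θ
  b_eq : ∀ θ ∈ M.Θ, ∀ v v' : Vstar, (M.b θ).form (T θ v) (T θ v') = (M.b 0).form v v'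
  extends_eq : ∀ θ ∈ M.Θ, ∀ v : Vstar, E θ (M.ι v) = M.ι (T θ v)
  d_eq : ∀ θ ∈ M.Θ, ∀ u u' : 𝓗, (M.d θ).form (E θ u) (E θ u') = (M.d 0).form u u'

theorem Transfer.d_quad_eq (hT : M.Transfer Vstar T E) {θ : Param n} (hθ : θ ∈ M.Θ) (u : 𝓗) :
    (M.d θ).quad (E θ u) = (M.d 0).quad u := by
  rw [NonnegForm.quad, hT.d_eq θ hθ, NonnegForm.quad]

theorem Vs_le (hle : Vstar ≤ M.V 0) (θ : Param n) : M.Vs Vstar θ ≤ M.V θ := by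
  rw [Vs]
  split_ifs with h
  · rw [h]; exact hle
  · exact le_rfl

theorem Transfer.mem_V (hT : M.Transfer Vstar T E) (hle : Vstar ≤ M.V 0) {θ : Param n}
    (hθ : θ ∈ M.Θ) (v : Vstar) : T θ v ∈ M.V θ :=
  Vs_le hle θ (by rw [← hT.range_eq θ hθ]; exact LinearMap.mem_range_self _ v)

/-- `ε⁻² a_θ + b_θ` as a non-negative form. -/
def energy (M : Model n H 𝓗) (ε : ℝ) (θ : Param n) : NonnegForm H where
  form := M.formA ε θ
  nonneg u := by
    have h1 := (M.a θ).form_self u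
    have h2 := (M.b θ).form_self u
    have h3 : M.formA ε θ u u = (((ε ^ 2)⁻¹ * (M.a θ).quad u + (M.b θ).quad u : ℝ) : ℂ) := by
      simp only [formA, LinearMap.add_apply, LinearMap.smul_apply, smul_eq_mul, h1, h2]
      push_cast; rfl
    have h4 := (M.a θ).quad_nonneg u
    have h5 := (M.b θ).quad_nonneg u
    rw [h3, Complex.ofReal_re, Complex.ofReal_im]
    exact ⟨by positivity, rfl⟩

theorem energy_form (ε : ℝ) (θ : Param n) (u w : H) : (M.energy ε θ).form u w =
    ((ε : ℂ) ^ 2)⁻¹ * (M.a θ).form u w + (M.b θ).form u w := rfl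

theorem energy_quad (ε : ℝ) (θ : Param n) (u : H) : (M.energy ε θ).quad u =
    (ε ^ 2)⁻¹ * (M.a θ).quad u + (M.b θ).quad u := by
  rw [NonnegForm.quad, energy_form, Complex.add_re, (M.a θ).form_self, ← Complex.ofReal_pow,
    ← Complex.ofReal_inv, Complex.re_ofReal_mul, Complex.ofReal_re]
  rfl

theorem b_quad_le_energy (ε : ℝ) (θ : Param n) (u : H) :
    (M.b θ).quad u ≤ (M.energy ε θ).quad u := by
  rw [energy_quad]
  have := (M.a θ).quad_nonneg u
  have : 0 ≤ (ε ^ 2)⁻¹ * (M.a θ).quad u := by positivity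
  linarith

theorem a_quad_le_energy {ε : ℝ} (hε : 0 < ε) (θ : Param n) (u : H) :
    (M.a θ).quad u ≤ ε ^ 2 * (M.energy ε θ).quad u := by
  rw [energy_quad, mul_add, mul_inv_cancel_left₀ (by positivity)]
  have := (M.b θ).quad_nonneg u
  have : 0 ≤ ε ^ 2 * (M.b θ).quad u := by positivity
  linarith

theorem formS_apply (ξ : Param n) (p p' : Vstar × Z) : M.formS Vstar Z a' a'' ξ p p' =
    M.homForm a' a'' ξ p.2 p'.2 + (M.b 0).form (M.sumMap Vstar Z p) (M.sumMap Vstar Z p') := rfl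

theorem sumMap_apply (p : Vstar × Z) : M.sumMap Vstar Z p = (p.1 : H) + ((p.2 : M.V 0) : H) := rfl

namespace Bounds

variable (hB : M.Bounds Vstar Z a' a'' T E κ)
include hB

theorem norm_sq_le_energy {ε : ℝ} (hε : 0 < ε) (hε1 : ε < 1) {θ : Param n} (hθ : θ ∈ M.Θ) (u : H) :
    ‖u‖ ^ 2 ≤ κ * (M.energy ε θ).quad u := by
  refine (hB.norm_sq_le θ hθ u).trans ?_
  have hκ := hB.pos
  rw [energy_quad]
  gcongr
  refine le_mul_of_one_le_left ((M.a θ).quad_nonneg u) ?_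
  exact (one_le_inv₀ (by positivity)).mpr (pow_le_one₀ hε.le hε1.le)

theorem norm_sq_le_b_zero (h0 : 0 ∈ M.Θ) {v : H} (hv : v ∈ M.V 0) :
    ‖v‖ ^ 2 ≤ κ * (M.b 0).quad v := by
  have h := hB.norm_sq_le 0 h0 v
  rwa [NonnegForm.quad, M.a_left_eq_zero hv, Complex.zero_re, zero_add] at h

theorem b_quad_le_sq {θ : Param n} (hθ : θ ∈ M.Θ) (u : H) :
    (M.b θ).quad u ≤ (κ * ‖u‖) ^ 2 := by
  refine (hB.b_quad_le hθ u).trans ?_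
  have := hB.one_le
  rw [mul_pow]
  gcongr
  nlinarith

theorem d_quad_le_sq (hamb : M.AmbientAssumptions) {θ : Param n} (hθ : θ ∈ M.Θ) (u : H) :
    (M.d θ).quad (M.ι u) ≤ (κ * ‖u‖) ^ 2 :=
  (hamb.le_b u θ hθ).trans (hB.b_quad_le_sq hθ u)

theorem norm_d_le (hamb : M.AmbientAssumptions) {θ : Param n} (hθ : θ ∈ M.Θ) {g : 𝓗} {F : ℝ}
    (hF : 0 ≤ F) (hg : (M.d θ).quad g ≤ F ^ 2) (u : H) :
    ‖(M.d θ).form g (M.ι u)‖ ≤ κ * F * ‖u‖ := by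
  have hκ := hB.pos
  have := (M.d θ).norm_form_le_of_quad_le hF (by positivity : 0 ≤ κ * ‖u‖) hg
    (hB.d_quad_le_sq hamb hθ u)
  linarith

/-- On V_θ the norm is equivalent to that of b_θ, and `T θ` carries b_0 to b_θ isometrically. -/
theorem norm_T_le (hT : M.Transfer Vstar T E) (hle : Vstar ≤ M.V 0) {θ : Param n} (h0 : 0 ∈ M.Θ)
    (hθ : θ ∈ M.Θ) (v : Vstar) : ‖T θ v‖ ≤ κ * ‖v‖ := by
  have hκ := hB.pos
  have h1 := hB.norm_sq_le θ hθ (T θ v)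
  rw [NonnegForm.quad, M.a_left_eq_zero (hT.mem_V hle hθ v), Complex.zero_re, zero_add,
    NonnegForm.quad, hT.b_eq θ hθ] at h1
  have h2 := hB.b_quad_le h0 (v : H)
  refine le_of_sq_le_sq ?_ (by positivity)
  calc _ ≤ κ * (M.b 0).quad (v : H) := h1
    _ ≤ κ * (κ * ‖(v : H)‖ ^ 2) := by gcongr
    _ = _ := by rw [Submodule.coe_norm]; ring

theorem norm_le_T (hT : M.Transfer Vstar T E) (hle : Vstar ≤ M.V 0) {θ : Param n} (h0 : 0 ∈ M.Θ)
    (hθ : θ ∈ M.Θ) (v : Vstar) : ‖v‖ ≤ κ * ‖T θ v‖ := by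
  have hκ := hB.pos
  have h1 := hB.norm_sq_le_b_zero h0 (hle v.2)
  have h2 := hB.b_quad_le hθ (T θ v)
  rw [NonnegForm.quad, hT.b_eq θ hθ] at h2
  refine le_of_sq_le_sq ?_ (by positivity)
  calc _ ≤ κ * (M.b 0).quad (v : H) := h1
    _ ≤ κ * (κ * ‖T θ v‖ ^ 2) := by gcongr; exact h2
    _ = _ := by ring

/-- A priori bounds for the limit problem. -/
theorem limit_bounds [CompleteSpace H] (hamb : M.AmbientAssumptions)
    (hint : (0 : Param n) ∈ interior M.Θ) (hle : Vstar ≤ M.V 0) :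
    ∃ C : ℝ, 0 < C ∧ ∀ (ξ : Param n) (f : 𝓗) (F : ℝ) (p : Vstar × Z), 0 ≤ F →
      (M.d 0).quad f ≤ F ^ 2 →
      (∀ p', M.formS Vstar Z a' a'' ξ p p' = (M.d 0).form f (M.ι (M.sumMap Vstar Z p'))) →
      ‖p.1‖ ≤ C * F ∧ ‖p.2‖ ≤ C * F ∧ ‖ξ‖ ^ 2 * ‖p.2‖ ≤ C * F ∧ ‖ξ‖ * ‖p.2‖ ≤ C * F := by
  obtain ⟨c, hc, hell⟩ := hB.homForm_elliptic hint hle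
  have h0 : 0 ∈ M.Θ := interior_subset hint
  have hκ := hB.pos
  have hC : 0 < κ + 2 * κ / c := by positivity
  refine ⟨κ + 2 * κ / c, hC, ?_⟩
  rintro ξ f F ⟨v, z⟩ hF hf hp
  set q := √((M.b 0).quad (v + (z : M.V 0) : H)) with hq
  have hqsq : q ^ 2 = (M.b 0).quad (v + (z : M.V 0) : H) := Real.sq_sqrt ((M.b 0).quad_nonneg _)
  have hq0 : 0 ≤ q := Real.sqrt_nonneg _
  have hz := hell ξ z z.2
  -- Test with the solution itself, drop the non-negative homogenised form, and use d_0 ≤ b_0.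
  have hqF : q ≤ F := by
    have h1 := congrArg Complex.re (hp (v, z))
    rw [formS_apply, Complex.add_re] at h1
    have h2 := (Complex.re_le_norm _).trans ((M.d 0).norm_form_le_of_quad_le hF hq0 hf
      ((hamb.le_b _ 0 h0).trans hqsq.ge))
    change _ + (M.b 0).quad (v + (z : M.V 0) : H) = _ at h1
    rw [← hqsq] at h1
    have h3 : 0 ≤ (M.homForm a' a'' ξ z z).re := le_trans (by positivity) hz.1
    have h4 : q ^ 2 ≤ F * q := by
      change _ = ((M.d 0).form f (M.ι (v + (z : M.V 0) : H))).re at h1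
      change _ + q ^ 2 = _ at h1
      have h1' : (M.homForm a' a'' ξ z z).re + q ^ 2 =
        ((M.d 0).form f (M.ι (v + (z : M.V 0) : H))).re := h1
      linarith
    rcases eq_or_lt_of_le hq0 with h | h
    · rw [← h]; exact hF
    · exact le_of_mul_le_mul_right (by linarith [sq q]) h
  have h1 := hB.norm_sq_le_b_zero h0 (Submodule.add_mem _ (hle v.2) (z : M.V 0).2)
  have h2 := hB.transversal v v.2 z z.2
  have h3 : ‖v‖ ^ 2 + ‖z‖ ^ 2 ≤ (κ * F) ^ 2 := by
    calc _ ≤ κ * ‖(v : H) + (z : M.V 0)‖ ^ 2 := h2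
      _ ≤ κ * (κ * (M.b 0).quad (v + (z : M.V 0) : H)) := by gcongr
      _ = κ * (κ * q ^ 2) := by rw [hqsq]
      _ ≤ κ * (κ * F ^ 2) := by gcongr
      _ = _ := by ring
  have hv : ‖v‖ ≤ κ * F := le_of_sq_le_sq (by linarith [sq_nonneg ‖z‖]) (by positivity)
  have hz' : ‖z‖ ≤ κ * F := le_of_sq_le_sq (by linarith [sq_nonneg ‖v‖]) (by positivity)
  have hle1 : κ * F ≤ (κ + 2 * κ / c) * F := by
    gcongr
    linarith [show 0 < 2 * κ / c by positivity]
  -- Test with (0, z): ellipticity gives c|ξ|²‖z‖² ≤ 2κF‖z‖.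
  have hξ2 : ‖ξ‖ ^ 2 * ‖z‖ ≤ (κ + 2 * κ / c) * F := by
    have h4 := congrArg Complex.re (hp (0, z))
    have hs : M.sumMap Vstar Z (0, z) = ((z : M.V 0) : H) := by simp [sumMap_apply]
    rw [formS_apply, Complex.add_re, hs] at h4
    have h5 := (Complex.re_le_norm _).trans (hB.norm_d_le hamb h0 hF hf ((z : M.V 0) : H))
    have h6 := (Complex.abs_re_le_norm _).trans ((M.b 0).norm_form_le_of_quad_le hF
      (by positivity : 0 ≤ κ * ‖((z : M.V 0) : H)‖)
      (u := M.sumMap Vstar Z (v, z)) (by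
        rw [sumMap_apply]; exact hqsq.ge.trans (pow_le_pow_left₀ hq0 hqF 2))
      (hB.b_quad_le_sq h0 _))
    have h7 := (abs_le.mp h6).1
    have h8 : c * ‖ξ‖ ^ 2 * ‖z‖ ^ 2 ≤ 2 * κ * F * ‖z‖ := by
      have e : ‖((z : M.V 0) : H)‖ = ‖z‖ := rfl
      rw [e] at h5 h7
      have hz1 : c * ‖ξ‖ ^ 2 * ‖z‖ ^ 2 ≤ (M.homForm a' a'' ξ z z).re := hz.1
      linarith
    rcases eq_or_lt_of_le (norm_nonneg z) with h | h
    · rw [← h, mul_zero]; positivity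
    · have h9 : ‖ξ‖ ^ 2 * ‖z‖ ≤ 2 * κ / c * F := by
        rw [div_mul_eq_mul_div, le_div_iff₀ hc]
        refine le_of_mul_le_mul_right ?_ h
        linarith [h8]
      refine h9.trans ?_
      gcongr
      linarith
  refine ⟨hv.trans hle1, hz'.trans hle1, hξ2, ?_⟩
  -- The intermediate bound is the geometric mean of those for ‖z‖ and |ξ|²‖z‖.
  refine le_of_sq_le_sq ?_ (by positivity)
  calc _ = (‖ξ‖ ^ 2 * ‖z‖) * ‖z‖ := by ring
    _ ≤ ((κ + 2 * κ / c) * F) * ((κ + 2 * κ / c) * F) := by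
      gcongr
      exact hz'.trans hle1
    _ = _ := by ring

/-- Bounds for the components of a test function in terms of its energy. -/
theorem test_bounds [CompleteSpace H] (hT : M.Transfer Vstar T E)
    (hint : (0 : Param n) ∈ interior M.Θ) (hle : Vstar ≤ M.V 0) :
    ∃ r C : ℝ, 0 < r ∧ 0 < C ∧ ∀ θ ∈ M.Θ, ‖θ‖ ≤ r → ∀ ε : ℝ, 0 < ε → ε < 1 →
      ∀ (v : Vstar) (z : Z), ∀ w ∈ M.W 0, ∀ D : ℝ, 0 ≤ D →
      (M.energy ε θ).quad (T θ v + (z : M.V 0) + w) ≤ D ^ 2 →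
      ‖v‖ ≤ C * D ∧ ‖θ‖ * ‖z‖ ≤ C * ε * D ∧ ‖w‖ ≤ C * ε * D := by
  have h0 : 0 ∈ M.Θ := interior_subset hint
  have hκ := hB.pos
  have hκ1 := hB.one_le
  obtain ⟨r₁, C₁, hr₁, hC₁, h₁⟩ := hB.triple_bound_near h0 hle
  obtain ⟨r₂, C₂, hr₂, hC₂, h₂⟩ := hB.coercive_near hint hle
  refine ⟨min r₁ r₂, κ * C₁ * κ + √C₂, by positivity, by positivity,
    fun θ hθ hθr ε hε hε1 v z w hw D hD hE => ?_⟩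
  have hmem : T θ v ∈ M.Vs Vstar θ := by
    rw [← hT.range_eq θ hθ]; exact LinearMap.mem_range_self _ v
  have h3 := h₁ θ hθ (hθr.trans (min_le_left _ _)) _ hmem z z.2 w hw
  have h4 : ‖T θ v + (z : M.V 0) + w‖ ≤ κ * D := by
    refine le_of_sq_le_sq ?_ (by positivity)
    calc _ ≤ κ * (M.energy ε θ).quad _ := hB.norm_sq_le_energy hε hε1 hθ _
      _ ≤ κ * D ^ 2 := by gcongr
      _ ≤ κ * κ * D ^ 2 := by gcongr; exact le_mul_of_one_le_left hκ.le hκ1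
      _ = _ := by ring
  -- Since `T θ v` lies in V_θ, the form a_θ only sees z + w, and the weight ε⁻² in the energy makes
  -- it O(ε²D²).
  have h5 : (M.a θ).quad ((z : M.V 0) + w : H) ≤ ε ^ 2 * D ^ 2 := by
    have h6 : (M.a θ).quad (T θ v + (z : M.V 0) + w) = (M.a θ).quad ((z : M.V 0) + w : H) := by
      rw [add_assoc, NonnegForm.quad_add, M.a_left_eq_zero (hT.mem_V hle hθ v), NonnegForm.quad,
        M.a_left_eq_zero (hT.mem_V hle hθ v)]
      simp
    rw [← h6]
    exact (M.a_quad_le_energy hε θ _).trans (by gcongr)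
  have h6 := h₂ θ hθ (hθr.trans (min_le_right _ _)) z z.2 w hw
  have h7 : ‖θ‖ ^ 2 * ‖z‖ ^ 2 + ‖w‖ ^ 2 ≤ (√C₂ * ε * D) ^ 2 := by
    calc _ ≤ C₂ * (M.a θ).quad ((z : M.V 0) + w : H) := h6
      _ ≤ C₂ * (ε ^ 2 * D ^ 2) := by gcongr
      _ = _ := by rw [mul_pow, mul_pow, Real.sq_sqrt hC₂.le]; ring
  have h8 : √C₂ * ε * D ≤ (κ * C₁ * κ + √C₂) * ε * D := by
    gcongr
    linarith [show 0 < κ * C₁ * κ by positivity]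
  refine ⟨?_, ?_, ?_⟩
  · calc ‖v‖ ≤ κ * ‖T θ v‖ := hB.norm_le_T hT hle h0 hθ v
      _ ≤ κ * (C₁ * (κ * D)) := by
        gcongr
        refine le_trans ?_ (h3.trans (by gcongr))
        linarith [norm_nonneg w, norm_nonneg ((z : M.V 0) : H)]
      _ = κ * C₁ * κ * D := by ring
      _ ≤ _ := by gcongr; linarith [Real.sqrt_nonneg C₂]
  · refine le_trans (le_of_sq_le_sq ?_ (by positivity)) h8
    rw [mul_pow]
    linarith [sq_nonneg ‖w‖]
  · refine le_trans (le_of_sq_le_sq ?_ (by positivity)) h8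
    have : 0 ≤ ‖θ‖ ^ 2 * ‖z‖ ^ 2 := by positivity
    linarith

end Bounds

end Model

end

/-! ### Residuals of the ansatz on the three subspaces. -/

section

namespace Model

variable {n : ℕ} {H 𝓗 : Type*} [NormedAddCommGroup H] [InnerProductSpace ℂ H]
  [NormedAddCommGroup 𝓗] [InnerProductSpace ℂ 𝓗] {M : Model n H 𝓗}

variable {Vstar : Submodule ℂ H} {Z : Submodule ℂ (M.V 0)} {a' : M.FirstOrder}
  {a'' : M.SecondOrder} {T : Param n → Vstar →ₗ[ℂ] H} {E : Param n → 𝓗 ≃ₗ[ℂ] 𝓗} {κ : ℝ}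

namespace Bounds

variable (hB : M.Bounds Vstar Z a' a'' T E κ) [CompleteSpace H]
include hB

/-- The cell problem leaves ε⁻²O(θ²)‖z‖‖w‖, bounded by hypothesis. The b- and d-terms need no
cancellation, because ‖w‖ is itself O(ε) in terms of the energy. -/
theorem residual_W (hT : M.Transfer Vstar T E) (hamb : M.AmbientAssumptions)
    (hint : (0 : Param n) ∈ interior M.Θ) (hle : Vstar ≤ M.V 0) :
    ∃ C : ℝ, 0 < C ∧ ∀ θ ∈ M.Θ, ‖θ‖ ≤ 1 → ∀ ε : ℝ, 0 < ε → ∀ (f : 𝓗) (F G : ℝ), 0 ≤ F → 0 ≤ G →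
      (M.d 0).quad f ≤ F ^ 2 → ∀ (v : Vstar) (z : Z), ‖v‖ ≤ G → ‖z‖ ≤ G →
      (ε ^ 2)⁻¹ * ‖θ‖ ^ 2 * ‖z‖ ≤ G → ∀ w ∈ M.W 0,
      ‖(M.energy ε θ).form (T θ v + (z : M.V 0) + M.corrector a' θ z) w
        - (M.d θ).form (E θ f) (M.ι w)‖ ≤ C * (F + G) * ‖w‖ := by
  have h0 : 0 ∈ M.Θ := interior_subset hint
  have hκ := hB.pos
  obtain ⟨C₁, hC₁, h₁⟩ := hB.a_corrected_W hint
  obtain ⟨C₂, hC₂, h₂⟩ := hB.corrector_bound hint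
  refine ⟨C₁ + κ * (κ + 1 + C₂) + κ, by positivity,
    fun θ hθ hθ1 ε hε f F G hF hG hf v z hv hz hzε w hw => ?_⟩
  have hd := hB.norm_d_le hamb hθ hF ((hT.d_quad_eq hθ f).le.trans hf) w
  have ha : ‖((ε : ℂ) ^ 2)⁻¹ * (M.a θ).form (T θ v + (z : M.V 0) + M.corrector a' θ z) w‖ ≤
      C₁ * G * ‖w‖ := by
    have e : (M.a θ).form (T θ v + (z : M.V 0) + M.corrector a' θ z) w =
        (M.a θ).form ((z : M.V 0) + M.corrector a' θ z) w := by
      rw [add_assoc, LinearMap.map_add₂, M.a_left_eq_zero (hT.mem_V hle hθ v), zero_add]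
    rw [e, norm_mul, norm_inv, norm_pow, Complex.norm_real, Real.norm_of_nonneg hε.le]
    calc _ ≤ (ε ^ 2)⁻¹ * (C₁ * ‖θ‖ ^ 2 * ‖(z : M.V 0)‖ * ‖w‖) := by
          gcongr; exact h₁ θ hθ z w hw
      _ = C₁ * ((ε ^ 2)⁻¹ * ‖θ‖ ^ 2 * ‖z‖) * ‖w‖ := by
          rw [show ‖(z : M.V 0)‖ = ‖z‖ from rfl]; ring
      _ ≤ _ := by gcongr
  have hU : ‖T θ v + (z : M.V 0) + M.corrector a' θ z‖ ≤ (κ + 1 + C₂) * G := by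
    have k1 := hB.norm_T_le hT hle h0 hθ v
    have k2 := h₂ θ z
    have k3 : κ * ‖v‖ ≤ κ * G := by gcongr
    have k4 : C₂ * ‖θ‖ * ‖(z : M.V 0)‖ ≤ C₂ * 1 * G := by gcongr; exact hz
    have k5 : ‖((z : M.V 0) : H)‖ ≤ G := hz
    have k6 := norm_add₃_le (a := T θ v) (b := ((z : M.V 0) : H)) (c := M.corrector a' θ z)
    linarith
  have hb := hB.b_le θ hθ (T θ v + (z : M.V 0) + M.corrector a' θ z) w
  have hb' : κ * ‖T θ v + (z : M.V 0) + M.corrector a' θ z‖ * ‖w‖ ≤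
      κ * ((κ + 1 + C₂) * G) * ‖w‖ := by gcongr
  rw [energy_form]
  refine (norm_sub_le _ _).trans ?_
  have k := norm_add_le (((ε : ℂ) ^ 2)⁻¹ *
    (M.a θ).form (T θ v + (z : M.V 0) + M.corrector a' θ z) w)
    ((M.b θ).form (T θ v + (z : M.V 0) + M.corrector a' θ z) w)
  have k2 : 0 ≤ C₁ * F * ‖w‖ := by positivity
  have k3 : 0 ≤ κ * (κ + 1 + C₂) * F * ‖w‖ := by positivity
  have k4 : 0 ≤ κ * G * ‖w‖ := by positivity
  linarith

/-- The limit equation cancels the leading terms. Everything left carries a factor ‖θ‖‖z'‖, which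
the energy controls with a gain of ε. -/
theorem residual_Z (hT : M.Transfer Vstar T E) (hamb : M.AmbientAssumptions)
    (hint : (0 : Param n) ∈ interior M.Θ) (hle : Vstar ≤ M.V 0) :
    ∃ C : ℝ, 0 < C ∧ ∀ θ ∈ M.Θ, ∀ ε : ℝ, 0 < ε → ∀ (f : 𝓗) (F G : ℝ), 0 ≤ F → 0 ≤ G →
      (M.d 0).quad f ≤ F ^ 2 → ∀ (v : Vstar) (z : Z), ‖v‖ ≤ G → ‖z‖ ≤ G →
      (ε ^ 2)⁻¹ * ‖θ‖ ^ 2 * ‖z‖ ≤ G → ∀ z' : Z,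
      M.formS Vstar Z a' a'' (ε⁻¹ • θ) (v, z) (0, z') =
        (M.d 0).form f (M.ι (M.sumMap Vstar Z (0, z'))) →
      ‖(M.energy ε θ).form (T θ v + (z : M.V 0) + M.corrector a' θ z) (z' : M.V 0)
        - (M.d θ).form (E θ f) (M.ι (z' : M.V 0))‖ ≤ C * (F + G) * (‖θ‖ * ‖z'‖) := by
  have h0 : 0 ∈ M.Θ := interior_subset hint
  have hκ := hB.pos
  obtain ⟨C₁, hC₁, h₁⟩ := hB.a_corrected_V hint
  obtain ⟨C₂, hC₂, h₂⟩ := hB.corrector_bound hint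
  refine ⟨C₁ + 2 * κ + κ * C₂ + κ ^ 2, by positivity,
    fun θ hθ ε hε f F G hF hG hf v z hv hz hzε z' hp => ?_⟩
  have hs : M.sumMap Vstar Z (0, z') = ((z' : M.V 0) : H) := by simp [sumMap_apply]
  rw [formS_apply, hs, sumMap_apply, hB.homForm_smul hint, LinearMap.map_add₂] at hp
  simp only at hp
  set N := M.corrector a' θ z with hN
  set A := (M.a θ).form ((z : M.V 0) + N) (z' : M.V 0) with hA
  set h := M.homForm a' a'' θ z z' with hh
  -- Five errors remain: the third-order remainder of a_θ, the transfer defect of b, the variation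
  -- of b, the corrector inside b, and `E θ` minus the identity on z'.
  have e : (M.energy ε θ).form (T θ v + (z : M.V 0) + N) (z' : M.V 0)
        - (M.d θ).form (E θ f) (M.ι (z' : M.V 0)) =
      ((ε : ℂ) ^ 2)⁻¹ * (A - h)
      + ((M.b θ).form (T θ v) (z' : M.V 0) - (M.b 0).form v (z' : M.V 0))
      + ((M.b θ).form (z : M.V 0) (z' : M.V 0) - (M.b 0).form (z : M.V 0) (z' : M.V 0))
      + (M.b θ).form N (z' : M.V 0)
      + (M.d θ).form (E θ f) (E θ (M.ι (z' : M.V 0)) - M.ι (z' : M.V 0)) := by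
    rw [hA, map_sub ((M.d θ).form (E θ f)), hT.d_eq θ hθ, ← hp, energy_form]
    simp only [LinearMap.map_add₂, M.a_left_eq_zero (hT.mem_V hle hθ v)]
    push_cast
    rw [inv_pow]
    ring
  rw [e]
  have t1 : ‖((ε : ℂ) ^ 2)⁻¹ * (A - h)‖ ≤ C₁ * G * (‖θ‖ * ‖z'‖) := by
    rw [norm_mul, norm_inv, norm_pow, Complex.norm_real, Real.norm_of_nonneg hε.le]
    calc _ ≤ (ε ^ 2)⁻¹ * (C₁ * ‖θ‖ ^ 3 * ‖(z : M.V 0)‖ * ‖(z' : M.V 0)‖) := by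
          gcongr; exact h₁ θ hθ z z'
      _ = C₁ * ((ε ^ 2)⁻¹ * ‖θ‖ ^ 2 * ‖z‖) * (‖θ‖ * ‖z'‖) := by
          rw [show ‖(z : M.V 0)‖ = ‖z‖ from rfl, show ‖(z' : M.V 0)‖ = ‖z'‖ from rfl]; ring
      _ ≤ _ := by gcongr
  have t2 : ‖(M.b θ).form (T θ v) (z' : M.V 0) - (M.b 0).form v (z' : M.V 0)‖ ≤
      κ * G * (‖θ‖ * ‖z'‖) := by
    calc _ ≤ κ * ‖θ‖ * ‖v‖ * ‖(z' : M.V 0)‖ := hB.transfer θ hθ v z' z'.2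
      _ ≤ κ * ‖θ‖ * G * ‖z'‖ := by gcongr; rfl
      _ = _ := by ring
  have t3 : ‖(M.b θ).form (z : M.V 0) (z' : M.V 0) - (M.b 0).form (z : M.V 0) (z' : M.V 0)‖ ≤
      κ * G * (‖θ‖ * ‖z'‖) := by
    calc _ ≤ κ * ‖θ‖ * ‖(z : M.V 0)‖ * ‖(z' : M.V 0)‖ := hB.b_lip z z' θ hθ
      _ ≤ κ * ‖θ‖ * G * ‖z'‖ := by
        gcongr
        · exact hz
        · rfl
      _ = _ := by ring
  have t4 : ‖(M.b θ).form N (z' : M.V 0)‖ ≤ κ * C₂ * G * (‖θ‖ * ‖z'‖) := by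
    calc _ ≤ κ * ‖N‖ * ‖((z' : M.V 0) : H)‖ := hB.b_le θ hθ _ _
      _ ≤ κ * (C₂ * ‖θ‖ * G) * ‖z'‖ := by
        gcongr
        · exact (h₂ θ z).trans (by gcongr; exact hz)
        · rfl
      _ = _ := by ring
  have t5 : ‖(M.d θ).form (E θ f) (E θ (M.ι (z' : M.V 0)) - M.ι (z' : M.V 0))‖ ≤
      κ ^ 2 * F * (‖θ‖ * ‖z'‖) := by
    have k := (M.d θ).norm_form_le_of_quad_le (u := E θ f)
      (v := E θ (M.ι (z' : M.V 0)) - M.ι (z' : M.V 0)) hF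
      (by positivity : 0 ≤ κ * ‖θ‖ * (κ * ‖z'‖)) ((hT.d_quad_eq hθ f).le.trans hf) (by
        refine (hB.E_lip θ hθ _).trans ?_
        rw [mul_pow _ (κ * ‖z'‖)]
        gcongr
        exact hB.d_quad_le_sq hamb h0 _)
    linarith
  have k1 := norm_add_le (((ε : ℂ) ^ 2)⁻¹ * (A - h)
      + ((M.b θ).form (T θ v) (z' : M.V 0) - (M.b 0).form v (z' : M.V 0))
      + ((M.b θ).form (z : M.V 0) (z' : M.V 0) - (M.b 0).form (z : M.V 0) (z' : M.V 0))
      + (M.b θ).form N (z' : M.V 0))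
      ((M.d θ).form (E θ f) (E θ (M.ι (z' : M.V 0)) - M.ι (z' : M.V 0)))
  have k2 := norm_add₄_le (a := ((ε : ℂ) ^ 2)⁻¹ * (A - h))
    (b := (M.b θ).form (T θ v) (z' : M.V 0) - (M.b 0).form v (z' : M.V 0))
    (c := (M.b θ).form (z : M.V 0) (z' : M.V 0) - (M.b 0).form (z : M.V 0) (z' : M.V 0))
    (d := (M.b θ).form N (z' : M.V 0))
  have p1 : 0 ≤ (C₁ + 2 * κ + κ * C₂) * F * (‖θ‖ * ‖z'‖) := by positivity
  have p2 : 0 ≤ κ ^ 2 * G * (‖θ‖ * ‖z'‖) := by positivity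
  linarith

/-- Here a_θ vanishes, and the isometries for b and d reproduce the limit equation exactly. Only the
coupling of `T θ v'` with z and the corrector survives, giving the small factor ‖θ‖‖z‖. -/
theorem residual_V (hT : M.Transfer Vstar T E)
    (hint : (0 : Param n) ∈ interior M.Θ) (hle : Vstar ≤ M.V 0) :
    ∃ C : ℝ, 0 < C ∧ ∀ θ ∈ M.Θ, ∀ (ε : ℝ) (ξ : Param n) (f : 𝓗) (v : Vstar) (z : Z) (v' : Vstar),
      M.formS Vstar Z a' a'' ξ (v, z) (v', 0) =
        (M.d 0).form f (M.ι (M.sumMap Vstar Z (v', 0))) →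
      ‖(M.energy ε θ).form (T θ v + (z : M.V 0) + M.corrector a' θ z) (T θ v')
        - (M.d θ).form (E θ f) (M.ι (T θ v'))‖ ≤ C * (‖θ‖ * ‖z‖) * ‖v'‖ := by
  have h0 : 0 ∈ M.Θ := interior_subset hint
  have hκ := hB.pos
  obtain ⟨C₂, hC₂, h₂⟩ := hB.corrector_bound hint
  refine ⟨κ + κ * C₂ * κ, by positivity, fun θ hθ ε ξ f v z v' hp => ?_⟩
  have hs : M.sumMap Vstar Z (v', 0) = (v' : H) := by simp [sumMap_apply]
  rw [formS_apply, hs, sumMap_apply, LinearMap.map_add₂] at hp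
  simp only [ZeroMemClass.coe_zero, map_zero, zero_add] at hp
  set N := M.corrector a' θ z with hN
  have e : (M.energy ε θ).form (T θ v + (z : M.V 0) + N) (T θ v')
        - (M.d θ).form (E θ f) (M.ι (T θ v')) =
      -- The conjugate appears because (H6) has the transferred vector in the first slot.
      conj ((M.b θ).form (T θ v') (z : M.V 0) - (M.b 0).form v' (z : M.V 0))
      + (M.b θ).form N (T θ v') := by
    rw [← hT.extends_eq θ hθ, hT.d_eq θ hθ, ← hp, energy_form,
      M.a_right_eq_zero (hT.mem_V hle hθ v'), LinearMap.map_add₂, LinearMap.map_add₂,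
      hT.b_eq θ hθ, map_sub, ← (M.b θ).conj_symm, ← (M.b 0).conj_symm]
    ring
  rw [e]
  refine (norm_add_le _ _).trans ?_
  rw [Complex.norm_conj]
  have t1 := hB.transfer θ hθ v' z z.2
  have t2 : ‖(M.b θ).form N (T θ v')‖ ≤ κ * C₂ * κ * (‖θ‖ * ‖z‖) * ‖v'‖ := by
    calc _ ≤ κ * ‖N‖ * ‖T θ v'‖ := hB.b_le θ hθ _ _
      _ ≤ κ * (C₂ * ‖θ‖ * ‖(z : M.V 0)‖) * (κ * ‖v'‖) := by
        gcongr
        · exact h₂ θ z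
        · exact hB.norm_T_le hT hle h0 hθ v'
      _ = _ := by rw [show ‖(z : M.V 0)‖ = ‖z‖ from rfl]; ring
  have t3 : κ * ‖θ‖ * ‖v'‖ * ‖(z : M.V 0)‖ = κ * (‖θ‖ * ‖z‖) * ‖v'‖ := by
    rw [show ‖(z : M.V 0)‖ = ‖z‖ from rfl]; ring
  linarith

end Bounds

end Model

end

/-! ### Error estimates for small θ, for θ away from 0, and for large ξ. -/

section

theorem NonnegForm.sqrt_quad_le_of_le_mul {X : Type*} [AddCommGroup X] [Module ℂ X]
    (s : NonnegForm X) {u : X} {F : ℝ} (hF : 0 ≤ F) (h : s.quad u ≤ F * √(s.quad u)) :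
    √(s.quad u) ≤ F := by
  rcases eq_or_lt_of_le (Real.sqrt_nonneg (s.quad u)) with h0 | h0
  · rw [← h0]; exact hF
  · refine le_of_mul_le_mul_right ?_ h0
    rwa [Real.mul_self_sqrt (s.quad_nonneg u)]

namespace Model

variable {n : ℕ} {H 𝓗 : Type*} [NormedAddCommGroup H] [InnerProductSpace ℂ H]
  [NormedAddCommGroup 𝓗] [InnerProductSpace ℂ 𝓗] {M : Model n H 𝓗}

variable {Vstar : Submodule ℂ H} {Z : Submodule ℂ (M.V 0)} {a' : M.FirstOrder}
  {a'' : M.SecondOrder} {T : Param n → Vstar →ₗ[ℂ] H} {E : Param n → 𝓗 ≃ₗ[ℂ] 𝓗} {κ : ℝ}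

theorem AmbientAssumptions.exists_d_bound (hamb : M.AmbientAssumptions) {θ : Param n}
    (hθ : θ ∈ M.Θ) : ∃ C : ℝ, 0 ≤ C ∧ ∀ u v, ‖(M.d θ).form u v‖ ≤ C * ‖u‖ * ‖v‖ := by
  obtain ⟨c, C, hc, hC, h⟩ := hamb.equiv θ hθ
  refine ⟨C, hC.le, fun u v => ?_⟩
  have := (M.d θ).norm_form_le_of_quad_le (u := u) (v := v) (p := √C * ‖u‖) (q := √C * ‖v‖)
    (by positivity) (by positivity) (by rw [mul_pow, Real.sq_sqrt hC.le]; exact (h u).2)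
    (by rw [mul_pow, Real.sq_sqrt hC.le]; exact (h v).2)
  calc _ ≤ _ := this
    _ = (√C * √C) * ‖u‖ * ‖v‖ := by ring
    _ = _ := by rw [Real.mul_self_sqrt hC.le]

namespace Bounds

variable (hB : M.Bounds Vstar Z a' a'' T E κ)
include hB

theorem energy_le {ε : ℝ} (hε : 0 < ε) {θ : Param n} (hθ : θ ∈ M.Θ) (u v : H) :
    ‖(M.energy ε θ).form u v‖ ≤ ((ε ^ 2)⁻¹ * κ + κ) * ‖u‖ * ‖v‖ := by
  have h1 := hB.a_le θ hθ u v
  have h2 := hB.b_le θ hθ u v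
  rw [energy_form]
  refine (norm_add_le _ _).trans ?_
  rw [norm_mul, norm_inv, norm_pow, Complex.norm_real, Real.norm_of_nonneg hε.le]
  calc _ ≤ (ε ^ 2)⁻¹ * (κ * ‖u‖ * ‖v‖) + κ * ‖u‖ * ‖v‖ := by gcongr
    _ = _ := by ring

theorem sqrt_d_le (hamb : M.AmbientAssumptions) {θ : Param n} (hθ : θ ∈ M.Θ) (u : H) :
    √((M.d θ).quad (M.ι u)) ≤ κ * ‖u‖ := by
  have hκ := hB.pos
  exact Real.sqrt_le_iff.mpr ⟨by positivity, hB.d_quad_le_sq hamb hθ u⟩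

/-- The error estimate for small `θ`. -/
theorem near_estimate [CompleteSpace H] [CompleteSpace 𝓗] (hT : M.Transfer Vstar T E)
    (hamb : M.AmbientAssumptions) (hint : (0 : Param n) ∈ interior M.Θ) (hle : Vstar ≤ M.V 0)
    (hZ : M.IsDefectSubspace Vstar Z) :
    ∃ r C : ℝ, 0 < r ∧ 0 < C ∧ ∀ θ ∈ M.Θ, ‖θ‖ ≤ r → ∀ ε : ℝ, 0 < ε → ε < 1 →
      ∀ (f : 𝓗) (F : ℝ) (u : H) (p : Vstar × Z), 0 ≤ F → (M.d 0).quad f ≤ F ^ 2 →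
      (∀ w, (M.energy ε θ).form u w = (M.d θ).form (E θ f) (M.ι w)) →
      (∀ p', M.formS Vstar Z a' a'' (ε⁻¹ • θ) p p' =
        (M.d 0).form f (M.ι (M.sumMap Vstar Z p'))) →
      √((M.d θ).quad (M.ι u - E θ (M.ι (M.sumMap Vstar Z p)))) ≤ C * ε * F := by
  have h0 : 0 ∈ M.Θ := interior_subset hint
  have hκ := hB.pos
  obtain ⟨Cl, hCl, hlim⟩ := hB.limit_bounds hamb hint hle
  obtain ⟨rt, Ct, hrt, hCt, htest⟩ := hB.test_bounds hT hint hle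
  obtain ⟨rd, hrd, hdense⟩ := hB.exists_dense_triple h0 hle hZ
  obtain ⟨CW, hCW, hW⟩ := hB.residual_W hT hamb hint hle
  obtain ⟨CZ, hCZ, hZr⟩ := hB.residual_Z hT hamb hint hle
  obtain ⟨CV, hCV, hV⟩ := hB.residual_V hT hint hle
  obtain ⟨Cn, hCn, hN⟩ := hB.corrector_bound hint
  refine ⟨min (min rt rd) 1,
    (CV * Cl * Ct + (CZ + CW) * (1 + Cl) * Ct) + (κ * Cn * Cl + κ ^ 2 * Cl),
    by positivity, by positivity, ?_⟩
  rintro θ hθ hθr ε hε hε1 f F u ⟨v, z⟩ hF hf hu hp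
  have hθt : ‖θ‖ ≤ rt := hθr.trans ((min_le_left _ _).trans (min_le_left _ _))
  have hθd : ‖θ‖ ≤ rd := hθr.trans ((min_le_left _ _).trans (min_le_right _ _))
  have hθ1 : ‖θ‖ ≤ 1 := hθr.trans (min_le_right _ _)
  obtain ⟨hv, hz, hz2, hz1⟩ := hlim _ f F (v, z) hF hf hp
  rw [norm_smul, norm_inv, Real.norm_of_nonneg hε.le] at hz2 hz1
  simp only at hv hz hz2 hz1
  have hzε : (ε ^ 2)⁻¹ * ‖θ‖ ^ 2 * ‖z‖ ≤ Cl * F := by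
    rwa [mul_pow, inv_pow] at hz2
  have hzθ : ‖θ‖ * ‖z‖ ≤ ε * (Cl * F) := by
    rw [mul_assoc, inv_mul_le_iff₀ hε] at hz1
    exact hz1
  have hG : 0 ≤ Cl * F := by positivity
  set U := T θ v + (z : M.V 0) + M.corrector a' θ z with hU
  set δ := (CV * Cl * Ct + (CZ + CW) * (1 + Cl) * Ct) * ε * F with hδ
  have hδ0 : 0 ≤ δ := by positivity
  -- The residual is estimated on V_θ^⋆ + Z + W_0 and extended by continuity, density of that sum
  -- being all that is known.
  have hres : ∀ w, ‖(M.energy ε θ).form U w - (M.d θ).form (E θ f) (M.ι w)‖ ≤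
      δ * √((M.energy ε θ).quad w) := by
    obtain ⟨Cd, hCd, hd⟩ := hamb.exists_d_bound hθ
    have hCe : 0 ≤ (ε ^ 2)⁻¹ * κ + κ := by positivity
    have hc1 := SForm.continuous_right hCe (hB.energy_le hε hθ) U
    have hc2 := (SForm.continuous_right hCd hd (E θ f)).comp M.ι.continuous
    have hc3 : Continuous fun w => √((M.energy ε θ).quad w) :=
      (Complex.continuous_re.comp (SForm.continuous_diag hCe (hB.energy_le hε hθ))).sqrt
    have hcl : IsClosed {w | ‖(M.energy ε θ).form U w - (M.d θ).form (E θ f) (M.ι w)‖ ≤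
        δ * √((M.energy ε θ).quad w)} :=
      isClosed_le (hc1.sub hc2).norm (continuous_const.mul hc3)
    intro w
    refine hcl.closure_subset_iff.mpr ?_ (hdense θ hθ hθd w)
    intro x hx
    obtain ⟨y, hy, w, hw, rfl⟩ := Submodule.mem_sup.mp hx
    obtain ⟨v'', hv'', z'', hz'', rfl⟩ := Submodule.mem_sup.mp hy
    rw [← hT.range_eq θ hθ] at hv''
    obtain ⟨v', rfl⟩ := hv''
    obtain ⟨z', hz', rfl⟩ := hz''
    set D := √((M.energy ε θ).quad (T θ v' + (M.V 0).subtype z' + w)) with hD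
    have hDsq : D ^ 2 = _ := Real.sq_sqrt ((M.energy ε θ).quad_nonneg _)
    have hD0 : 0 ≤ D := Real.sqrt_nonneg _
    obtain ⟨k1, k2, k3⟩ := htest θ hθ hθt ε hε hε1 v' ⟨z', hz'⟩ w hw D hD0 hDsq.ge
    have e1 := hV θ hθ ε _ f v z v' (hp (v', 0))
    have e2 := hZr θ hθ ε hε f F _ hF hG hf v z hv hz hzε ⟨z', hz'⟩ (hp (0, ⟨z', hz'⟩))
    have e3 := hW θ hθ hθ1 ε hε f F _ hF hG hf v z hv hz hzε w hw
    have e : (M.energy ε θ).form U (T θ v' + (M.V 0).subtype z' + w) -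
        (M.d θ).form (E θ f) (M.ι (T θ v' + (M.V 0).subtype z' + w)) =
        ((M.energy ε θ).form U (T θ v') - (M.d θ).form (E θ f) (M.ι (T θ v'))) +
        ((M.energy ε θ).form U z' - (M.d θ).form (E θ f) (M.ι z')) +
        ((M.energy ε θ).form U w - (M.d θ).form (E θ f) (M.ι w)) := by
      simp only [map_add, Submodule.subtype_apply]
      ring
    change ‖_‖ ≤ δ * D
    rw [e]
    refine norm_add₃_le.trans ?_
    -- On V_θ^⋆ the factor ε comes from the a priori bound on ‖θ‖‖z‖; in the other two terms it
    -- comes from the test function.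
    have f1 : CV * (‖θ‖ * ‖z‖) * ‖v'‖ ≤ CV * (ε * (Cl * F)) * (Ct * D) := by gcongr
    have f2 : CZ * (F + Cl * F) * (‖θ‖ * ‖(⟨z', hz'⟩ : Z)‖) ≤
        CZ * (F + Cl * F) * (Ct * ε * D) := by gcongr
    have f3 : CW * (F + Cl * F) * ‖w‖ ≤ CW * (F + Cl * F) * (Ct * ε * D) := by gcongr
    calc _ ≤ CV * (ε * (Cl * F)) * (Ct * D) + CZ * (F + Cl * F) * (Ct * ε * D) +
          CW * (F + Cl * F) * (Ct * ε * D) :=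
          add_le_add (add_le_add (e1.trans f1) (e2.trans f2)) (e3.trans f3)
      _ = δ * D := by rw [hδ]; ring
  have hen := (M.energy ε θ).quad_sub_le_of_residual hδ0 hu hres
  have hd1 : √((M.d θ).quad (M.ι (u - U))) ≤ δ := by
    rw [Real.sqrt_le_iff]
    exact ⟨hδ0, (hamb.le_b _ θ hθ).trans ((b_quad_le_energy ε θ _).trans hen)⟩
  have hd2 : √((M.d θ).quad (M.ι (M.corrector a' θ z))) ≤ κ * Cn * Cl * ε * F := by
    calc _ ≤ κ * ‖M.corrector a' θ z‖ := hB.sqrt_d_le hamb hθ _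
      _ ≤ κ * (Cn * ‖θ‖ * ‖(z : M.V 0)‖) := by gcongr; exact hN θ z
      _ = κ * Cn * (‖θ‖ * ‖z‖) := by rw [show ‖(z : M.V 0)‖ = ‖z‖ from rfl]; ring
      _ ≤ κ * Cn * (ε * (Cl * F)) := by gcongr
      _ = _ := by ring
  have hd3 : √((M.d θ).quad (-(E θ (M.ι (z : M.V 0)) - M.ι (z : M.V 0)))) ≤
      κ ^ 2 * Cl * ε * F := by
    rw [NonnegForm.quad_neg]
    have k : √((M.d θ).quad (E θ (M.ι (z : M.V 0)) - M.ι (z : M.V 0))) ≤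
        κ * ‖θ‖ * (κ * ‖z‖) := by
      rw [Real.sqrt_le_iff]
      refine ⟨by positivity, (hB.E_lip θ hθ _).trans ?_⟩
      rw [mul_pow _ (κ * ‖z‖)]
      gcongr
      exact hB.d_quad_le_sq hamb h0 _
    calc _ ≤ _ := k
      _ = κ ^ 2 * (‖θ‖ * ‖z‖) := by ring
      _ ≤ κ ^ 2 * (ε * (Cl * F)) := by gcongr
      _ = _ := by ring
  -- The transferred `T θ v` cancels exactly; the corrector and `E θ z` − z are both O(‖θ‖‖z‖) =
  -- O(ε).
  have e : M.ι u - E θ (M.ι (M.sumMap Vstar Z (v, z))) =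
      M.ι (u - U) + (M.ι (M.corrector a' θ z) + -(E θ (M.ι (z : M.V 0)) - M.ι (z : M.V 0))) := by
    rw [sumMap_apply]
    simp only [hU, map_add, map_sub, hT.extends_eq θ hθ]
    abel
  rw [e]
  have g1 := (M.d θ).sqrt_quad_add_le (M.ι (u - U))
    (M.ι (M.corrector a' θ z) + -(E θ (M.ι (z : M.V 0)) - M.ι (z : M.V 0)))
  have g2 := (M.d θ).sqrt_quad_add_le (M.ι (M.corrector a' θ z))
    (-(E θ (M.ι (z : M.V 0)) - M.ι (z : M.V 0)))
  rw [hδ] at hd1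
  linarith

/-- The error estimate away from `θ = 0`. -/
theorem far_estimate [CompleteSpace H] (hT : M.Transfer Vstar T E)
    (hamb : M.AmbientAssumptions) (hint : (0 : Param n) ∈ interior M.Θ) (hle : Vstar ≤ M.V 0)
    {r : ℝ} (hr : 0 < r) :
    ∃ C : ℝ, 0 < C ∧ ∀ θ ∈ M.Θ, r ≤ ‖θ‖ → ∀ ε : ℝ, 0 < ε →
      ∀ (f : 𝓗) (F : ℝ) (u : H) (v : Vstar), 0 ≤ F → (M.d 0).quad f ≤ F ^ 2 →
      (∀ w, (M.energy ε θ).form u w = (M.d θ).form (E θ f) (M.ι w)) →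
      (∀ v' : Vstar, (M.b 0).form v v' = (M.d 0).form f (M.ι v')) →
      √((M.d θ).quad (M.ι u - E θ (M.ι v))) ≤ C * ε * F := by
  have h0 : 0 ∈ M.Θ := interior_subset hint
  have hκ := hB.pos
  have hκ1 := hB.one_le
  refine ⟨(κ * (κ * κ) + κ) * (κ / r), by positivity, fun θ hθ hθr ε hε f F u v hF hf hu hv => ?_⟩
  have hθ0 : θ ≠ 0 := by
    rintro rfl
    rw [norm_zero] at hθr
    linarith
  have hvb : ‖v‖ ≤ κ * F := by
    have h1 : √((M.b 0).quad v) ≤ F := by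
      refine (M.b 0).sqrt_quad_le_of_le_mul hF ?_
      have k : (M.b 0).quad v = ((M.d 0).form f (M.ι v)).re := congrArg Complex.re (hv v)
      exact k.le.trans <| (Complex.re_le_norm _).trans ((M.d 0).norm_form_le_of_quad_le hF (Real.sqrt_nonneg _) hf
        ((hamb.le_b _ 0 h0).trans (Real.sq_sqrt ((M.b 0).quad_nonneg _)).ge))
    rw [Real.sqrt_le_iff] at h1
    refine le_of_sq_le_sq ?_ (by positivity)
    calc _ ≤ κ * (M.b 0).quad v := hB.norm_sq_le_b_zero h0 (hle v.2)
      _ ≤ κ * F ^ 2 := by gcongr; exact h1.2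
      _ ≤ κ * κ * F ^ 2 := by gcongr; exact le_mul_of_one_le_left hκ.le hκ1
      _ = _ := by ring
  have hTv : ‖T θ v‖ ≤ κ * κ * F := by
    refine (hB.norm_T_le hT hle h0 hθ v).trans ?_
    rw [mul_assoc]
    gcongr
  have hδ0 : 0 ≤ (κ * (κ * κ) + κ) * (κ / r) * ε * F := by positivity
  -- As θ ≠ 0, the range of `T θ` is all of V_θ, where the residual vanishes; on W_θ the gap with
  -- ‖θ‖ ≥ r gives ‖w‖ = O(ε) in terms of the energy.
  have hres : ∀ w, ‖(M.energy ε θ).form (T θ v) w - (M.d θ).form (E θ f) (M.ι w)‖ ≤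
      (κ * (κ * κ) + κ) * (κ / r) * ε * F * √((M.energy ε θ).quad w) := by
    intro x
    obtain ⟨y, hy, w, hw, rfl⟩ := hB.exists_decomp hθ x
    have hy' : y ∈ LinearMap.range (T θ) := by
      rw [hT.range_eq θ hθ, Vs, if_neg hθ0]; exact hy
    obtain ⟨v', rfl⟩ := hy'
    set D := √((M.energy ε θ).quad (T θ v' + w)) with hD
    have hDsq : D ^ 2 = (M.energy ε θ).quad (T θ v' + w) :=
      Real.sq_sqrt ((M.energy ε θ).quad_nonneg _)
    have hD0 : 0 ≤ D := Real.sqrt_nonneg _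
    have hw1 : ‖w‖ ≤ κ / r * ε * D := by
      have k1 := hB.gap θ hθ w hw
      have k2 : (M.a θ).quad (T θ v' + w) = (M.a θ).quad w := by
        rw [NonnegForm.quad_add, M.a_left_eq_zero hy, NonnegForm.quad, M.a_left_eq_zero hy]
        simp
      have k3 := M.a_quad_le_energy hε θ (T θ v' + w)
      rw [k2, ← hDsq] at k3
      refine le_of_sq_le_sq ?_ (by positivity)
      have k4 : r ^ 2 * ‖w‖ ^ 2 ≤ κ * κ * (ε ^ 2 * D ^ 2) := by
        calc r ^ 2 * ‖w‖ ^ 2 ≤ ‖θ‖ ^ 2 * ‖w‖ ^ 2 := by gcongr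
          _ ≤ κ * (M.a θ).quad w := k1
          _ ≤ κ * (ε ^ 2 * D ^ 2) := by gcongr
          _ ≤ _ := by gcongr; exact le_mul_of_one_le_left hκ.le hκ1
      calc ‖w‖ ^ 2 = (r ^ 2)⁻¹ * (r ^ 2 * ‖w‖ ^ 2) := by field_simp
        _ ≤ (r ^ 2)⁻¹ * (κ * κ * (ε ^ 2 * D ^ 2)) := by gcongr
        _ = _ := by field_simp
    have e : (M.energy ε θ).form (T θ v) (T θ v' + w) -
        (M.d θ).form (E θ f) (M.ι (T θ v' + w)) =
        (M.b θ).form (T θ v) w - (M.d θ).form (E θ f) (M.ι w) := by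
      rw [energy_form, M.a_left_eq_zero (hT.mem_V hle hθ v)]
      simp only [map_add]
      rw [hT.b_eq θ hθ, ← hT.extends_eq θ hθ, hT.d_eq θ hθ, hv]
      ring
    rw [e]
    refine (norm_sub_le _ _).trans ?_
    have k1 := hB.b_le θ hθ (T θ v) w
    have k2 := hB.norm_d_le hamb hθ hF ((hT.d_quad_eq hθ f).le.trans hf) w
    calc _ ≤ κ * ‖T θ v‖ * ‖w‖ + κ * F * ‖w‖ := add_le_add k1 k2
      _ ≤ κ * (κ * κ * F) * (κ / r * ε * D) + κ * F * (κ / r * ε * D) := by gcongr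
      _ = _ := by ring
  have hen := (M.energy ε θ).quad_sub_le_of_residual hδ0 hu hres
  rw [hT.extends_eq θ hθ, ← map_sub, Real.sqrt_le_iff]
  exact ⟨hδ0, (hamb.le_b _ θ hθ).trans ((b_quad_le_energy ε θ _).trans hen)⟩

/-- The limit problem for large `ξ`. -/
theorem limit_far [CompleteSpace H] (hamb : M.AmbientAssumptions)
    (hint : (0 : Param n) ∈ interior M.Θ) (hle : Vstar ≤ M.V 0) :
    ∃ C : ℝ, 0 < C ∧ ∀ (ξ : Param n) (f : 𝓗) (F : ℝ) (p : Vstar × Z) (v : Vstar), 0 ≤ F →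
      (M.d 0).quad f ≤ F ^ 2 →
      (∀ p', M.formS Vstar Z a' a'' ξ p p' = (M.d 0).form f (M.ι (M.sumMap Vstar Z p'))) →
      (∀ v' : Vstar, (M.b 0).form v v' = (M.d 0).form f (M.ι v')) →
      ‖ξ‖ * √((M.d 0).quad (M.ι v - M.ι (M.sumMap Vstar Z p))) ≤ C * F := by
  obtain ⟨C, hC, hlim⟩ := hB.limit_bounds hamb hint hle
  have h0 : 0 ∈ M.Θ := interior_subset hint
  have hκ := hB.pos
  refine ⟨2 * κ * C, by positivity, ?_⟩
  rintro ξ f F ⟨v₀, z⟩ v hF hf hp hv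
  obtain ⟨-, -, -, hz⟩ := hlim ξ f F _ hF hf hp
  simp only at hz
  -- Subtracting the two equations, tested with v − v₀, shows that v − v₀ is controlled by z, and
  -- |ξ|‖z‖ is bounded.
  have h1 : (M.b 0).form ((v : H) - v₀) ((v : H) - v₀) =
      (M.b 0).form (z : M.V 0) ((v : H) - v₀) := by
    have k1 := hv (v - v₀)
    have k2 := hp (v - v₀, 0)
    have hs : M.sumMap Vstar Z (v - v₀, 0) = ((v - v₀ : Vstar) : H) := by simp [sumMap_apply]
    rw [formS_apply, hs, sumMap_apply, ← k1, LinearMap.map_add₂] at k2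
    simp only [ZeroMemClass.coe_zero, map_zero, zero_add, AddSubgroupClass.coe_sub] at k2
    rw [LinearMap.map_sub₂, ← k2]
    ring
  have hbz : √((M.b 0).quad (z : M.V 0)) ≤ κ * ‖z‖ :=
    Real.sqrt_le_iff.mpr ⟨by positivity, hB.b_quad_le_sq h0 _⟩
  have h2 : √((M.b 0).quad ((v : H) - v₀)) ≤ κ * ‖z‖ := by
    refine (M.b 0).sqrt_quad_le_of_le_mul (by positivity) ?_
    have k : (M.b 0).quad ((v : H) - v₀) = ((M.b 0).form (z : M.V 0) ((v : H) - v₀)).re :=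
      congrArg Complex.re h1
    refine k.le.trans <| (Complex.re_le_norm _).trans (((M.b 0).norm_form_le _ _).trans ?_)
    gcongr
  have h3 : M.ι v - M.ι (M.sumMap Vstar Z (v₀, z)) = M.ι ((v : H) - v₀) + -M.ι (z : M.V 0) := by
    rw [sumMap_apply, map_add, map_sub]; abel
  have h4 := (M.d 0).sqrt_quad_add_le (M.ι ((v : H) - v₀)) (-M.ι (z : M.V 0))
  rw [← h3, NonnegForm.quad_neg] at h4
  have h5 : √((M.d 0).quad (M.ι ((v : H) - v₀))) ≤ κ * ‖z‖ :=
    (Real.sqrt_le_sqrt (hamb.le_b _ 0 h0)).trans h2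
  have h6 : √((M.d 0).quad (M.ι (z : M.V 0))) ≤ κ * ‖z‖ :=
    (Real.sqrt_le_sqrt (hamb.le_b _ 0 h0)).trans hbz
  calc _ ≤ ‖ξ‖ * (2 * κ * ‖z‖) := by gcongr; linarith
    _ = 2 * κ * (‖ξ‖ * ‖z‖) := by ring
    _ ≤ 2 * κ * (C * F) := by gcongr
    _ = _ := by ring

end Bounds

end Model

end

/-! ### Solution operators of form problems. -/

section

/-- `R` is the solution operator `f ↦ j q` of the problem `s(q, q') = d(f, j q')` for all `q'`. -/
def IsResolvent {Q X : Type*} [AddCommGroup Q] [Module ℂ Q] [NormedAddCommGroup X]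
    [NormedSpace ℂ X] (j : Q →ₗ[ℂ] X) (s : SForm Q) (d : SForm X) (R : X →L[ℂ] X) : Prop :=
  ∀ f, ∃ q, j q = R f ∧ ∀ q', s q q' = d f (j q')

namespace IsResolvent

variable {Q X : Type*} [AddCommGroup Q] [Module ℂ Q] [NormedAddCommGroup X]
  [InnerProductSpace ℂ X] {j : Q →ₗ[ℂ] X} {s : NonnegForm Q} {d : NonnegForm X}
  {R : X →L[ℂ] X} (h : IsResolvent j s.form d.form R)
include h

theorem isSymm : IsSymm d R := by
  intro f g
  obtain ⟨p, hp, hp'⟩ := h f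
  obtain ⟨q, hq, hq'⟩ := h g
  rw [← hp, ← hq, ← hp', s.conj_symm, hq', ← d.conj_symm]

theorem form_nonneg (f : X) : 0 ≤ (d.form (R f) f).re := by
  obtain ⟨p, hp, hp'⟩ := h f
  rw [← hp, d.conj_symm f, ← hp', Complex.conj_re]
  exact s.quad_nonneg p

theorem quad_le (hle : ∀ q, d.quad (j q) ≤ s.quad q) (f : X) : d.quad (R f) ≤ d.quad f := by
  obtain ⟨p, hp, hp'⟩ := h f
  have h1 : d.quad (R f) ≤ √(d.quad f) * √(d.quad (R f)) := by
    rw [← hp]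
    refine (hle p).trans ?_
    have : s.quad p = (d.form f (j p)).re := congrArg Complex.re (hp' p)
    rw [this]
    exact (Complex.re_le_norm _).trans (d.norm_form_le _ _)
  have h2 := d.sqrt_quad_le_of_le_mul (Real.sqrt_nonneg _) h1
  exact (Real.sqrt_le_sqrt_iff (d.quad_nonneg f)).mp h2

theorem isInverse {c : ℝ} (hc : 0 < c) (hd : ∀ u, c * ‖u‖ ^ 2 ≤ d.quad u)
    (hcont : ∀ u, Continuous fun v => d.form u v) (hle : ∀ q, d.quad (j q) ≤ s.quad q)
    (hj : Function.Injective j) (hdense : DenseRange j) :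
    IsInverse (formOperator j s.form d.form) R := by
  have hdef : ∀ u, d.form u u = 0 → u = 0 := by
    intro u hu
    have h1 := hd u
    rw [NonnegForm.quad, hu, Complex.zero_re] at h1
    have h2 : ‖u‖ ^ 2 ≤ 0 := by
      by_contra hneg
      have := mul_pos hc (not_le.mp hneg)
      linarith
    have h3 : ‖u‖ = 0 := by nlinarith [norm_nonneg u]
    exact norm_eq_zero.mp h3
  refine formOperator_isInverse hj (fun g hg => hdef g ?_) (fun q hq => ?_) h
  · have hcl : IsClosed {v | d.form g v = 0} := isClosed_eq (hcont g) continuous_const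
    exact hcl.closure_subset_iff.mpr (by rintro _ ⟨q, rfl⟩; exact hg q) (hdense g)
  · refine hj ?_
    rw [map_zero]
    refine hdef _ ?_
    have h1 := hle q
    rw [show s.quad q = (s.form q q).re from rfl, hq, Complex.zero_re] at h1
    rw [d.form_self, le_antisymm h1 (d.quad_nonneg _), Complex.ofReal_zero]

/-- With p the solution for right-hand side j q, one has d(R j q, j q) = s[p] and d[j q] = s(p, q).
Cauchy–Schwarz for `s` then bounds the Rayleigh quotient of `R` at j q from below by d[j q]/s[q]. -/
theorem exists_mem_spectrum_ge [CompleteSpace X] {c C : ℝ} (hc : 0 < c) (hC : 0 ≤ C)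
    (hl : ∀ u, c * ‖u‖ ^ 2 ≤ d.quad u) (hr : ∀ u, d.quad u ≤ C * ‖u‖ ^ 2) {q : Q}
    (hq : 0 < d.quad (j q)) (hle : d.quad (j q) ≤ s.quad q) :
    ∃ z ∈ spectrum ℂ R, d.quad (j q) / s.quad q ≤ ‖z‖ := by
  refine DegenerateForms.exists_mem_spectrum_ge hc hC hl hr h.isSymm (u := j q) hq ?_
  obtain ⟨p, hp, hp'⟩ := h (j q)
  have hs : 0 < s.quad q := hq.trans_le hle
  have h1 := s.norm_form_sq_le p q
  rw [hp' q, d.form_self, Complex.norm_real, Real.norm_of_nonneg hq.le] at h1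
  have h2 : (d.form (R (j q)) (j q)).re = s.quad p := by
    rw [← hp, d.conj_symm (j q), ← hp', Complex.conj_re]; rfl
  rw [h2, div_mul_eq_mul_div, div_le_iff₀ hs]
  linarith [sq (d.quad (j q))]

end IsResolvent

/-- Lax–Milgram needs a Hilbert space, while the form domain `Q` has no norm here; `e` supplies a
Hilbert parametrisation, such as V_0 for `Vstar × Z`. -/
theorem exists_isResolvent {Q K X : Type*} [AddCommGroup Q] [Module ℂ Q] [NormedAddCommGroup K]
    [InnerProductSpace ℂ K] [CompleteSpace K] [NormedAddCommGroup X] [NormedSpace ℂ X]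
    (e : K ≃ₗ[ℂ] Q) {j : Q →ₗ[ℂ] X} {J : K →L[ℂ] X} (hJ : ∀ k, J k = j (e k))
    {s : SForm Q} {d : SForm X} {c C D : ℝ} (hc : 0 < c) (hC : 0 ≤ C) (hD : 0 ≤ D)
    (hcoer : ∀ k, c * ‖k‖ ^ 2 ≤ (s (e k) (e k)).re)
    (hs : ∀ k k', ‖s (e k) (e k')‖ ≤ C * ‖k‖ * ‖k'‖) (hd : ∀ u v, ‖d u v‖ ≤ D * ‖u‖ * ‖v‖) :
    ∃ R : X →L[ℂ] X, IsResolvent j s d R := by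
  let s' : SForm K := LinearMap.mk₂'ₛₗ (RingHom.id ℂ) (starRingEnd ℂ)
    (fun k k' => s (e k) (e k')) (by simp) (by simp) (by simp) (by simp)
  let t : X →ₗ[ℂ] K →ₗ⋆[ℂ] ℂ := LinearMap.mk₂'ₛₗ (RingHom.id ℂ) (starRingEnd ℂ)
    (fun u k => d u (J k)) (by simp) (by simp) (by simp) (by simp)
  obtain ⟨S, hS⟩ := lax_milgram s' hc hC hcoer hs t (D := D * ‖J‖) (by positivity)
    (fun u k => by
      refine (hd u (J k)).trans ?_
      calc D * ‖u‖ * ‖J k‖ ≤ D * ‖u‖ * (‖J‖ * ‖k‖) := by gcongr; exact J.le_opNorm k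
        _ = _ := by ring)
  refine ⟨J ∘L S, fun f => ⟨e (S f), (hJ _).symm, fun q' => ?_⟩⟩
  have : s (e (S f)) (e (e.symm q')) = d f (J (e.symm q')) := hS f (e.symm q')
  rwa [hJ, e.apply_symm_apply] at this

end

/-! ### Comparison of the resolvents. -/

section

namespace Model

variable {n : ℕ} {H 𝓗 : Type*} [NormedAddCommGroup H] [InnerProductSpace ℂ H]
  [NormedAddCommGroup 𝓗] [InnerProductSpace ℂ 𝓗] {M : Model n H 𝓗}

variable {Vstar : Submodule ℂ H} {Z : Submodule ℂ (M.V 0)} {a' : M.FirstOrder}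
  {a'' : M.SecondOrder} {T : Param n → Vstar →ₗ[ℂ] H} {E : Param n → 𝓗 ≃ₗ[ℂ] 𝓗} {κ : ℝ}

/-- The restriction of `d_0` to `𝓗_0` as a non-negative form. -/
def limitInnerForm (M : Model n H 𝓗) (Vstar : Submodule ℂ H) (Z : Submodule ℂ (M.V 0)) :
    NonnegForm (M.limitSpace Vstar Z) where
  form := M.limitInner Vstar Z
  nonneg u := (M.d 0).nonneg u

/-- The embedding of `V_⋆ ∔ Z` into `𝓗`. -/
def limitInclusion (M : Model n H 𝓗) (Vstar : Submodule ℂ H) (Z : Submodule ℂ (M.V 0)) :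
    (Vstar × Z) →ₗ[ℂ] 𝓗 :=
  (M.ι : H →ₗ[ℂ] 𝓗) ∘ₗ M.sumMap Vstar Z

theorem limitInclusion_apply (p : Vstar × Z) :
    M.limitInclusion Vstar Z p = M.ι (M.sumMap Vstar Z p) := rfl

theorem IsDefectSubspace.sumMap_mem (hZ : M.IsDefectSubspace Vstar Z) (p : Vstar × Z) :
    M.sumMap Vstar Z p ∈ M.V 0 := by
  rw [sumMap_apply]
  exact Submodule.add_mem _ (hZ.Vstar_le p.1.2) (p.2 : M.V 0).2

theorem IsDefectSubspace.sumMap_injective (hZ : M.IsDefectSubspace Vstar Z) :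
    Function.Injective (M.sumMap Vstar Z) := by
  rw [injective_iff_map_eq_zero]
  rintro ⟨v, z⟩ h
  rw [sumMap_apply] at h
  have h1 : (v : H) = -((z : M.V 0) : H) := eq_neg_of_add_eq_zero_left h
  have h2 : (v : H) ∈ Vstar ⊓ Z.map (M.V 0).subtype :=
    ⟨v.2, by rw [h1]; exact Submodule.neg_mem _ ⟨z, z.2, rfl⟩⟩
  rw [hZ.inf_eq, Submodule.mem_bot] at h2
  rw [h2, eq_comm, neg_eq_zero] at h1
  exact Prod.ext (Subtype.ext h2) (Subtype.ext (Subtype.ext h1))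

theorem IsDefectSubspace.sumMap_surjective (hZ : M.IsDefectSubspace Vstar Z) (y : M.V 0) :
    ∃ p, M.sumMap Vstar Z p = y := by
  have hy : (y : H) ∈ Vstar ⊔ Z.map (M.V 0).subtype := hZ.sup_eq.ge y.2
  obtain ⟨v, hv, _, ⟨z, hz, rfl⟩, h⟩ := Submodule.mem_sup.mp hy
  exact ⟨(⟨v, hv⟩, ⟨z, hz⟩), h⟩

/-- `V_⋆ × Z` as a parametrisation of `V_0`. -/
def IsDefectSubspace.equiv (hZ : M.IsDefectSubspace Vstar Z) : (Vstar × Z) ≃ₗ[ℂ] M.V 0 :=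
  LinearEquiv.ofBijective ((M.sumMap Vstar Z).codRestrict (M.V 0) hZ.sumMap_mem)
    ⟨fun _ _ h => hZ.sumMap_injective (congrArg Subtype.val h), fun y => by
      obtain ⟨p, hp⟩ := hZ.sumMap_surjective y
      exact ⟨p, Subtype.ext hp⟩⟩

theorem IsDefectSubspace.sumMap_equiv_symm (hZ : M.IsDefectSubspace Vstar Z) (k : M.V 0) :
    M.sumMap Vstar Z (hZ.equiv.symm k) = k :=
  congrArg Subtype.val (hZ.equiv.apply_symm_apply k)

namespace Bounds

variable (hB : M.Bounds Vstar Z a' a'' T E κ) [CompleteSpace H]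
include hB

theorem exists_limitEnergy (hint : (0 : Param n) ∈ interior M.Θ) (hle : Vstar ≤ M.V 0)
    (ξ : Param n) : ∃ s : NonnegForm (Vstar × Z), s.form = M.formS Vstar Z a' a'' ξ ∧
      ∀ p, (M.b 0).quad (M.sumMap Vstar Z p) ≤ s.quad p := by
  obtain ⟨c, hc, h⟩ := hB.homForm_elliptic hint hle
  have key : ∀ p : Vstar × Z, (M.b 0).quad (M.sumMap Vstar Z p) ≤
      (M.formS Vstar Z a' a'' ξ p p).re ∧ (M.formS Vstar Z a' a'' ξ p p).im = 0 := by
    intro p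
    obtain ⟨h1, h2⟩ := h ξ p.2 p.2.2
    rw [formS_apply, (M.b 0).form_self, Complex.add_re, Complex.add_im, h2, Complex.ofReal_re,
      Complex.ofReal_im, add_zero]
    refine ⟨?_, rfl⟩
    have : 0 ≤ c * ‖ξ‖ ^ 2 * ‖(p.2 : M.V 0)‖ ^ 2 := by positivity
    linarith
  exact ⟨⟨M.formS Vstar Z a' a'' ξ,
    fun p => ⟨((M.b 0).quad_nonneg _).trans (key p).1, (key p).2⟩⟩, rfl, fun p => (key p).1⟩

theorem exists_resolvent_energy (hamb : M.AmbientAssumptions) {θ : Param n} (hθ : θ ∈ M.Θ) {ε : ℝ}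
    (hε : 0 < ε) (hε1 : ε < 1) :
    ∃ R : 𝓗 →L[ℂ] 𝓗, IsResolvent (M.ι : H →ₗ[ℂ] 𝓗) (M.energy ε θ).form (M.d θ).form R := by
  have hκ := hB.pos
  obtain ⟨D, hD, hd⟩ := hamb.exists_d_bound hθ
  exact exists_isResolvent (LinearEquiv.refl ℂ H) (J := M.ι) (fun _ => rfl)
    (c := κ⁻¹) (C := (ε ^ 2)⁻¹ * κ + κ) (by positivity) (by positivity) hD
    (fun k => by
      rw [inv_mul_le_iff₀ hκ]
      exact hB.norm_sq_le_energy hε hε1 hθ k)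
    (fun k k' => hB.energy_le hε hθ k k') hd

/-- The limit problem is solved for every `f` in 𝓗, not only in 𝓗_0, so that both resolvents act on
the same space. -/
theorem exists_resolvent_limit (hamb : M.AmbientAssumptions)
    (hint : (0 : Param n) ∈ interior M.Θ) (hZ : M.IsDefectSubspace Vstar Z) (ξ : Param n) :
    ∃ B : 𝓗 →L[ℂ] 𝓗, IsResolvent (M.limitInclusion Vstar Z) (M.formS Vstar Z a' a'' ξ)
      (M.d 0).form B := by
  have h0 : 0 ∈ M.Θ := interior_subset hint
  have hκ := hB.pos
  have : CompleteSpace (M.V 0) := (hB.isClosed_V h0).completeSpace_coe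
  obtain ⟨D, hD, hd⟩ := hamb.exists_d_bound h0
  obtain ⟨s, hs, hsb⟩ := hB.exists_limitEnergy hint hZ.Vstar_le ξ
  obtain ⟨Ch, hCh, hh⟩ := hB.homForm_bound hint
  have hzb : ∀ k : M.V 0, ‖((hZ.equiv.symm k).2 : M.V 0)‖ ≤ κ * ‖k‖ := by
    intro k
    have h1 := hB.transversal _ (hZ.equiv.symm k).1.2 _ (hZ.equiv.symm k).2.2
    rw [← sumMap_apply, hZ.sumMap_equiv_symm] at h1
    refine le_of_sq_le_sq ?_ (by positivity)
    calc _ ≤ κ * ‖(k : H)‖ ^ 2 := by linarith [sq_nonneg ‖((hZ.equiv.symm k).1 : H)‖]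
      _ ≤ κ * κ * ‖(k : H)‖ ^ 2 := by gcongr; exact le_mul_of_one_le_left hκ.le hB.one_le
      _ = _ := by rw [Submodule.coe_norm]; ring
  refine exists_isResolvent hZ.equiv.symm (J := M.ι ∘L (M.V 0).subtypeL)
    (c := κ⁻¹) (C := Ch * ‖ξ‖ ^ 2 * κ ^ 2 + κ) (fun k => ?_) (by positivity) (by positivity) hD
    (fun k => ?_) (fun k k' => ?_) hd
  · rw [limitInclusion_apply, hZ.sumMap_equiv_symm]; rfl
  · rw [inv_mul_le_iff₀ hκ]
    refine (hB.norm_sq_le_b_zero h0 k.2).trans ?_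
    have := hsb (hZ.equiv.symm k)
    rw [hZ.sumMap_equiv_symm, NonnegForm.quad.eq_1 s, hs] at this
    gcongr
  · rw [formS_apply, hZ.sumMap_equiv_symm, hZ.sumMap_equiv_symm]
    refine (norm_add_le _ _).trans ?_
    have h1 := hh ξ (hZ.equiv.symm k).2 (hZ.equiv.symm k').2
    have h2 : Ch * ‖ξ‖ ^ 2 * ‖((hZ.equiv.symm k).2 : M.V 0)‖ * ‖((hZ.equiv.symm k').2 : M.V 0)‖ ≤
        Ch * ‖ξ‖ ^ 2 * (κ * ‖k‖) * (κ * ‖k'‖) := by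
      gcongr
      · exact hzb k
      · exact hzb k'
    have h3 := hB.b_le 0 h0 (k : H) k'
    calc _ ≤ Ch * ‖ξ‖ ^ 2 * (κ * ‖k‖) * (κ * ‖k'‖) + κ * ‖(k : H)‖ * ‖(k' : H)‖ :=
          add_le_add (h1.trans h2) h3
      _ = _ := by rw [Submodule.coe_norm, Submodule.coe_norm]; ring

/-- This is the common approximation of both problems when |θ| and ε|ξ| are bounded below: the `Z`
component has disappeared. -/
theorem exists_vstar_solution (hamb : M.AmbientAssumptions)
    (hint : (0 : Param n) ∈ interior M.Θ) (hle : Vstar ≤ M.V 0)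
    (hcl : IsClosed (Vstar : Set H)) (f : 𝓗) :
    ∃ v : Vstar, ∀ v' : Vstar, (M.b 0).form v v' = (M.d 0).form f (M.ι v') := by
  have h0 : 0 ∈ M.Θ := interior_subset hint
  have hκ := hB.pos
  have : CompleteSpace Vstar := hcl.completeSpace_coe
  obtain ⟨D, hD, hd⟩ := hamb.exists_d_bound h0
  obtain ⟨R, hR⟩ := exists_isResolvent (LinearEquiv.refl ℂ Vstar) (J := M.ι ∘L Vstar.subtypeL)
    (j := (M.ι : H →ₗ[ℂ] 𝓗) ∘ₗ Vstar.subtype) (s := (M.b 0).form.domRestrict₁₂ Vstar Vstar)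
    (d := (M.d 0).form) (c := κ⁻¹) (C := κ) (fun _ => rfl) (by positivity) (by positivity) hD
    (fun k => by
      rw [inv_mul_le_iff₀ hκ]
      exact hB.norm_sq_le_b_zero h0 (hle k.2))
    (fun k k' => hB.b_le 0 h0 k k') hd
  obtain ⟨v, -, hv⟩ := hR f
  exact ⟨v, hv⟩

/-- The operators `L_{ε,θ}⁻¹`, transported by the transfer operators, are close to the inverses of
the limit operators. -/
theorem resolvent_close [CompleteSpace 𝓗] (hT : M.Transfer Vstar T E)
    (hamb : M.AmbientAssumptions) (hint : (0 : Param n) ∈ interior M.Θ)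
    (hcl : IsClosed (Vstar : Set H)) (hZ : M.IsDefectSubspace Vstar Z) {ρ : ℝ} (hρ : 0 < ρ) :
    ∃ C : ℝ, 0 < C ∧ ∀ ε : ℝ, 0 < ε → ε < 1 → ∀ θ ∈ M.Θ, ∀ ξ : Param n,
      (ξ = ε⁻¹ • θ ∨ ρ ≤ ‖θ‖ ∧ ρ ≤ ε * ‖ξ‖) → ∀ R B : 𝓗 →L[ℂ] 𝓗,
      IsResolvent (M.ι : H →ₗ[ℂ] 𝓗) (M.energy ε θ).form (M.d θ).form R →
      IsResolvent (M.limitInclusion Vstar Z) (M.formS Vstar Z a' a'' ξ) (M.d 0).form B →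
      ∀ f, (M.d θ).quad (R (E θ f) - E θ (B f)) ≤ (C * ε) ^ 2 * (M.d 0).quad f := by
  have hle := hZ.Vstar_le
  obtain ⟨r, C₁, hr, hC₁, hnear⟩ := hB.near_estimate hT hamb hint hle hZ
  have hρr : 0 < min r ρ := lt_min hr hρ
  obtain ⟨C₂, hC₂, hfar⟩ := hB.far_estimate hT hamb hint hle hρr
  obtain ⟨C₃, hC₃, hlim⟩ := hB.limit_far hamb hint hle
  refine ⟨C₁ + C₂ + C₃ / min r ρ, by positivity, fun ε hε hε1 θ hθ ξ hξ R B hR hBr f => ?_⟩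
  obtain ⟨u, hu, hu'⟩ := hR (E θ f)
  obtain ⟨p, hp, hp'⟩ := hBr f
  set F := √((M.d 0).quad f) with hF
  have hFsq : F ^ 2 = (M.d 0).quad f := Real.sq_sqrt ((M.d 0).quad_nonneg f)
  have hF0 : 0 ≤ F := Real.sqrt_nonneg _
  suffices h : √((M.d θ).quad (M.ι u - E θ (M.ι (M.sumMap Vstar Z p)))) ≤
      (C₁ + C₂ + C₃ / min r ρ) * ε * F by
    have h1 := (Real.sqrt_le_iff.mp h).2
    rw [mul_pow, hFsq] at h1
    rw [← hu, ← hp]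
    exact h1
  -- Outside this case both ‖θ‖ and ε‖ξ‖ are at least `min r ρ`, and both solutions are O(ε)-close
  -- to the `Vstar` solution, so ξ need not be θ/ε.
  by_cases hcase : ξ = ε⁻¹ • θ ∧ ‖θ‖ ≤ r
  · obtain ⟨rfl, hθr⟩ := hcase
    refine (hnear θ hθ hθr ε hε hε1 f F u p hF0 hFsq.ge hu' hp').trans ?_
    gcongr
    have : 0 ≤ C₃ / min r ρ := by positivity
    linarith
  · have hbig : min r ρ ≤ ‖θ‖ ∧ min r ρ ≤ ε * ‖ξ‖ := by
      rcases hξ with h | h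
      · have hθr : r ≤ ‖θ‖ := by
          by_contra hneg
          exact hcase ⟨h, (not_le.mp hneg).le⟩
        refine ⟨(min_le_left _ _).trans hθr, ?_⟩
        rw [h, norm_smul, norm_inv, Real.norm_of_nonneg hε.le, mul_inv_cancel_left₀ hε.ne']
        exact (min_le_left _ _).trans hθr
      · exact ⟨(min_le_right _ _).trans h.1, (min_le_right _ _).trans h.2⟩
    obtain ⟨v, hv⟩ := hB.exists_vstar_solution hamb hint hle hcl f
    have h1 := hfar θ hθ hbig.1 ε hε f F u v hF0 hFsq.ge hu' hv
    have h2 := hlim ξ f F p v hF0 hFsq.ge hp' hv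
    set x := √((M.d 0).quad (M.ι v - M.ι (M.sumMap Vstar Z p))) with hx
    have hx0 : 0 ≤ x := Real.sqrt_nonneg _
    have h3 : x ≤ C₃ / min r ρ * ε * F := by
      have h4 : min r ρ * x ≤ ε * (C₃ * F) := by
        calc min r ρ * x ≤ (ε * ‖ξ‖) * x := by gcongr; exact hbig.2
          _ = ε * (‖ξ‖ * x) := by ring
          _ ≤ _ := by gcongr
      calc x = (min r ρ)⁻¹ * (min r ρ * x) := by field_simp
        _ ≤ (min r ρ)⁻¹ * (ε * (C₃ * F)) := by gcongr
        _ = _ := by ring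
    have h5 : M.ι u - E θ (M.ι (M.sumMap Vstar Z p)) =
        (M.ι u - E θ (M.ι v)) + E θ (M.ι v - M.ι (M.sumMap Vstar Z p)) := by
      rw [map_sub]; abel
    rw [h5]
    refine ((M.d θ).sqrt_quad_add_le _ _).trans ?_
    rw [hT.d_quad_eq hθ, ← hx]
    have : 0 ≤ C₁ * ε * F := by positivity
    linarith

end Bounds

/-- `L_{ε,θ}⁻¹` transported by the transfer operator is symmetric with respect to `d_0`. -/
theorem Transfer.exists_conj [CompleteSpace 𝓗] (hT : M.Transfer Vstar T E)
    (hamb : M.AmbientAssumptions) (h0 : 0 ∈ M.Θ) {θ : Param n} (hθ : θ ∈ M.Θ) {R : 𝓗 →L[ℂ] 𝓗}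
    (hR : IsSymm (M.d θ) R) :
    ∃ A : 𝓗 →L[ℂ] 𝓗, IsSymm (M.d 0) A ∧ spectrum ℂ A = spectrum ℂ R ∧
      ∀ f, E θ (A f) = R (E θ f) := by
  obtain ⟨c, _, hc, -, hcb⟩ := hamb.equiv θ hθ
  obtain ⟨_, C, -, hC, hCb⟩ := hamb.equiv 0 h0
  have hcont : Continuous (E θ : 𝓗 →ₗ[ℂ] 𝓗) := by
    -- Boundedness of `E θ` follows from the isometry between d_0 and d_θ.
    refine AddMonoidHomClass.continuous_of_bound (E θ : 𝓗 →ₗ[ℂ] 𝓗) √(C / c) fun u => ?_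
    refine le_of_sq_le_sq ?_ (by positivity)
    rw [mul_pow, Real.sq_sqrt (by positivity), div_mul_eq_mul_div, le_div_iff₀ hc, mul_comm]
    exact ((hcb (E θ u)).1.trans (hT.d_quad_eq hθ u).le).trans (hCb u).2
  let e : 𝓗 ≃L[ℂ] 𝓗 := (E θ).toContinuousLinearEquivOfContinuous hcont
  have he : ∀ u, e u = E θ u := fun _ => rfl
  let g : (𝓗 →L[ℂ] 𝓗)ˣ := (ContinuousLinearEquiv.unitsEquiv ℂ 𝓗).symm e
  have hg : ∀ u, (g : 𝓗 →L[ℂ] 𝓗) u = E θ u := fun _ => rfl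
  refine ⟨(↑g⁻¹ : 𝓗 →L[ℂ] 𝓗) * R * (g : 𝓗 →L[ℂ] 𝓗), ?_, spectrum.units_conjugate', ?_⟩
  · have key : ∀ f, E θ (((↑g⁻¹ : 𝓗 →L[ℂ] 𝓗) * R * (g : 𝓗 →L[ℂ] 𝓗)) f) = R (E θ f) := by
      intro f
      rw [← hg]
      exact unit_apply_inv_apply g _
    intro u v
    rw [← hT.d_eq θ hθ, ← hT.d_eq θ hθ, key, key, hR]
  · intro f
    rw [← hg]
    exact unit_apply_inv_apply g _

end Model

end

/-! ### Spectra of the two families. -/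

section

namespace Model

variable {n : ℕ} {H 𝓗 : Type*} [NormedAddCommGroup H] [InnerProductSpace ℂ H]
  [NormedAddCommGroup 𝓗] [InnerProductSpace ℂ 𝓗] {M : Model n H 𝓗}

variable {Vstar : Submodule ℂ H} {Z : Submodule ℂ (M.V 0)} {a' : M.FirstOrder}
  {a'' : M.SecondOrder} {T : Param n → Vstar →ₗ[ℂ] H} {E : Param n → 𝓗 ≃ₗ[ℂ] 𝓗} {κ : ℝ}

theorem IsDefectSubspace.limitInclusion_injective (hZ : M.IsDefectSubspace Vstar Z)
    (hamb : M.AmbientAssumptions) : Function.Injective (M.limitInclusion Vstar Z) :=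
  hamb.injective.comp hZ.sumMap_injective

theorem denseRange_limitEmbedding : DenseRange (M.limitEmbedding Vstar Z) := by
  intro y
  rw [Metric.mem_closure_range_iff]
  intro ε hε
  obtain ⟨x, ⟨p, rfl⟩, hx⟩ := Metric.mem_closure_iff.mp y.2 ε hε
  exact ⟨p, hx⟩

namespace Bounds

variable (hB : M.Bounds Vstar Z a' a'' T E κ) [CompleteSpace H] [CompleteSpace 𝓗]
include hB

/-- The spectra of `L_{ε,θ}` and its inverse, in terms of the resolvent. -/
theorem exists_spectra_opL (hamb : M.AmbientAssumptions) {θ : Param n} (hθ : θ ∈ M.Θ) {ε : ℝ}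
    (hε : 0 < ε) (hε1 : ε < 1) :
    ∃ R : 𝓗 →L[ℂ] 𝓗, IsResolvent (M.ι : H →ₗ[ℂ] 𝓗) (M.energy ε θ).form (M.d θ).form R ∧
      spectrumOf (M.opL ε θ).inverse = spectrum ℂ R ∧
      ∀ z, z ∈ spectrumOf (M.opL ε θ) ↔ z ≠ 0 ∧ z⁻¹ ∈ spectrum ℂ R := by
  obtain ⟨R, hR⟩ := hB.exists_resolvent_energy hamb hθ hε hε1
  obtain ⟨D, hD, hd⟩ := hamb.exists_d_bound hθ
  obtain ⟨c, _, hc, -, hcb⟩ := hamb.equiv θ hθ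
  have hinv : IsInverse (M.opL ε θ) R := hR.isInverse hc (fun u => (hcb u).1)
    (SForm.continuous_right hD hd)
    (fun q => (hamb.le_b q θ hθ).trans (b_quad_le_energy ε θ q)) hamb.injective hamb.denseRange
  exact ⟨R, hR, hinv.spectrumOf_inverse, hinv.mem_spectrumOf_iff⟩

/-- The spectra of `𝕃_ξ` and its inverse, in terms of the resolvent extended by zero to `𝓗`. -/
theorem exists_spectra_opLimit (hamb : M.AmbientAssumptions)
    (hint : (0 : Param n) ∈ interior M.Θ) (hZ : M.IsDefectSubspace Vstar Z) (ξ : Param n) :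
    ∃ B : 𝓗 →L[ℂ] 𝓗, IsResolvent (M.limitInclusion Vstar Z) (M.formS Vstar Z a' a'' ξ)
        (M.d 0).form B ∧
      (∀ z, z ≠ 0 → (z ∈ spectrumOf (M.opLimit Vstar Z a' a'' ξ).inverse ↔ z ∈ spectrum ℂ B)) ∧
      ∀ z, z ∈ spectrumOf (M.opLimit Vstar Z a' a'' ξ) ↔ z ≠ 0 ∧ z⁻¹ ∈ spectrum ℂ B := by
  have h0 : 0 ∈ M.Θ := interior_subset hint
  obtain ⟨B, hBr⟩ := hB.exists_resolvent_limit hamb hint hZ ξ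
  obtain ⟨D, hD, hd⟩ := hamb.exists_d_bound h0
  obtain ⟨c, _, hc, -, hcb⟩ := hamb.equiv 0 h0
  obtain ⟨s, hs, hsb⟩ := hB.exists_limitEnergy hint hZ.Vstar_le ξ
  have hmem : ∀ f, B f ∈ M.limitSpace Vstar Z := by
    intro f
    obtain ⟨p, hp, -⟩ := hBr f
    rw [← hp]
    exact (M.limitEmbedding Vstar Z p).2
  have : CompleteSpace (M.limitSpace Vstar Z) :=
    (Submodule.isClosed_topologicalClosure _).completeSpace_coe
  let R : M.limitSpace Vstar Z →L[ℂ] M.limitSpace Vstar Z :=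
    (B ∘L (M.limitSpace Vstar Z).subtypeL).codRestrict _ fun f => hmem f
  have hR : IsResolvent (M.limitEmbedding Vstar Z) s.form
      (M.limitInnerForm Vstar Z).form R := by
    intro f
    obtain ⟨p, hp, hp'⟩ := hBr f
    refine ⟨p, Subtype.ext hp, fun p' => ?_⟩
    rw [hs, hp']
    rfl
  have hinv : IsInverse (M.opLimit Vstar Z a' a'' ξ) R := by
    have := hR.isInverse hc (fun u => (hcb u).1)
      (SForm.continuous_right (s := (M.limitInnerForm Vstar Z).form) hD fun u v => hd u v)
      (fun q => (hamb.le_b _ 0 h0).trans (hsb q))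
      (fun p q hpq => hZ.limitInclusion_injective hamb (congrArg Subtype.val hpq))
      denseRange_limitEmbedding
    rw [hs] at this
    exact this
  have hres : ∀ z, z ≠ 0 → (z ∈ spectrum ℂ R ↔ z ∈ spectrum ℂ B) := fun z hz =>
    mem_spectrum_restrict_iff hmem (fun _ => rfl) hz
  refine ⟨B, hBr, fun z hz => ?_, fun z => ?_⟩
  · rw [hinv.spectrumOf_inverse, hres z hz]
  · rw [hinv.mem_spectrumOf_iff]
    exact and_congr_right fun hz => hres _ (inv_ne_zero hz)

/-- Spectral closeness of matched pairs of operators. -/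
theorem spectra_close (hT : M.Transfer Vstar T E)
    (hamb : M.AmbientAssumptions) (hint : (0 : Param n) ∈ interior M.Θ)
    (hcl : IsClosed (Vstar : Set H)) (hZ : M.IsDefectSubspace Vstar Z) {ρ : ℝ} (hρ : 0 < ρ) :
    ∃ C : ℝ, 0 < C ∧ ∀ ε : ℝ, 0 < ε → ε < 1 → ∀ θ ∈ M.Θ, ∀ ξ : Param n,
      (ξ = ε⁻¹ • θ ∨ ρ ≤ ‖θ‖ ∧ ρ ≤ ε * ‖ξ‖) → ∀ R B : 𝓗 →L[ℂ] 𝓗,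
      IsResolvent (M.ι : H →ₗ[ℂ] 𝓗) (M.energy ε θ).form (M.d θ).form R →
      IsResolvent (M.limitInclusion Vstar Z) (M.formS Vstar Z a' a'' ξ) (M.d 0).form B →
      (∀ z ∈ spectrum ℂ R, ∃ μ ∈ spectrum ℂ B, ‖z - μ‖ ≤ C * ε) ∧
      ∀ μ ∈ spectrum ℂ B, ∃ z ∈ spectrum ℂ R, ‖μ - z‖ ≤ C * ε := by
  have h0 : 0 ∈ M.Θ := interior_subset hint
  obtain ⟨C, hC, hclose⟩ := hB.resolvent_close hT hamb hint hcl hZ hρ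
  obtain ⟨c, C₀, hc, hC₀, hb⟩ := hamb.equiv 0 h0
  refine ⟨C, hC, fun ε hε hε1 θ hθ ξ hξ R B hR hBr => ?_⟩
  have hd := hclose ε hε hε1 θ hθ ξ hξ R B hR hBr
  -- Now `A` and `B` are both symmetric for d_0; the perturbation lemma is applied once with each as
  -- the reference operator.
  obtain ⟨A, hA, hspec, hAE⟩ := hT.exists_conj hamb h0 hθ hR.isSymm
  obtain ⟨s, hs, -⟩ := hB.exists_limitEnergy hint hZ.Vstar_le ξ
  rw [← hs] at hBr
  have hAB : ∀ f, (M.d 0).quad (A f - B f) ≤ (C * ε) ^ 2 * (M.d 0).quad f := by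
    intro f
    rw [← hT.d_quad_eq hθ, map_sub, hAE]
    exact hd f
  have hBA : ∀ f, (M.d 0).quad (B f - A f) ≤ (C * ε) ^ 2 * (M.d 0).quad f := by
    intro f
    rw [← neg_sub, NonnegForm.quad_neg]
    exact hAB f
  rw [← hspec]
  exact ⟨fun z hz => exists_mem_spectrum_near hc hC₀.le (fun u => (hb u).1) (fun u => (hb u).2)
      hBr.isSymm (by positivity) hAB hz,
    fun z hz => exists_mem_spectrum_near hc hC₀.le (fun u => (hb u).1) (fun u => (hb u).2)
      hA (by positivity) hBA hz⟩

/-- Since d_θ ≤ b_θ is dominated by the energy, the resolvent is a positive contraction; its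
spectrum lies in [0, 1] and that of its inverse in [1, ∞). -/
theorem opL_spectrum_real (hamb : M.AmbientAssumptions) {θ : Param n} (hθ : θ ∈ M.Θ) {ε : ℝ}
    (hε : 0 < ε) (hε1 : ε < 1) {z : ℂ} (hz : z ∈ spectrumOf (M.opL ε θ)) :
    ∃ t : ℝ, 1 ≤ t ∧ z = t := by
  obtain ⟨R, hR, -, hR'⟩ := hB.exists_spectra_opL hamb hθ hε hε1
  obtain ⟨c, C₀, hc, hC₀, hb⟩ := hamb.equiv θ hθ
  obtain ⟨hz0, hz1⟩ := (hR' z).mp hz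
  obtain ⟨x, hx0, hx1, hzx⟩ := spectrum_subset_Icc hc hC₀.le (fun u => (hb u).1)
    (fun u => (hb u).2) hR.isSymm hR.form_nonneg
    (hR.quad_le fun q => (hamb.le_b q θ hθ).trans (b_quad_le_energy ε θ q)) hz1
  have hx : x ≠ 0 := by
    rintro rfl
    rw [Complex.ofReal_zero, inv_eq_zero] at hzx
    exact hz0 hzx
  exact ⟨x⁻¹, (one_le_inv₀ (lt_of_le_of_ne hx0 hx.symm)).mpr hx1, by
    rw [Complex.ofReal_inv, ← hzx, inv_inv]⟩

theorem opLimit_spectrum_real (hamb : M.AmbientAssumptions)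
    (hint : (0 : Param n) ∈ interior M.Θ) (hZ : M.IsDefectSubspace Vstar Z) {ξ : Param n} {z : ℂ}
    (hz : z ∈ spectrumOf (M.opLimit Vstar Z a' a'' ξ)) : ∃ t : ℝ, 1 ≤ t ∧ z = t := by
  have h0 : 0 ∈ M.Θ := interior_subset hint
  obtain ⟨B, hBr, -, hB'⟩ := hB.exists_spectra_opLimit hamb hint hZ ξ
  obtain ⟨s, hs, hsb⟩ := hB.exists_limitEnergy hint hZ.Vstar_le ξ
  rw [← hs] at hBr
  obtain ⟨c, C₀, hc, hC₀, hb⟩ := hamb.equiv 0 h0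
  obtain ⟨hz0, hz1⟩ := (hB' z).mp hz
  obtain ⟨x, hx0, hx1, hzx⟩ := spectrum_subset_Icc hc hC₀.le (fun u => (hb u).1)
    (fun u => (hb u).2) hBr.isSymm hBr.form_nonneg
    (hBr.quad_le fun q => (hamb.le_b _ 0 h0).trans (hsb q)) hz1
  have hx : x ≠ 0 := by
    rintro rfl
    rw [Complex.ofReal_zero, inv_eq_zero] at hzx
    exact hz0 hzx
  exact ⟨x⁻¹, (one_le_inv₀ (lt_of_le_of_ne hx0 hx.symm)).mpr hx1, by
    rw [Complex.ofReal_inv, ← hzx, inv_inv]⟩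

/-- If the limit operators have spectrum at all, then the bottom of the spectrum of `L_{ε,0}` is
bounded uniformly in `ε`. -/
theorem exists_opL_spectrum_bounded (hamb : M.AmbientAssumptions)
    (hint : (0 : Param n) ∈ interior M.Θ) (hZ : M.IsDefectSubspace Vstar Z)
    (hne : (⋃ ξ : Param n, spectrumOf (M.opLimit Vstar Z a' a'' ξ)).Nonempty) :
    ∃ m : ℝ, 0 ≤ m ∧ ∀ ε : ℝ, 0 < ε → ε < 1 → ∃ y ∈ spectrumOf (M.opL ε 0), ‖y‖ ≤ m := by
  have h0 : 0 ∈ M.Θ := interior_subset hint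
  obtain ⟨z, hz⟩ := hne
  obtain ⟨ξ, hz⟩ := Set.mem_iUnion.mp hz
  obtain ⟨B, hBr, -, hB'⟩ := hB.exists_spectra_opLimit hamb hint hZ ξ
  obtain ⟨hz0, hz1⟩ := (hB' z).mp hz
  -- Otherwise `B` would vanish, contradicting its nonzero spectral value.
  have hp : ∃ p, M.limitInclusion Vstar Z p ≠ 0 := by
    by_contra! hall
    have hB0 : B = 0 := by
      ext f
      obtain ⟨p, hp, -⟩ := hBr f
      rw [← hp, hall p]; rfl
    rw [hB0, spectrum.mem_iff, sub_zero] at hz1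
    exact hz1 ((IsUnit.mk0 _ (inv_ne_zero hz0)).map (algebraMap ℂ (𝓗 →L[ℂ] 𝓗)))
  obtain ⟨p, hp⟩ := hp
  set q := M.sumMap Vstar Z p with hq
  have hp : M.ι q ≠ 0 := hp
  obtain ⟨c, C₀, hc, hC₀, hb⟩ := hamb.equiv 0 h0
  have hdq : 0 < (M.d 0).quad (M.ι q) :=
    lt_of_lt_of_le (mul_pos hc (pow_pos (norm_pos_iff.mpr hp) 2)) (hb _).1
  have hbq : 0 < (M.b 0).quad q := hdq.trans_le (hamb.le_b q 0 h0)
  refine ⟨(M.b 0).quad q / (M.d 0).quad (M.ι q), by positivity, fun ε hε hε1 => ?_⟩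
  obtain ⟨R, hR, -, hR'⟩ := hB.exists_spectra_opL hamb h0 hε hε1
  -- As q lies in V_0, its energy at θ = 0 does not depend on ε, and neither does the resulting
  -- bound.
  have heq : (M.energy ε 0).quad q = (M.b 0).quad q := by
    have : (M.a 0).quad q = 0 := by
      rw [NonnegForm.quad, M.a_left_eq_zero (hZ.sumMap_mem p), Complex.zero_re]
    rw [energy_quad, this, mul_zero, zero_add]
  obtain ⟨y, hy, hy'⟩ := hR.exists_mem_spectrum_ge hc hC₀.le (fun u => (hb u).1)
    (fun u => (hb u).2) (q := q) hdq ((hamb.le_b q 0 h0).trans heq.ge)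
  rw [heq] at hy'
  have hpos : 0 < (M.d 0).quad (M.ι q) / (M.b 0).quad q := by positivity
  have hy0 : y ≠ 0 := norm_pos_iff.mp (hpos.trans_le hy')
  refine ⟨y⁻¹, (hR' _).mpr ⟨inv_ne_zero hy0, by rwa [inv_inv]⟩, ?_⟩
  rw [norm_inv, ← inv_div]
  exact inv_anti₀ hpos hy'

end Bounds

end Model

end

end DegenerateForms

end

/-! ### Assembly of the two distance estimates. -/

theorem theoremt {n : ℕ} (hn : 1 ≤ n) {H 𝓗 : Type*}
    [NormedAddCommGroup H] [InnerProductSpace ℂ H] [CompleteSpace H]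
    [TopologicalSpace.SeparableSpace H]
    [NormedAddCommGroup 𝓗] [InnerProductSpace ℂ 𝓗] [CompleteSpace 𝓗]
    [TopologicalSpace.SeparableSpace 𝓗]
    (M : DegenerateForms.Model n H 𝓗)
    (hform : M.FormAssumptions) (hamb : M.AmbientAssumptions)
    (hzero : (0 : DegenerateForms.Param n) ∈ interior M.Θ) (hconn : IsConnected M.Θ)
    (Vstar : Submodule ℂ H) (Z : Submodule ℂ (M.V 0))
    (a' : M.FirstOrder) (a'' : M.SecondOrder)
    (H1 : M.GapCondition)
    (H2 : M.RemovableSingularity Vstar) (hZ : M.IsDefectSubspace Vstar Z)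
    (H3 : M.QuadraticGap)
    (H4 : M.Differentiability a' a'')
    (H5 : M.LipschitzAtZero)
    (H6 : M.TransferExtends Vstar Z) :
    (∃ C : ℝ, 0 < C ∧ ∀ ε : ℝ, 0 < ε → ε < 1 →
      Metric.hausdorffEDist
        ((⋃ θ ∈ M.Θ, DegenerateForms.spectrumOf (M.opL ε θ).inverse) ∪ {0})
        ((⋃ ξ : DegenerateForms.Param n,
          DegenerateForms.spectrumOf (M.opLimit Vstar Z a' a'' ξ).inverse) ∪ {0})
        ≤ ENNReal.ofReal (C * ε)) ∧
    (∃ C : ℝ, ∀ b : ℝ, ∃ Cb : ℝ, 0 ≤ Cb ∧ Cb ≤ C * (1 + b ^ 2) ∧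
      ∀ a : ℝ, a ≤ b → ∀ ε : ℝ, 0 < ε → ε < 1 →
        DegenerateForms.distOn a b
          (closure (⋃ θ ∈ M.Θ, DegenerateForms.spectrumOf (M.opL ε θ)))
          (closure (⋃ ξ : DegenerateForms.Param n,
            DegenerateForms.spectrumOf (M.opLimit Vstar Z a' a'' ξ)))
          ≤ ENNReal.ofReal (Cb * ε)) := by
  have h0 : 0 ∈ M.Θ := interior_subset hzero
  obtain ⟨T, E, hT1, hT2, hT3, hT4, hT5, hT6, hT7⟩ := H6
  obtain ⟨κ, hB⟩ := DegenerateForms.Model.exists_bounds hform h0 H1 H2 hZ H3 H4 H5 hT3 hT6 hT7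
  have hT : M.Transfer Vstar T E := ⟨fun θ hθ => (hT1 θ hθ).2, hT2, hT4, hT5⟩
  obtain ⟨ρ, hρ, hρΘ⟩ := DegenerateForms.Model.exists_closedBall_subset hzero
  obtain ⟨C, hC, hclose⟩ := hB.spectra_close hT hamb hzero H2.isClosed hZ hρ
  -- If ε|ξ| ≤ ρ then εξ lies in Θ. Any larger ξ is paired with a parameter of norm ρ, since far
  -- from 0 no exact matching is needed.
  have hmatch : ∀ ε : ℝ, 0 < ε → ∀ ξ : DegenerateForms.Param n,
      ∃ θ ∈ M.Θ, ξ = ε⁻¹ • θ ∨ ρ ≤ ‖θ‖ ∧ ρ ≤ ε * ‖ξ‖ := by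
    intro ε hε ξ
    rcases le_total (ε * ‖ξ‖) ρ with h | h
    · refine ⟨ε • ξ, hρΘ _ ?_, Or.inl (inv_smul_smul₀ hε.ne' ξ).symm⟩
      rwa [norm_smul, Real.norm_of_nonneg hε.le]
    · have hξ : ξ ≠ 0 := by
        rintro rfl
        rw [norm_zero, mul_zero] at h
        linarith
      have hn := DegenerateForms.Model.exists_smul_norm_eq hξ hρ.le
      exact ⟨_, hρΘ _ hn.le, Or.inr ⟨hn.ge, h⟩⟩
  refine ⟨⟨C, hC, fun ε hε hε1 => ?_⟩, ?_⟩
  · have hCε : 0 ≤ C * ε := by positivity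
    refine DegenerateForms.hausdorffEDist_le_of_norm_sub_le ?_ ?_
    · rintro x (hx | hx)
      · obtain ⟨θ, hθ, hx⟩ := Set.mem_iUnion₂.mp hx
        obtain ⟨R, hR, hRs, -⟩ := hB.exists_spectra_opL hamb hθ hε hε1
        obtain ⟨B, hBr, hBs, -⟩ := hB.exists_spectra_opLimit hamb hzero hZ (ε⁻¹ • θ)
        rw [hRs] at hx
        obtain ⟨μ, hμ, hd⟩ := (hclose ε hε hε1 θ hθ _ (Or.inl rfl) R B hR hBr).1 x hx
        refine ⟨μ, ?_, hd⟩
        -- Passing from 𝓗_0 to 𝓗 may add 0 to the spectrum; the adjoined {0} makes this harmless.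
        rcases eq_or_ne μ 0 with rfl | hμ0
        · exact Or.inr rfl
        · exact Or.inl (Set.mem_iUnion.mpr ⟨_, (hBs μ hμ0).mpr hμ⟩)
      · rw [Set.mem_singleton_iff] at hx
        exact ⟨0, Or.inr rfl, by simpa [hx] using hCε⟩
    · intro y hy
      rcases eq_or_ne y 0 with rfl | hy0
      · exact ⟨0, Or.inr rfl, by simpa using hCε⟩
      · obtain ⟨ξ, hy⟩ := Set.mem_iUnion.mp (hy.resolve_right hy0)
        obtain ⟨θ, hθ, hm⟩ := hmatch ε hε ξ
        obtain ⟨R, hR, hRs, -⟩ := hB.exists_spectra_opL hamb hθ hε hε1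
        obtain ⟨B, hBr, hBs, -⟩ := hB.exists_spectra_opLimit hamb hzero hZ ξ
        obtain ⟨z, hz, hd⟩ :=
          (hclose ε hε hε1 θ hθ ξ hm R B hR hBr).2 y ((hBs y hy0).mp hy)
        exact ⟨z, Or.inl (Set.mem_iUnion₂.mpr ⟨θ, hθ, by rwa [hRs]⟩), hd⟩
  · set Y := ⋃ ξ : DegenerateForms.Param n, DegenerateForms.spectrumOf (M.opLimit Vstar Z a' a'' ξ) with hY
    -- The modulus bound must be uniform in ε on both sides. If `Y` is empty, both distances are 0
    -- by convention and any `m` serves.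
    have hm : ∃ m : ℝ, 0 ≤ m ∧ (Y.Nonempty → (∃ y ∈ Y, ‖y‖ ≤ m) ∧
        ∀ ε : ℝ, 0 < ε → ε < 1 → ∃ y ∈ DegenerateForms.spectrumOf (M.opL ε 0), ‖y‖ ≤ m) := by
      by_cases hne : Y.Nonempty
      · obtain ⟨m, hm0, hm⟩ := hB.exists_opL_spectrum_bounded hamb hzero hZ hne
        obtain ⟨y, hy⟩ := hne
        exact ⟨max m ‖y‖, le_max_of_le_left hm0, fun _ => ⟨⟨y, hy, le_max_right _ _⟩,
          fun ε hε hε1 => (hm ε hε hε1).imp fun x hx => ⟨hx.1, hx.2.trans (le_max_left _ _)⟩⟩⟩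
      · exact ⟨0, le_rfl, fun h => absurd h hne⟩
    obtain ⟨m, hm0, hm⟩ := hm
    refine ⟨4 * C * (1 + m), fun b => ⟨4 * C * (1 + m) * (1 + b ^ 2), by positivity, le_rfl,
      fun a _ ε hε hε1 => ?_⟩⟩
    have hXreal : ∀ x ∈ ⋃ θ ∈ M.Θ, DegenerateForms.spectrumOf (M.opL ε θ), ∃ t : ℝ, 1 ≤ t ∧ x = t := by
      intro x hx
      obtain ⟨θ, hθ, hx⟩ := Set.mem_iUnion₂.mp hx
      exact hB.opL_spectrum_real hamb hθ hε hε1 hx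
    have hYreal : ∀ y ∈ Y, ∃ t : ℝ, 1 ≤ t ∧ y = t := by
      intro y hy
      obtain ⟨ξ, hy⟩ := Set.mem_iUnion.mp hy
      exact hB.opLimit_spectrum_real hamb hzero hZ hy
    refine max_le (DegenerateForms.directedDist_closure_le hXreal hC hε hm0 ?_ fun _ h => (hm h).1)
      (DegenerateForms.directedDist_closure_le hYreal hC hε hm0 ?_ fun h _ => ?_)
    · intro x hx
      obtain ⟨θ, hθ, hx⟩ := Set.mem_iUnion₂.mp hx
      obtain ⟨R, hR, -, hRs⟩ := hB.exists_spectra_opL hamb hθ hε hε1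
      obtain ⟨B, hBr, -, hBs⟩ := hB.exists_spectra_opLimit hamb hzero hZ (ε⁻¹ • θ)
      obtain ⟨μ, hμ, hd⟩ :=
        (hclose ε hε hε1 θ hθ _ (Or.inl rfl) R B hR hBr).1 _ ((hRs x).mp hx).2
      refine ⟨μ, hd, or_iff_not_imp_left.mpr fun hμ0 => ?_⟩
      exact Set.mem_iUnion.mpr ⟨_, (hBs _).mpr ⟨inv_ne_zero hμ0, by rwa [inv_inv]⟩⟩
    · intro y hy
      obtain ⟨ξ, hy⟩ := Set.mem_iUnion.mp hy
      obtain ⟨θ, hθ, hmt⟩ := hmatch ε hε ξ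
      obtain ⟨R, hR, -, hRs⟩ := hB.exists_spectra_opL hamb hθ hε hε1
      obtain ⟨B, hBr, -, hBs⟩ := hB.exists_spectra_opLimit hamb hzero hZ ξ
      obtain ⟨μ, hμ, hd⟩ :=
        (hclose ε hε hε1 θ hθ ξ hmt R B hR hBr).2 _ ((hBs y).mp hy).2
      refine ⟨μ, hd, or_iff_not_imp_left.mpr fun hμ0 => ?_⟩
      exact Set.mem_iUnion₂.mpr ⟨θ, hθ, (hRs _).mpr ⟨inv_ne_zero hμ0, by rwa [inv_inv]⟩⟩
    · obtain ⟨y, hy, hym⟩ := (hm h).2 ε hε hε1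
      exact ⟨y, Set.mem_iUnion₂.mpr ⟨0, h0, hy⟩, hym⟩
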